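/- **Theorem 3.1.** There is an integer $N$ (a sufficient order of smoothness) with the following property. Let $\lambda=\pm1$, $L>0$, $0<T<\infty$, and let $q\in C^N([0,L]\times[0,T])$ (smooth up to the boundary) satisfy $$iq_t+q_{xx}-2\lambda|q|^2q=0\quad(0<x<L,\ 0<t<T),\qquad q(x,0)=0\quad(0\le x\le L).$$ Let $g_0(t)=q(0,t)$, $h_0(t)=q(L,t)$, $g_1(t)=q_x(0,t)$, $h_1(t)=q_x(L,t)$. Put $\sigma_3=\mathrm{diag}(1,-1)$, $\hat\sigma_3M=[\sigma_3,M]$, $$Q=\begin{pmatrix}0&q\\ \lambda\bar q&0\end{pmatrix},\qquad \tilde Q=2kQ-i(Q_x+\lambda|q|^2)\sigma_3 .$$ For each of the corners $(x_1,t_1)=(0,T)$, $(x_2,t_2)=(0,0)$, $(x_3,t_3)=(L,0)$, $(x_4,t_4)=(L,T)$ there is exactly one function $\mu_j(x,t,k)$ on $[0,L]\times[0,T]\times\mathbb C$, continuous in $(x,t)$, with $$\mu_j(x,t,k)=I+\int_{t_j}^{t}e^{-i(k(x-x_j)+2k^2(t-t'))\hat\sigma_3}(\tilde Q\mu_j)(x_j,t',k)\,dt'+\int_{x_j}^{x}e^{-ik(x-x')\hat\sigma_3}(Q\mu_j)(x',t,k)\,dx'.$$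 Write $\bar f(k)=\overline{f(\bar k)}$. The matrices $\mu_1(0,0,k)$, $\mu_4(L,0,k)$, $\mu_2(0,t,k)$, $\mu_3(L,t,k)$ have the form $\begin{pmatrix}\bar f_2&f_1\\ \lambda\bar f_1&f_2\end{pmatrix}$ with $(f_1,f_2)$ equal to $(B,A)$, $(\mathcal B,\mathcal A)$, $(\Phi_1,\Phi_2)(t,\cdot)$, $(\varphi_1,\varphi_2)(t,\cdot)$ respectively; this defines the spectral functions $A,B,\mathcal A,\mathcal B$ and the functions $\Phi_j,\varphi_j$. For all $k\in\mathbb C$, $$A(k)=\overline{\Phi_2(T,\bar k)},\quad B(k)=-\Phi_1(T,k)e^{4ik^2T},\quad \mathcal A(k)=\overline{\varphi_2(T,\bar k)},\quad \mathcal B(k)=-\varphi_1(T,k)e^{4ik^2T},$$ and, for $0\le t\le T$ and $k\in\mathbb C$, $$\Phi_1(t,k)=\int_0^te^{4ik^2(t'-t)}\bigl[-i\lambda|g_0|^2\Phi_1+(2kg_0+ig_1)\Phi_2\bigr](t',k)\,dt',$$ $$\Phi_2(t,k)=1+\lambda\int_0^t\bigl[(2k\bar g_0-i\bar g_1)\Phi_1+i|g_0|^2\Phi_2\bigr](t',k)\,dt',$$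 and $\varphi_1,\varphi_2$ satisfy the same equations with $g_0,g_1$ replaced by $h_0,h_1$. Let $\Delta(k)=e^{2ikL}-e^{-2ikL}$, $\Sigma(k)=e^{2ikL}+e^{-2ikL}$, $f_\pm(k)=f(k)\pm f(-k)$. For $0<\varepsilon<\pi/(4L)$ let $\partial D_3^0$ be the boundary of the third quadrant, oriented from $-i\infty$ through $0$ to $-\infty$ and indented so that it passes below each zero $-\frac{n\pi}{2L}$ ($n=0,1,2,\dots$) of $\Delta$ along the circle of radius $\varepsilon$ about it. Integrals over $\partial D_3^0$ are limits as $R\to\infty$ of the integrals over the part from $-iR$ to $-R$, where $R$ runs through the radii such that $-R$ is not within distance less than $\varepsilon$ of a zero of $\Delta$. Then, for every such $\varepsilon$ and every $t\in[0,T]$, the following integrals exist and the formulas hold (all functions being evaluated at $(t,k)$, $g_0,h_0$ at $t$). (a) (Dirichlet problem.) $$g_1(t)=\frac4{\pi i}\int_{\partial D_3^0}\Bigl\{\frac{\Sigma}{2\Delta}[k\Phi_{1-}+ig_0]-\frac1\Delta[k\varphi_{1-}+ih_0]+\frac{g_0}{4i}\varphi_{2-}+\frac{ig_0}2\Phi_{2-}+\frac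 k\Delta\bigl[(\bar\varphi_2-1)\Phi_1e^{-2ikL}-\varphi_1(\bar\Phi_2-1)\bigr]_-\Bigr\}dk,$$ $$h_1(t)=\frac4{\pi i}\int_{\partial D_3^0}\Bigl\{-\frac{\Sigma}{2\Delta}[k\varphi_{1-}+ih_0]+\frac1\Delta[k\Phi_{1-}+ig_0]+\frac{h_0}{4i}\Phi_{2-}+\frac{ih_0}2\varphi_{2-}+\frac k\Delta\bigl[(\bar\varphi_2-1)\Phi_1-\varphi_1(\bar\Phi_2-1)e^{2ikL}\bigr]_-\Bigr\}dk.$$ (b) (Neumann problem.) $$g_0(t)=\frac2\pi\int_{\partial D_3^0}\frac1\Delta\Bigl\{\frac\Sigma2\Phi_{1+}-\varphi_{1+}+\bigl[\Phi_1(\bar\varphi_2-1)e^{-2ikL}-(\bar\Phi_2-1)\varphi_1\bigr]_+\Bigr\}dk,$$ $$h_0(t)=\frac2\pi\int_{\partial D_3^0}\frac1\Delta\Bigl\{-\frac\Sigma2\varphi_{1+}+\Phi_{1+}+\bigl[(\bar\varphi_2-1)\Phi_1-e^{2ikL}(\bar\Phi_2-1)\varphi_1\bigr]_+\Bigr\}dk.$$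 -/

import Mathlib

open Set Filter Topology

namespace NLSInterval

/-- A `C^N` (up to the boundary) solution `q(x,t)` on `[0,L] × [0,T]` of the nonlinear Schrödinger
equation `i q_t + q_xx - 2 lam |q|² q = 0` that vanishes at `t = 0`. -/
structure IsSolution (N : ℕ) (lam L T : ℝ) (q : ℝ → ℝ → ℂ) : Prop where
  contDiffOn : ContDiffOn ℝ N (fun p : ℝ × ℝ => q p.1 p.2) (Icc 0 L ×ˢ Icc 0 T)
  nls : ∀ x ∈ Ioo 0 L, ∀ t ∈ Ioo 0 T,
    Complex.I * deriv (fun s => q x s) t + deriv (deriv (fun y => q y t)) x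
      - 2 * (lam : ℂ) * ((‖q x t‖ ^ 2 : ℝ) : ℂ) * q x t = 0
  initial : ∀ x ∈ Icc 0 L, q x 0 = 0

/-- `g₀, h₀` are the Dirichlet and `g₁, h₁` the Neumann boundary values of `q` at `x = 0` and
`x = L` (the latter as one-sided derivatives). -/
structure HasBoundaryValues (L T : ℝ) (q : ℝ → ℝ → ℂ) (g₀ g₁ h₀ h₁ : ℝ → ℂ) : Prop where
  left_dirichlet : ∀ t ∈ Icc 0 T, q 0 t = g₀ t
  right_dirichlet : ∀ t ∈ Icc 0 T, q L t = h₀ t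
  left_neumann : ∀ t ∈ Icc 0 T, HasDerivWithinAt (fun x => q x t) (g₁ t) (Icc 0 L) 0
  right_neumann : ∀ t ∈ Icc 0 T, HasDerivWithinAt (fun x => q x t) (h₁ t) (Icc 0 L) L

/-- The Pauli matrix `σ₃ = diag(1, -1)`. -/
def sigma3 : Matrix (Fin 2) (Fin 2) ℂ := !![1, 0; 0, -1]

/-- `e^{a σ̂₃} M = e^{a σ₃} M e^{-a σ₃}`, where `σ̂₃ M = [σ₃, M]`. -/
noncomputable def expHat (a : ℂ) (M : Matrix (Fin 2) (Fin 2) ℂ) : Matrix (Fin 2) (Fin 2) ℂ :=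
  !![Complex.exp a, 0; 0, Complex.exp (-a)] * M * !![Complex.exp (-a), 0; 0, Complex.exp a]

/-- The matrix `Q` of the `x`-part of the Lax pair. -/
noncomputable def laxQ (lam : ℝ) (q : ℝ → ℝ → ℂ) (x t : ℝ) : Matrix (Fin 2) (Fin 2) ℂ :=
  !![0, q x t; (lam : ℂ) * (starRingEnd ℂ) (q x t), 0]

/-- The matrix `Q_x`; the `x`-derivative is one-sided at the end points of `[0,L]`. -/
noncomputable def laxQx (lam L : ℝ) (q : ℝ → ℝ → ℂ) (x t : ℝ) : Matrix (Fin 2) (Fin 2) ℂ :=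
  !![0, derivWithin (fun y => q y t) (Icc 0 L) x;
     (lam : ℂ) * (starRingEnd ℂ) (derivWithin (fun y => q y t) (Icc 0 L) x), 0]

/-- The matrix `Q̃ = 2kQ - i(Q_x + lam |q|²)σ₃` of the `t`-part of the Lax pair. -/
noncomputable def laxQt (lam L : ℝ) (q : ℝ → ℝ → ℂ) (x t : ℝ) (k : ℂ) :
    Matrix (Fin 2) (Fin 2) ℂ :=
  (2 * k) • laxQ lam q x t
    - Complex.I • ((laxQx lam L q x t
        + ((lam : ℂ) * ((‖q x t‖ ^ 2 : ℝ) : ℂ)) • (1 : Matrix (Fin 2) (Fin 2) ℂ)) * sigma3)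

/-- `μ(x,t,k)` is the eigenfunction of the Lax pair normalized at the corner `(x₀,t₀)`:
`μ(x,t,k) = I + ∫_{(x₀,t₀)}^{(x,t)} e^{-i(kx+2k²t)σ̂₃} W`, with
`W = e^{i(kx'+2k²t')σ̂₃} (Q dx' + Q̃ dt') μ`. The form `W` is closed; the path of integration
runs first along the side `x' = x₀` and then along the horizontal line `t' = t`. Matrices are
integrated entry by entry. -/
structure IsEigenfunction (lam L T : ℝ) (q : ℝ → ℝ → ℂ) (x₀ t₀ : ℝ)
    (μ : ℝ → ℝ → ℂ → Matrix (Fin 2) (Fin 2) ℂ) : Prop where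
  continuousOn : ∀ k : ℂ, ContinuousOn (fun p : ℝ × ℝ => μ p.1 p.2 k) (Icc 0 L ×ˢ Icc 0 T)
  integral_eq : ∀ x ∈ Icc 0 L, ∀ t ∈ Icc 0 T, ∀ k : ℂ, ∀ i j : Fin 2,
    μ x t k i j = (1 : Matrix (Fin 2) (Fin 2) ℂ) i j
      + (∫ t' in t₀..t,
          expHat (-Complex.I * (k * ((x - x₀ : ℝ) : ℂ) + 2 * k ^ 2 * ((t - t' : ℝ) : ℂ)))
            (laxQt lam L q x₀ t' k * μ x₀ t' k) i j)
      + ∫ x' in x₀..x,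
          expHat (-Complex.I * (k * ((x - x' : ℝ) : ℂ))) (laxQ lam q x' t * μ x' t k) i j

/-- `f̄(k) = conj (f (conj k))`. -/
noncomputable def bar (f : ℂ → ℂ) (k : ℂ) : ℂ := (starRingEnd ℂ) (f ((starRingEnd ℂ) k))

/-- `f₊(k) = f(k) + f(-k)`. -/
def evenPart (f : ℂ → ℂ) (k : ℂ) : ℂ := f k + f (-k)

/-- `f₋(k) = f(k) - f(-k)`. -/
def oddPart (f : ℂ → ℂ) (k : ℂ) : ℂ := f k - f (-k)

/-- The matrix `(f̄₂, f₁; lam f̄₁, f₂)` as a function of `k`. -/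
noncomputable def symMatrix (lam : ℝ) (f₁ f₂ : ℂ → ℂ) (k : ℂ) : Matrix (Fin 2) (Fin 2) ℂ :=
  !![bar f₂ k, f₁ k; (lam : ℂ) * bar f₁ k, f₂ k]

/-- `E(k) = e^{2ikL}`, so that `e^{-2ikL} = E(-k)`. -/
noncomputable def expL (L : ℝ) (k : ℂ) : ℂ := Complex.exp (2 * Complex.I * k * L)

/-- `Δ(k) = e^{2ikL} - e^{-2ikL}`. -/
noncomputable def Delta (L : ℝ) (k : ℂ) : ℂ := expL L k - expL L (-k)

/-- `Σ(k) = e^{2ikL} + e^{-2ikL}`. -/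
noncomputable def Sig (L : ℝ) (k : ℂ) : ℂ := expL L k + expL L (-k)

/-- The `n`-th nonnegative zero `nπ/(2L)` of `Δ`. -/
noncomputable def zeroPt (L : ℝ) (n : ℕ) : ℝ := n * Real.pi / (2 * L)

/-- The integral of `f` over the circular arc `c + ε e^{iθ}`, with `θ` running from `a` to `b`. -/
noncomputable def arcIntegral (c : ℂ) (ε a b : ℝ) (f : ℂ → ℂ) : ℂ :=
  ∫ θ in a..b, f (c + ε * Complex.exp (θ * Complex.I)) * (Complex.I * ε * Complex.exp (θ * Complex.I))

/-- The integral of `f` over the part from `-iR` to `-R` of the following contour `∂D₃⁰`: up the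
negative imaginary axis to `-iε`, clockwise along the circle of radius `ε` about `0` to `-ε`, and
then to the left along the negative real axis, where each zero `-nπ/(2L)` of `Δ`, `n ≥ 1`, is
avoided along the lower half of the circle of radius `ε` about it. -/
noncomputable def truncatedIntegral (L ε R : ℝ) (f : ℂ → ℂ) : ℂ :=
  (∫ y in ε..R, f (-Complex.I * y) * Complex.I)
    + arcIntegral 0 ε (-(Real.pi / 2)) (-Real.pi) f
    + ∑ n ∈ Finset.range ⌊2 * L * R / Real.pi⌋₊,
        (-(∫ s in (zeroPt L n + ε)..(zeroPt L (n + 1) - ε), f (-(s : ℂ)))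
          + arcIntegral (-(zeroPt L (n + 1) : ℂ)) ε 0 (-Real.pi) f)
    - ∫ s in (zeroPt L ⌊2 * L * R / Real.pi⌋₊ + ε)..R, f (-(s : ℂ))

/-- The (improper) integral `∫_{∂D₃⁰} f(k) dk` exists and equals `J`: it is the limit, as
`R → ∞`, of the integrals over the part of the contour in `|k| ≤ R`; here `R` runs through the
radii for which the end point `-R` does not lie in the interior of one of the indentations. -/
def HasContourIntegral (L ε : ℝ) (f : ℂ → ℂ) (J : ℂ) : Prop :=
  Tendsto (fun R : ℝ => truncatedIntegral L ε R f)
    (atTop ⊓ 𝓟 {R : ℝ | ∀ n : ℕ, ε ≤ |R - zeroPt L n|}) (𝓝 J)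

/-- The integrand of the representation of `g₁` (at a fixed time). -/
noncomputable def integrand_g₁ (L : ℝ) (g₀ h₀ : ℂ) (Φ₁ Φ₂ φ₁ φ₂ : ℂ → ℂ) (k : ℂ) : ℂ :=
  Sig L k / (2 * Delta L k) * (k * oddPart Φ₁ k + Complex.I * g₀)
    - 1 / Delta L k * (k * oddPart φ₁ k + Complex.I * h₀)
    + g₀ / (4 * Complex.I) * oddPart φ₂ k + Complex.I * g₀ / 2 * oddPart Φ₂ k
    + k / Delta L k *
      oddPart (fun z => (bar φ₂ z - 1) * Φ₁ z * expL L (-z) - φ₁ z * (bar Φ₂ z - 1)) k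

/-- The integrand of the representation of `h₁` (at a fixed time). -/
noncomputable def integrand_h₁ (L : ℝ) (g₀ h₀ : ℂ) (Φ₁ Φ₂ φ₁ φ₂ : ℂ → ℂ) (k : ℂ) : ℂ :=
  -(Sig L k / (2 * Delta L k)) * (k * oddPart φ₁ k + Complex.I * h₀)
    + 1 / Delta L k * (k * oddPart Φ₁ k + Complex.I * g₀)
    + h₀ / (4 * Complex.I) * oddPart Φ₂ k + Complex.I * h₀ / 2 * oddPart φ₂ k
    + k / Delta L k *
      oddPart (fun z => (bar φ₂ z - 1) * Φ₁ z - φ₁ z * (bar Φ₂ z - 1) * expL L z) k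

/-- The integrand of the representation of `g₀` (at a fixed time). -/
noncomputable def integrand_g₀ (L : ℝ) (Φ₁ Φ₂ φ₁ φ₂ : ℂ → ℂ) (k : ℂ) : ℂ :=
  1 / Delta L k * (Sig L k / 2 * evenPart Φ₁ k - evenPart φ₁ k
    + evenPart (fun z => Φ₁ z * (bar φ₂ z - 1) * expL L (-z) - (bar Φ₂ z - 1) * φ₁ z) k)

/-- The integrand of the representation of `h₀` (at a fixed time). -/
noncomputable def integrand_h₀ (L : ℝ) (Φ₁ Φ₂ φ₁ φ₂ : ℂ → ℂ) (k : ℂ) : ℂ :=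
  1 / Delta L k * (-(Sig L k / 2) * evenPart φ₁ k + evenPart Φ₁ k
    + evenPart (fun z => (bar φ₂ z - 1) * Φ₁ z - expL L z * (bar Φ₂ z - 1) * φ₁ z) k)

/-- The pair `(F₁, F₂)` satisfies, for `0 ≤ t ≤ T` and `k ∈ ℂ`, the Volterra equations driven by
the Dirichlet value `u₀` and the Neumann value `u₁`. -/
def VolterraSystem (lam T : ℝ) (u₀ u₁ : ℝ → ℂ) (F₁ F₂ : ℝ → ℂ → ℂ) : Prop :=
  ∀ t ∈ Icc 0 T, ∀ k : ℂ,
    F₁ t k = (∫ t' in (0 : ℝ)..t, Complex.exp (4 * Complex.I * k ^ 2 * ((t' - t : ℝ) : ℂ)) *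
        (-Complex.I * (lam : ℂ) * ((‖u₀ t'‖ ^ 2 : ℝ) : ℂ) * F₁ t' k
          + (2 * k * u₀ t' + Complex.I * u₁ t') * F₂ t' k)) ∧
    F₂ t k = 1 + (lam : ℂ) * ∫ t' in (0 : ℝ)..t,
        ((2 * k * (starRingEnd ℂ) (u₀ t') - Complex.I * (starRingEnd ℂ) (u₁ t')) * F₁ t' k
          + Complex.I * ((‖u₀ t'‖ ^ 2 : ℝ) : ℂ) * F₂ t' k)

end NLSInterval

open NLSInterval

/-! The eigenfunction equations are Duhamel formulas for linear differential equations in t and x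
(`isEigenfunction_iff`). Existence, uniqueness, the conjugation symmetry, determinant one, the
formulas for the spectral functions and the Volterra equations therefore all reduce to existence and
uniqueness for linear systems.

The contour formulas rest on the combination M = φ₁Φ̄₂ − φ̄₂Φ₁e^{−2ikL}. When the brackets are
multiplied out, each integrand becomes o + n/Δ: here o is odd and entire, while n is entire and
contains Φ and φ only through M or e^{2ikL}M (`SideAsymptotics.hasContourIntegral`). The indented
contour is deformed into the arc |k| = R in the third quadrant (`truncatedIntegral_eq_arcIntegral`).
A primitive of o is even, so o has the same integral over the arc in the fourth quadrant
(`arcIntegral_odd`). There Im k² ≤ 0, the factor e^{−4ik²t} is bounded, and a WKB expansion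
(`SmoothData.asymptotics`) gives o = c/k + O(k⁻²).

In the third quadrant this expansion is not available: the single functions may grow like an
exponential of |k|². The combination M does not. Compatibility of the Lax pair (`tSys_of_laxSol`)
and q(x,0) = 0 show that the eigenfunctions normalized at (0,0) and (L,0) agree on the side x = L
(`eigenfunction_bottom`). Hence M is an entry of the transition matrix of the x-part from 0 to L,
and so of exponential type (`exists_exp_bound`). On the real and imaginary axes the expansions of
both sides control M, and Phragmén–Lindelöf, which in a quadrant tolerates any order of growth below
2, carries the control into the half plane (`exists_bound_global`). Since |Δ| is at least a constant
times |e^{2ikL}| away from its zeros, n/Δ = d/k + O(k⁻²) on the arc.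

The two quarter arcs have opposite orientations, so the contour integral is (iπ/2)(c − d). The 1/k
coefficients of Φ₂ and φ₂ cancel in c − d, which leaves g₁/2 and h₁/2 for the Dirichlet problem,
g₀/i and h₀/i for the Neumann problem. -/

namespace NLSInterval

/-! ### Linear systems of ordinary differential equations -/

/-- Global existence for ordinary differential equations with a globally Lipschitz right-hand side,
with continuous dependence on a parameter in a compact space. -/
theorem exists_solution_of_lipschitz {P E : Type*} [MetricSpace P] [CompactSpace P]
    [NormedAddCommGroup E] [NormedSpace ℝ E] [CompleteSpace E] (v : P → ℝ → E → E)
    (hv : Continuous fun w : P × ℝ × E => v w.1 w.2.1 w.2.2) {M : ℝ} (hM : 0 < M)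
    (hLip : ∀ p s y y', ‖v p s y - v p s y'‖ ≤ M * ‖y - y'‖) {a b : ℝ} (hab : a ≤ b)
    (y₀ : P → E) (hy₀ : Continuous y₀) :
    ∃ y : P → ℝ → E, Continuous (fun w : P × ℝ => y w.1 w.2) ∧
      (∀ p, y p a = y₀ p) ∧
      ∀ p, ∀ t ∈ Icc a b, HasDerivWithinAt (y p) (v p t (y p t)) (Icc a b) t := by
  have hcont : ∀ u : C(P × Icc a b, E), Continuous (fun w : P × ℝ =>
      v w.1 w.2 (Real.exp (2 * M * (w.2 - a)) • u (w.1, projIcc a b hab w.2))) := by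
    intro u
    have hp : Continuous (projIcc a b hab) := continuous_projIcc
    fun_prop
  have hprim : ∀ u : C(P × Icc a b, E), Continuous (fun w : P × ℝ =>
      ∫ s in a..w.2, v w.1 s (Real.exp (2 * M * (s - a)) • u (w.1, projIcc a b hab s))) := by
    intro u
    exact intervalIntegral.continuous_parametric_primitive_of_continuous
      (f := fun p s => v p s (Real.exp (2 * M * (s - a)) • u (p, projIcc a b hab s))) (hcont u)
  -- Picard iteration for u = e^{−2M(t−a)}y. The exponential weight makes the map a contraction with
  -- ratio 1/2 on the whole interval at once. The parameter is a variable of the function space, so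
  -- continuous dependence on it comes with the fixed point.
  let F : C(P × Icc a b, E) → C(P × Icc a b, E) := fun u =>
    ⟨fun w => Real.exp (-(2 * M * (w.2 - a))) • (y₀ w.1 + ∫ s in a..(w.2 : ℝ),
      v w.1 s (Real.exp (2 * M * (s - a)) • u (w.1, projIcc a b hab s))), by
      have := (hprim u).comp (f := fun w : P × Icc a b => (w.1, (w.2 : ℝ))) (by fun_prop)
      have h2 : Continuous fun w : P × Icc a b => ∫ s in a..(w.2 : ℝ),
        v w.1 s (Real.exp (2 * M * (s - a)) • u (w.1, projIcc a b hab s)) := this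
      fun_prop⟩
  have hF : ContractingWith (1 / 2) F := by
    refine ⟨by norm_num, LipschitzWith.of_dist_le_mul fun u u' => ?_⟩
    rw [ContinuousMap.dist_le (by positivity)]
    rintro ⟨p, t, ht⟩
    simp only [F, ContinuousMap.coe_mk, dist_eq_norm, ← smul_sub, norm_smul, add_sub_add_left_eq_sub]
    have c1 : ∀ u : C(P × Icc a b, E), Continuous fun s => v p s
        (Real.exp (2 * M * (s - a)) • u (p, projIcc a b hab s)) :=
      fun u => (hcont u).comp (f := fun s => (p, s)) (by fun_prop)
    rw [← intervalIntegral.integral_sub ((c1 u).intervalIntegrable _ _)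
      ((c1 u').intervalIntegrable _ _)]
    have hint : ∫ s in a..t, M * (Real.exp (2 * M * (s - a)) * ‖u - u'‖)
        = (Real.exp (2 * M * (t - a)) - 1) / 2 * ‖u - u'‖ := by
      have hd : ∀ s ∈ uIcc a t, HasDerivAt
          (fun s => Real.exp (2 * M * (s - a)) / 2 * ‖u - u'‖)
          (M * (Real.exp (2 * M * (s - a)) * ‖u - u'‖)) s := by
        intro s _
        have := ((((hasDerivAt_id s).sub_const a).const_mul (2 * M)).exp.div_const 2).mul_const
          ‖u - u'‖
        exact this.congr_deriv (by simp only [id]; ring)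
      rw [intervalIntegral.integral_eq_sub_of_hasDerivAt hd
        (Continuous.intervalIntegrable (by fun_prop) _ _)]
      simp; ring
    have hle : ‖∫ s in a..t, (v p s (Real.exp (2 * M * (s - a)) • u (p, projIcc a b hab s))
        - v p s (Real.exp (2 * M * (s - a)) • u' (p, projIcc a b hab s)))‖
        ≤ (Real.exp (2 * M * (t - a)) - 1) / 2 * ‖u - u'‖ := by
      rw [← hint]
      refine intervalIntegral.norm_integral_le_of_norm_le ht.1
        (Filter.Eventually.of_forall fun s _ => ?_)
        (Continuous.intervalIntegrable (by fun_prop) _ _)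
      refine (hLip _ _ _ _).trans ?_
      rw [← smul_sub, norm_smul, Real.norm_eq_abs, Real.abs_exp]
      gcongr
      exact (u - u').norm_coe_le_norm (p, projIcc a b hab s)
    have hpos := Real.exp_pos (-(2 * M * (t - a)))
    rw [Real.norm_eq_abs, abs_of_pos hpos]
    calc _ ≤ Real.exp (-(2 * M * (t - a))) *
          ((Real.exp (2 * M * (t - a)) - 1) / 2 * ‖u - u'‖) := by gcongr
      _ = (1 - Real.exp (-(2 * M * (t - a)))) / 2 * ‖u - u'‖ := by
          rw [Real.exp_neg]; field_simp
      _ ≤ _ := by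
          push_cast
          gcongr
          linarith
  obtain ⟨u, hu⟩ : ∃ u, F u = u := ⟨_, hF.fixedPoint_isFixedPt⟩
  refine ⟨fun p t => y₀ p + ∫ s in a..t,
      v p s (Real.exp (2 * M * (s - a)) • u (p, projIcc a b hab s)), ?_, fun p => by simp, ?_⟩
  · have := hprim u
    fun_prop
  · intro p t ht
    have c1 : Continuous fun s => v p s
        (Real.exp (2 * M * (s - a)) • u (p, projIcc a b hab s)) :=
      (hcont u).comp (f := fun s => (p, s)) (by fun_prop)
    have key : y₀ p + ∫ s in a..t, v p s (Real.exp (2 * M * (s - a)) • u (p, projIcc a b hab s))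
        = Real.exp (2 * M * (t - a)) • u (p, projIcc a b hab t) := by
      have h1 : u (p, ⟨t, ht⟩) = F u (p, ⟨t, ht⟩) := by rw [hu]
      rw [projIcc_of_mem hab ht, h1]
      simp only [F, ContinuousMap.coe_mk, smul_smul, ← Real.exp_add, add_neg_cancel, Real.exp_zero,
        one_smul]
    have hd := (c1.integral_hasStrictDerivAt a t).hasDerivAt.hasDerivWithinAt (s := Icc a b)
    rw [← key] at hd
    exact hd.const_add _

/-- The pair `(y, z)` solves the linear system `y' = α y + β z`, `z' = γ y + δ z` on `[a, b]`. -/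
structure LinSys (a b : ℝ) (α β γ δ y z : ℝ → ℂ) : Prop where
  fst : ∀ t ∈ Icc a b, HasDerivWithinAt y (α t * y t + β t * z t) (Icc a b) t
  snd : ∀ t ∈ Icc a b, HasDerivWithinAt z (γ t * y t + δ t * z t) (Icc a b) t

/-- An energy estimate of Grönwall type for a linear system with forcing. Only the real parts of
the diagonal coefficients have to be bounded, and only from above. -/
theorem energy_estimate {a b K ε : ℝ} {α β γ δ r s y z : ℝ → ℂ} (hK : 0 ≤ K)
    (hy : ∀ t ∈ Icc a b, HasDerivWithinAt y (α t * y t + β t * z t + r t) (Icc a b) t)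
    (hz : ∀ t ∈ Icc a b, HasDerivWithinAt z (γ t * y t + δ t * z t + s t) (Icc a b) t)
    (hα : ∀ t ∈ Icc a b, (α t).re ≤ K) (hδ : ∀ t ∈ Icc a b, (δ t).re ≤ K)
    (hβ : ∀ t ∈ Icc a b, ‖β t‖ ≤ K) (hγ : ∀ t ∈ Icc a b, ‖γ t‖ ≤ K)
    (hr : ∀ t ∈ Icc a b, ‖r t‖ ≤ ε) (hs : ∀ t ∈ Icc a b, ‖s t‖ ≤ ε) {t : ℝ} (ht : t ∈ Icc a b) :
    ‖y t‖ ^ 2 + ‖z t‖ ^ 2 ≤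
      (‖y a‖ ^ 2 + ‖z a‖ ^ 2 + 2 * ε ^ 2) * Real.exp ((4 * K + 1) * (t - a)) := by
  have hre : ∀ (f : ℝ → ℂ) (f' : ℂ) (x : ℝ), HasDerivWithinAt f f' (Icc a b) x →
      HasDerivWithinAt (fun t => ‖f t‖ ^ 2) (2 * (inner ℝ (f x) f')) (Icc a b) x := by
    intro f f' x hf
    exact hf.norm_sq
  have hder : ∀ x ∈ Icc a b, HasDerivWithinAt (fun t => ‖y t‖ ^ 2 + ‖z t‖ ^ 2)
      (2 * (inner ℝ (y x) (α x * y x + β x * z x + r x))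
        + 2 * (inner ℝ (z x) (γ x * y x + δ x * z x + s x))) (Icc a b) x :=
    fun x hx => (hre _ _ _ (hy x hx)).add (hre _ _ _ (hz x hx))
  have hin : ∀ (w c p d q e : ℂ), c = p → ‖q‖ ≤ K → p.re ≤ K → ‖e‖ ≤ ε →
      inner ℝ w (p * w + q * d + e) ≤ K * ‖w‖ ^ 2 + K * (‖w‖ * ‖d‖) + ε * ‖w‖ := by
    intro w c p d q e _ hq hp he
    have h1 : inner ℝ w (p * w) = p.re * ‖w‖ ^ 2 := by
      rw [Complex.inner, Complex.sq_norm, Complex.normSq_apply]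
      simp; ring
    have h2 : inner ℝ w (q * d) ≤ K * (‖w‖ * ‖d‖) := by
      refine (real_inner_le_norm _ _).trans ?_
      rw [norm_mul]
      nlinarith [norm_nonneg w, norm_nonneg d, mul_nonneg (norm_nonneg w) (norm_nonneg d)]
    have h3 : inner ℝ w e ≤ ε * ‖w‖ := by
      refine (real_inner_le_norm _ _).trans ?_
      nlinarith [norm_nonneg w]
    rw [inner_add_right, inner_add_right, h1]
    nlinarith [sq_nonneg ‖w‖]
  -- The derivative of |y|² + |z|² is at most 2K(|y|² + |z|²) + 4K|y||z| + 2ε(|y| + |z|). The cross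
  -- term costs another 2K, and 2ε|y| ≤ |y|² + ε², likewise for z: hence the rate 4K + 1 and the
  -- forcing 2ε².
  have hG := le_gronwallBound_of_liminf_deriv_right_le (f := fun t => ‖y t‖ ^ 2 + ‖z t‖ ^ 2)
    (f' := fun x => 2 * (inner ℝ (y x) (α x * y x + β x * z x + r x))
        + 2 * (inner ℝ (z x) (γ x * y x + δ x * z x + s x)))
    (δ := ‖y a‖ ^ 2 + ‖z a‖ ^ 2) (K := 4 * K + 1) (ε := 2 * ε ^ 2) (a := a) (b := b)
    (fun x hx => (hder x hx).continuousWithinAt) ?_ le_rfl ?_ t ht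
  · refine hG.trans ?_
    rw [gronwallBound_of_K_ne_0 (by positivity)]
    have hta : 0 ≤ t - a := sub_nonneg.2 ht.1
    have he : 1 ≤ Real.exp ((4 * K + 1) * (t - a)) := Real.one_le_exp (by positivity)
    have : 2 * ε ^ 2 / (4 * K + 1) ≤ 2 * ε ^ 2 :=
      div_le_self (by positivity) (by linarith)
    have h2 : 2 * ε ^ 2 / (4 * K + 1) * (Real.exp ((4 * K + 1) * (t - a)) - 1)
        ≤ 2 * ε ^ 2 * Real.exp ((4 * K + 1) * (t - a)) :=
      mul_le_mul this (by linarith) (by linarith) (by positivity)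
    simp only
    linarith
  · intro x hx ρ hρ
    have h := (hder x (Ico_subset_Icc_self hx)).mono_of_mem_nhdsWithin
      (Icc_mem_nhdsGE_of_mem hx)
    exact h.liminf_right_slope_le hρ
  · intro x hx
    have hx' := Ico_subset_Icc_self hx
    have h1 := hin (y x) _ _ (z x) (β x) (r x) rfl (hβ x hx') (hα x hx') (hr x hx')
    have h2 := hin (z x) _ _ (y x) (γ x) (s x) rfl (hγ x hx') (hδ x hx') (hs x hx')
    rw [add_comm (δ x * z x)] at h2
    nlinarith [sq_nonneg (‖y x‖ - ‖z x‖), sq_nonneg (‖y x‖ - ε), sq_nonneg (‖z x‖ - ε)]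

theorem exists_norm_le_Icc {a b : ℝ} {f : ℝ → ℂ} (hf : ContinuousOn f (Icc a b)) :
    ∃ C, 0 ≤ C ∧ ∀ t ∈ Icc a b, ‖f t‖ ≤ C := by
  obtain ⟨C, hC⟩ := isCompact_Icc.exists_bound_of_continuousOn hf
  exact ⟨max C 0, le_max_right _ _, fun t ht => (hC t ht).trans (le_max_left _ _)⟩

namespace LinSys

variable {a b : ℝ} {α β γ δ y z y' z' : ℝ → ℂ}

theorem continuousOn_fst (h : LinSys a b α β γ δ y z) : ContinuousOn y (Icc a b) :=
  fun t ht => (h.fst t ht).continuousWithinAt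

theorem continuousOn_snd (h : LinSys a b α β γ δ y z) : ContinuousOn z (Icc a b) :=
  fun t ht => (h.snd t ht).continuousWithinAt

theorem add (h : LinSys a b α β γ δ y z) (h' : LinSys a b α β γ δ y' z') :
    LinSys a b α β γ δ (fun t => y t + y' t) (fun t => z t + z' t) :=
  ⟨fun t ht => ((h.fst t ht).add (h'.fst t ht)).congr_deriv (by ring),
    fun t ht => ((h.snd t ht).add (h'.snd t ht)).congr_deriv (by ring)⟩

theorem const_mul (h : LinSys a b α β γ δ y z) (c : ℂ) :
    LinSys a b α β γ δ (fun t => c * y t) (fun t => c * z t) :=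
  ⟨fun t ht => ((h.fst t ht).const_mul c).congr_deriv (by ring),
    fun t ht => ((h.snd t ht).const_mul c).congr_deriv (by ring)⟩

theorem sub (h : LinSys a b α β γ δ y z) (h' : LinSys a b α β γ δ y' z') :
    LinSys a b α β γ δ (fun t => y t - y' t) (fun t => z t - z' t) :=
  ⟨fun t ht => ((h.fst t ht).sub (h'.fst t ht)).congr_deriv (by ring),
    fun t ht => ((h.snd t ht).sub (h'.snd t ht)).congr_deriv (by ring)⟩

theorem _root_.NLSInterval.hasDerivWithinAt_reflect {f : ℝ → ℂ} {f' : ℂ} {t : ℝ}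
    (h : HasDerivWithinAt f f' (Icc a b) (a + b - t)) :
    HasDerivWithinAt (fun s => f (a + b - s)) (-f') (Icc a b) t := by
  have h1 : HasDerivWithinAt (fun s : ℝ => a + b - s) (-1) (Icc a b) t :=
    ((hasDerivAt_id t).const_sub (a + b)).hasDerivWithinAt
  have := HasDerivWithinAt.scomp t h h1 (fun s hs => ⟨by linarith [hs.2], by linarith [hs.1]⟩)
  exact this.congr_deriv (by simp)

/-- Time reversal turns data at the right end point into data at the left one, so the forward
estimates serve both corners of a side. -/
theorem reflect (h : LinSys a b α β γ δ y z) :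
    LinSys a b (fun t => -α (a + b - t)) (fun t => -β (a + b - t)) (fun t => -γ (a + b - t))
      (fun t => -δ (a + b - t)) (fun t => y (a + b - t)) (fun t => z (a + b - t)) := by
  have hm : ∀ t ∈ Icc a b, a + b - t ∈ Icc a b :=
    fun t ht => ⟨by linarith [ht.2], by linarith [ht.1]⟩
  exact ⟨fun t ht => (hasDerivWithinAt_reflect (h.fst _ (hm t ht))).congr_deriv (by ring),
    fun t ht => (hasDerivWithinAt_reflect (h.snd _ (hm t ht))).congr_deriv (by ring)⟩

theorem eq_zero_of_left (h : LinSys a b α β γ δ y z) (hα : ContinuousOn α (Icc a b))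
    (hβ : ContinuousOn β (Icc a b)) (hγ : ContinuousOn γ (Icc a b))
    (hδ : ContinuousOn δ (Icc a b)) (hy : y a = 0) (hz : z a = 0) {t : ℝ} (ht : t ∈ Icc a b) :
    y t = 0 ∧ z t = 0 := by
  obtain ⟨A, hA, hA'⟩ := exists_norm_le_Icc hα
  obtain ⟨B, hB, hB'⟩ := exists_norm_le_Icc hβ
  obtain ⟨C, hC, hC'⟩ := exists_norm_le_Icc hγ
  obtain ⟨D, hD, hD'⟩ := exists_norm_le_Icc hδ
  have := energy_estimate (K := A + B + C + D) (ε := 0) (α := α) (β := β) (γ := γ) (δ := δ) (r := fun _ => 0) (s := fun _ => 0)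
    (by positivity) (fun t ht => (h.fst t ht).congr_deriv (by ring))
    (fun t ht => (h.snd t ht).congr_deriv (by ring))
    (fun t ht => by linarith [hA' t ht, Complex.re_le_norm (α t)])
    (fun t ht => by linarith [hD' t ht, Complex.re_le_norm (δ t)])
    (fun t ht => by linarith [hB' t ht]) (fun t ht => by linarith [hC' t ht])
    (by simp) (by simp) ht
  simp only [hy, hz, norm_zero] at this
  norm_num at this
  constructor <;> rw [← norm_eq_zero] <;> nlinarith [sq_nonneg ‖y t‖, sq_nonneg ‖z t‖]

theorem comp_reflect_continuousOn {f : ℝ → ℂ} (hf : ContinuousOn f (Icc a b)) :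
    ContinuousOn (fun t => -f (a + b - t)) (Icc a b) :=
  (hf.comp (f := fun t => a + b - t) (by fun_prop)
    fun t ht => ⟨by linarith [ht.2], by linarith [ht.1]⟩).neg

/-- A solution of a linear system is determined by its values at either end point. -/
theorem unique (h : LinSys a b α β γ δ y z) (h' : LinSys a b α β γ δ y' z')
    (hα : ContinuousOn α (Icc a b))
    (hβ : ContinuousOn β (Icc a b)) (hγ : ContinuousOn γ (Icc a b))
    (hδ : ContinuousOn δ (Icc a b)) {t₀ : ℝ} (ht₀ : t₀ = a ∨ t₀ = b) (hy : y t₀ = y' t₀)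
    (hz : z t₀ = z' t₀) {t : ℝ} (ht : t ∈ Icc a b) : y t = y' t ∧ z t = z' t := by
  rw [← sub_eq_zero, ← sub_eq_zero (a := z t)]
  have hs := h.sub h'
  rcases ht₀ with rfl | rfl
  · exact hs.eq_zero_of_left hα hβ hγ hδ (sub_eq_zero.2 hy) (sub_eq_zero.2 hz) ht
  · have := hs.reflect.eq_zero_of_left (comp_reflect_continuousOn hα) (comp_reflect_continuousOn hβ)
      (comp_reflect_continuousOn hγ) (comp_reflect_continuousOn hδ) (by simp [hy]) (by simp [hz])
      (t := a + t₀ - t) ⟨by linarith [ht.2], by linarith [ht.1]⟩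
    simpa using this

/-- Liouville's formula: the off-diagonal coefficients cancel and the trace remains. -/
theorem det_const (h : LinSys a b α β γ δ y z) (h' : LinSys a b α β γ δ y' z') {t : ℝ}
    (ht : t ∈ Icc a b) :
    HasDerivWithinAt (fun t => y t * z' t - y' t * z t)
      ((α t + δ t) * (y t * z' t - y' t * z t)) (Icc a b) t :=
  (((h.fst t ht).mul (h'.snd t ht)).sub ((h'.fst t ht).mul (h.snd t ht))).congr_deriv (by ring)

section Existence

variable {c d : ℝ}

/-- The coefficients are frozen outside `[a, b]` by `projIcc`, which makes them bounded and the
right-hand side globally Lipschitz. The forcing terms serve the equation differentiated in k in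
`TSys.differentiable`. -/
theorem _root_.NLSInterval.exists_forced_solution_left (hab : a ≤ b) (hcd : c ≤ d)
    {α β γ δ r s : ℝ → ℝ → ℂ} {y₀ z₀ : ℝ → ℂ}
    (hα : ContinuousOn (fun p : ℝ × ℝ => α p.1 p.2) (Icc c d ×ˢ Icc a b))
    (hβ : ContinuousOn (fun p : ℝ × ℝ => β p.1 p.2) (Icc c d ×ˢ Icc a b))
    (hγ : ContinuousOn (fun p : ℝ × ℝ => γ p.1 p.2) (Icc c d ×ˢ Icc a b))
    (hδ : ContinuousOn (fun p : ℝ × ℝ => δ p.1 p.2) (Icc c d ×ˢ Icc a b))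
    (hr : ContinuousOn (fun p : ℝ × ℝ => r p.1 p.2) (Icc c d ×ˢ Icc a b))
    (hs : ContinuousOn (fun p : ℝ × ℝ => s p.1 p.2) (Icc c d ×ˢ Icc a b))
    (hy₀ : ContinuousOn y₀ (Icc c d)) (hz₀ : ContinuousOn z₀ (Icc c d)) :
    ∃ y z : ℝ → ℝ → ℂ, ContinuousOn (fun p : ℝ × ℝ => y p.1 p.2) (Icc c d ×ˢ Icc a b) ∧
      ContinuousOn (fun p : ℝ × ℝ => z p.1 p.2) (Icc c d ×ˢ Icc a b) ∧
      ∀ p ∈ Icc c d, (∀ t ∈ Icc a b, HasDerivWithinAt (y p)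
          (α p t * y p t + β p t * z p t + r p t) (Icc a b) t) ∧
        (∀ t ∈ Icc a b, HasDerivWithinAt (z p)
          (γ p t * y p t + δ p t * z p t + s p t) (Icc a b) t) ∧
        y p a = y₀ p ∧ z p a = z₀ p := by
  have hext : ∀ f : ℝ → ℝ → ℂ, ContinuousOn (fun p : ℝ × ℝ => f p.1 p.2) (Icc c d ×ˢ Icc a b) →
      Continuous (fun w : Icc c d × ℝ => f w.1 (projIcc a b hab w.2)) ∧
      ∃ C, 0 ≤ C ∧ ∀ w : Icc c d × ℝ, ‖f w.1 (projIcc a b hab w.2)‖ ≤ C := by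
    intro f hf
    constructor
    · refine hf.comp_continuous (f := fun w : Icc c d × ℝ =>
        ((w.1 : ℝ), (projIcc a b hab w.2 : ℝ))) (by have := @continuous_projIcc ℝ _ a b hab; fun_prop)
        fun w => ⟨w.1.2, (projIcc a b hab w.2).2⟩
    · obtain ⟨C, hC⟩ := (isCompact_Icc.prod isCompact_Icc).exists_bound_of_continuousOn hf
      exact ⟨max C 0, le_max_right _ _, fun w => (hC (w.1, projIcc a b hab w.2)
        ⟨w.1.2, (projIcc a b hab w.2).2⟩).trans (le_max_left _ _)⟩
  obtain ⟨cα, A, hA, hA'⟩ := hext α hα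
  obtain ⟨cβ, B, hB, hB'⟩ := hext β hβ
  obtain ⟨cγ, C, hC, hC'⟩ := hext γ hγ
  obtain ⟨cδ, D, hD, hD'⟩ := hext δ hδ
  obtain ⟨cr, -⟩ := hext r hr
  obtain ⟨cs, -⟩ := hext s hs
  obtain ⟨u, hu, hu₀, hu'⟩ := exists_solution_of_lipschitz (P := Icc c d) (E := ℂ × ℂ)
    (fun p t w => (α p (projIcc a b hab t) * w.1 + β p (projIcc a b hab t) * w.2
        + r p (projIcc a b hab t),
      γ p (projIcc a b hab t) * w.1 + δ p (projIcc a b hab t) * w.2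
        + s p (projIcc a b hab t)))
    (by
      have e : Continuous fun w : Icc c d × ℝ × ℂ × ℂ => (w.1, w.2.1) := by fun_prop
      have a1 := cα.comp e
      have a2 := cβ.comp e
      have a3 := cγ.comp e
      have a4 := cδ.comp e
      have a5 := cr.comp e
      have a6 := cs.comp e
      have h1 : Continuous fun w : Icc c d × ℝ × ℂ × ℂ => w.2.2.1 := by fun_prop
      have h2 : Continuous fun w : Icc c d × ℝ × ℂ × ℂ => w.2.2.2 := by fun_prop
      exact (((a1.mul h1).add (a2.mul h2)).add a5).prodMk
        (((a3.mul h1).add (a4.mul h2)).add a6))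
    (M := A + B + C + D + 1) (by positivity)
    (by
      rintro p t ⟨w1, w2⟩ ⟨w1', w2'⟩
      have hx : ‖w1 - w1'‖ ≤ ‖((w1, w2) : ℂ × ℂ) - (w1', w2')‖ :=
        norm_fst_le (((w1, w2) : ℂ × ℂ) - (w1', w2'))
      have hy : ‖w2 - w2'‖ ≤ ‖((w1, w2) : ℂ × ℂ) - (w1', w2')‖ :=
        norm_snd_le (((w1, w2) : ℂ × ℂ) - (w1', w2'))
      set N := ‖((w1, w2) : ℂ × ℂ) - (w1', w2')‖
      have hN : 0 ≤ N := norm_nonneg _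
      have h1 := hA' (p, t)
      have h2 := hB' (p, t)
      have h3 := hC' (p, t)
      have h4 := hD' (p, t)
      simp only at h1 h2 h3 h4
      have hb : ∀ (p q : ℂ) (P Q : ℝ), ‖p‖ ≤ P → ‖q‖ ≤ Q → 0 ≤ P → 0 ≤ Q →
          ‖p * w1 + q * w2 - (p * w1' + q * w2')‖ ≤ (P + Q) * N := by
        intro p q P Q hp hq hP hQ
        rw [show p * w1 + q * w2 - (p * w1' + q * w2') = p * (w1 - w1') + q * (w2 - w2') by ring,
          add_mul]
        refine (norm_add_le _ _).trans ?_
        rw [norm_mul, norm_mul]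
        gcongr
      rw [Prod.mk_sub_mk, Prod.norm_def, add_sub_add_right_eq_sub, add_sub_add_right_eq_sub]
      refine max_le ((hb _ _ _ _ h1 h2 hA hB).trans ?_) ((hb _ _ _ _ h3 h4 hC hD).trans ?_) <;>
        exact mul_le_mul_of_nonneg_right (by linarith) hN)
    hab (fun p => (y₀ p, z₀ p))
    ((continuousOn_iff_continuous_domRestrict.1 hy₀).prodMk
      (continuousOn_iff_continuous_domRestrict.1 hz₀))
  refine ⟨fun p t => (u (projIcc c d hcd p) t).1, fun p t => (u (projIcc c d hcd p) t).2, ?_, ?_, ?_⟩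
  · have := @continuous_projIcc ℝ _ c d hcd
    exact (hu.comp (f := fun w : ℝ × ℝ => (projIcc c d hcd w.1, w.2))
      (by fun_prop)).fst.continuousOn
  · have := @continuous_projIcc ℝ _ c d hcd
    exact (hu.comp (f := fun w : ℝ × ℝ => (projIcc c d hcd w.1, w.2))
      (by fun_prop)).snd.continuousOn
  · intro p hp
    simp only [projIcc_of_mem hcd hp]
    refine ⟨fun t ht => ?_, fun t ht => ?_, by rw [hu₀], by rw [hu₀]⟩
    · have := (hu' ⟨p, hp⟩ t ht)
      simp only [projIcc_of_mem hab ht] at this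
      exact this.hasFDerivWithinAt.fst.hasDerivWithinAt.congr_deriv (by simp)
    · have := (hu' ⟨p, hp⟩ t ht)
      simp only [projIcc_of_mem hab ht] at this
      exact this.hasFDerivWithinAt.snd.hasDerivWithinAt.congr_deriv (by simp)

/-- Existence for linear systems depending continuously on a real parameter, with initial values
prescribed at either end point. -/
theorem exists_param (hab : a ≤ b) (hcd : c ≤ d) {α β γ δ : ℝ → ℝ → ℂ} {y₀ z₀ : ℝ → ℂ}
    (hα : ContinuousOn (fun p : ℝ × ℝ => α p.1 p.2) (Icc c d ×ˢ Icc a b))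
    (hβ : ContinuousOn (fun p : ℝ × ℝ => β p.1 p.2) (Icc c d ×ˢ Icc a b))
    (hγ : ContinuousOn (fun p : ℝ × ℝ => γ p.1 p.2) (Icc c d ×ˢ Icc a b))
    (hδ : ContinuousOn (fun p : ℝ × ℝ => δ p.1 p.2) (Icc c d ×ˢ Icc a b))
    (hy₀ : ContinuousOn y₀ (Icc c d)) (hz₀ : ContinuousOn z₀ (Icc c d))
    {t₀ : ℝ} (ht₀ : t₀ = a ∨ t₀ = b) :
    ∃ y z : ℝ → ℝ → ℂ, ContinuousOn (fun p : ℝ × ℝ => y p.1 p.2) (Icc c d ×ˢ Icc a b) ∧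
      ContinuousOn (fun p : ℝ × ℝ => z p.1 p.2) (Icc c d ×ˢ Icc a b) ∧
      ∀ p ∈ Icc c d, LinSys a b (α p) (β p) (γ p) (δ p) (y p) (z p) ∧
        y p t₀ = y₀ p ∧ z p t₀ = z₀ p := by
  have hleft : ∀ {α β γ δ : ℝ → ℝ → ℂ} {y₀ z₀ : ℝ → ℂ},
      ContinuousOn (fun p : ℝ × ℝ => α p.1 p.2) (Icc c d ×ˢ Icc a b) →
      ContinuousOn (fun p : ℝ × ℝ => β p.1 p.2) (Icc c d ×ˢ Icc a b) →
      ContinuousOn (fun p : ℝ × ℝ => γ p.1 p.2) (Icc c d ×ˢ Icc a b) →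
      ContinuousOn (fun p : ℝ × ℝ => δ p.1 p.2) (Icc c d ×ˢ Icc a b) →
      ContinuousOn y₀ (Icc c d) → ContinuousOn z₀ (Icc c d) →
      ∃ y z : ℝ → ℝ → ℂ, ContinuousOn (fun p : ℝ × ℝ => y p.1 p.2) (Icc c d ×ˢ Icc a b) ∧
        ContinuousOn (fun p : ℝ × ℝ => z p.1 p.2) (Icc c d ×ˢ Icc a b) ∧
        ∀ p ∈ Icc c d, LinSys a b (α p) (β p) (γ p) (δ p) (y p) (z p) ∧
          y p a = y₀ p ∧ z p a = z₀ p := by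
    intro α β γ δ y₀ z₀ hα hβ hγ hδ hy₀ hz₀
    obtain ⟨y, z, hy, hz, H⟩ := exists_forced_solution_left hab hcd hα hβ hγ hδ
      (r := fun _ _ => 0) (s := fun _ _ => 0) continuousOn_const continuousOn_const hy₀ hz₀
    refine ⟨y, z, hy, hz, fun p hp => ⟨⟨fun t ht => ?_, fun t ht => ?_⟩, (H p hp).2.2⟩⟩
    · simpa using (H p hp).1 t ht
    · simpa using (H p hp).2.1 t ht
  rcases ht₀ with rfl | rfl
  · exact hleft hα hβ hγ hδ hy₀ hz₀
  · have hm : MapsTo (fun p : ℝ × ℝ => (p.1, a + t₀ - p.2)) (Icc c d ×ˢ Icc a t₀)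
        (Icc c d ×ˢ Icc a t₀) :=
      fun p hp => ⟨hp.1, by linarith [hp.2.2], by linarith [hp.2.1]⟩
    have hr : ∀ f : ℝ → ℝ → ℂ, ContinuousOn (fun p : ℝ × ℝ => f p.1 p.2) (Icc c d ×ˢ Icc a t₀) →
        ContinuousOn (fun p : ℝ × ℝ => f p.1 (a + t₀ - p.2)) (Icc c d ×ˢ Icc a t₀) :=
      fun f hf => hf.comp (f := fun p : ℝ × ℝ => (p.1, a + t₀ - p.2)) (by fun_prop) hm
    obtain ⟨y, z, hy, hz, H⟩ := hleft (α := fun p t => -α p (a + t₀ - t))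
      (β := fun p t => -β p (a + t₀ - t)) (γ := fun p t => -γ p (a + t₀ - t))
      (δ := fun p t => -δ p (a + t₀ - t)) (hr α hα).neg (hr β hβ).neg (hr γ hγ).neg (hr δ hδ).neg
      hy₀ hz₀
    refine ⟨fun p t => y p (a + t₀ - t), fun p t => z p (a + t₀ - t), hr y hy, hr z hz,
      fun p hp => ?_⟩
    obtain ⟨h1, h2, h3⟩ := H p hp
    exact ⟨by simpa using h1.reflect, by simpa using h2, by simpa using h3⟩

end Existence

end LinSys

/-- Variation of constants. -/
theorem duhamel_iff {a b t₀ : ℝ} (ht₀ : t₀ ∈ Icc a b) (κ c : ℂ) {y g : ℝ → ℂ}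
    (hg : ContinuousOn g (Icc a b)) :
    (∀ t ∈ Icc a b, y t = c * Complex.exp (κ * ((t - t₀ : ℝ) : ℂ))
        + ∫ s in t₀..t, Complex.exp (κ * ((t - s : ℝ) : ℂ)) * g s) ↔
      y t₀ = c ∧ ∀ t ∈ Icc a b, HasDerivWithinAt y (κ * y t + g t) (Icc a b) t := by
  have hab : a ≤ b := ht₀.1.trans ht₀.2
  have hexp : ∀ (s t : ℝ), Complex.exp (κ * ((t - s : ℝ) : ℂ))
      = Complex.exp (κ * t) * Complex.exp (-κ * s) := by
    intro s t; rw [← Complex.exp_add]; push_cast; ring_nf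
  have hd : ∀ (κ : ℂ) (t : ℝ), HasDerivAt (fun t : ℝ => Complex.exp (κ * t))
      (κ * Complex.exp (κ * t)) t := by
    intro κ t
    have := ((Complex.ofRealCLM.hasDerivAt (x := t)).const_mul κ).cexp
    exact this.congr_deriv (by simp; ring)
  -- A continuous extension of g to the line, so that the fundamental theorem of calculus applies at
  -- the end points too.
  set G : ℝ → ℂ := fun s => g (projIcc a b hab s) with hG
  have hGc : Continuous G :=
    hg.comp_continuous (f := fun s => (projIcc a b hab s : ℝ))
      (by have := @continuous_projIcc ℝ _ a b hab; fun_prop) fun s => (projIcc a b hab s).2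
  have hGg : ∀ s ∈ Icc a b, G s = g s := fun s hs => by simp [hG, projIcc_of_mem hab hs]
  have hint : ∀ t ∈ Icc a b, ∫ s in t₀..t, Complex.exp (κ * ((t - s : ℝ) : ℂ)) * g s
      = Complex.exp (κ * t) * ∫ s in t₀..t, Complex.exp (-κ * s) * G s := by
    intro t ht
    rw [← intervalIntegral.integral_const_mul]
    refine intervalIntegral.integral_congr fun s hs => ?_
    simp only [hexp s t]
    rw [hGg s (uIcc_subset_Icc ht₀ ht hs), mul_assoc]
  have hc : Continuous fun s : ℝ => Complex.exp (-κ * s) * G s := by fun_prop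
  constructor
  · intro h
    refine ⟨by rw [h t₀ ht₀]; simp, fun t ht => ?_⟩
    have h1 : HasDerivAt (fun t : ℝ => Complex.exp (κ * t) * (c * Complex.exp (-κ * t₀)
        + ∫ s in t₀..t, Complex.exp (-κ * s) * G s))
        (κ * Complex.exp (κ * t) * (c * Complex.exp (-κ * t₀)
        + ∫ s in t₀..t, Complex.exp (-κ * s) * G s)
        + Complex.exp (κ * t) * (Complex.exp (-κ * t) * G t)) t :=
      (hd κ t).mul ((hc.integral_hasStrictDerivAt t₀ t).hasDerivAt.const_add _)
    have h2 : ∀ t ∈ Icc a b, y t = Complex.exp (κ * t) * (c * Complex.exp (-κ * t₀)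
        + ∫ s in t₀..t, Complex.exp (-κ * s) * G s) := by
      intro t ht
      rw [h t ht, hint t ht, hexp]; ring
    refine (h1.hasDerivWithinAt.congr h2 (h2 t ht)).congr_deriv ?_
    rw [h2 t ht, hGg t ht, ← mul_assoc (Complex.exp _) (Complex.exp _), ← Complex.exp_add]
    simp; ring
  · rintro ⟨h0, h⟩ t ht
    have hsub : uIcc t₀ t ⊆ Icc a b := uIcc_subset_Icc ht₀ ht
    have h1 : ∀ s ∈ Icc a b, HasDerivWithinAt (fun s : ℝ => Complex.exp (-κ * s) * y s)
        (Complex.exp (-κ * s) * G s) (Icc a b) s := by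
      intro s hs
      refine ((hd (-κ) s).hasDerivWithinAt.mul (h s hs)).congr_deriv ?_
      rw [hGg s hs]; ring
    have h3 : ∫ s in t₀..t, Complex.exp (-κ * s) * G s
        = Complex.exp (-κ * t) * y t - Complex.exp (-κ * t₀) * y t₀ := by
      have hI : ∀ u v : ℝ, u ∈ Icc a b → v ∈ Icc a b → u ≤ v →
          ∫ s in u..v, Complex.exp (-κ * s) * G s
            = Complex.exp (-κ * v) * y v - Complex.exp (-κ * u) * y u := by
        intro u v hu hv huv
        refine intervalIntegral.integral_eq_sub_of_hasDerivAt_of_le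
          (f := fun s : ℝ => Complex.exp (-κ * s) * y s) huv
          (fun s hs => ((h1 s (Icc_subset_Icc hu.1 hv.2 hs)).continuousWithinAt).mono
            (Icc_subset_Icc hu.1 hv.2)) (fun s hs => ?_) (hc.intervalIntegrable _ _)
        have hs' : s ∈ Ioo a b := ⟨hu.1.trans_lt hs.1, hs.2.trans_le hv.2⟩
        exact (h1 s (Ioo_subset_Icc_self hs')).hasDerivAt (Icc_mem_nhds hs'.1 hs'.2)
      rcases le_total t₀ t with hle | hle
      · exact hI _ _ ht₀ ht hle
      · rw [intervalIntegral.integral_symm, hI _ _ ht ht₀ hle]; ring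
    have e1 : Complex.exp (κ * t) * Complex.exp (-κ * t) = 1 := by
      rw [← Complex.exp_add]; simp
    rw [hint t ht, h3, h0, hexp]
    linear_combination (-y t) * e1

/-! ### Derivatives of the solution up to the boundary -/

/-- The partial derivatives of a solution of the nonlinear Schrödinger equation on the closed
rectangle `[0, L] × [0, T]` that vanishes at `t = 0`. -/
structure SmoothData (lam L T : ℝ) (q qx qxx qt qtt qxt qxtt : ℝ → ℝ → ℂ) : Prop where
  L_pos : 0 < L
  T_pos : 0 < T
  cont : ContinuousOn (fun p : ℝ × ℝ => q p.1 p.2) (Icc 0 L ×ˢ Icc 0 T)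
  cont_x : ContinuousOn (fun p : ℝ × ℝ => qx p.1 p.2) (Icc 0 L ×ˢ Icc 0 T)
  cont_t : ContinuousOn (fun p : ℝ × ℝ => qt p.1 p.2) (Icc 0 L ×ˢ Icc 0 T)
  cont_tt : ContinuousOn (fun p : ℝ × ℝ => qtt p.1 p.2) (Icc 0 L ×ˢ Icc 0 T)
  cont_xt : ContinuousOn (fun p : ℝ × ℝ => qxt p.1 p.2) (Icc 0 L ×ˢ Icc 0 T)
  cont_xtt : ContinuousOn (fun p : ℝ × ℝ => qxtt p.1 p.2) (Icc 0 L ×ˢ Icc 0 T)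
  deriv_x : ∀ x ∈ Icc 0 L, ∀ t ∈ Icc 0 T,
    HasDerivWithinAt (fun y => q y t) (qx x t) (Icc 0 L) x
  deriv_xx : ∀ x ∈ Icc 0 L, ∀ t ∈ Icc 0 T,
    HasDerivWithinAt (fun y => qx y t) (qxx x t) (Icc 0 L) x
  deriv_t : ∀ x ∈ Icc 0 L, ∀ t ∈ Icc 0 T, HasDerivWithinAt (q x) (qt x t) (Icc 0 T) t
  deriv_tt : ∀ x ∈ Icc 0 L, ∀ t ∈ Icc 0 T, HasDerivWithinAt (qt x) (qtt x t) (Icc 0 T) t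
  deriv_xt : ∀ x ∈ Icc 0 L, ∀ t ∈ Icc 0 T, HasDerivWithinAt (qx x) (qxt x t) (Icc 0 T) t
  deriv_xtt : ∀ x ∈ Icc 0 L, ∀ t ∈ Icc 0 T, HasDerivWithinAt (qxt x) (qxtt x t) (Icc 0 T) t
  nls : ∀ x ∈ Icc 0 L, ∀ t ∈ Icc 0 T, Complex.I * qt x t + qxx x t
    - 2 * (lam : ℂ) * (q x t * (starRingEnd ℂ) (q x t)) * q x t = 0
  zero : ∀ x ∈ Icc 0 L, q x 0 = 0
  zero_x : ∀ x ∈ Icc 0 L, qx x 0 = 0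
  zero_t : ∀ x ∈ Icc 0 L, qt x 0 = 0
  zero_xt : ∀ x ∈ Icc 0 L, qxt x 0 = 0

section PartialDerivatives

variable {L T : ℝ}

theorem hasDerivWithinAt_fst {f : ℝ × ℝ → ℂ} {A B : Set ℝ}
    (hf : DifferentiableOn ℝ f (A ×ˢ B)) {x t : ℝ}
    (hx : x ∈ A) (ht : t ∈ B) :
    HasDerivWithinAt (fun y => f (y, t)) (fderivWithin ℝ f (A ×ˢ B) (x, t) (1, 0)) A x := by
  have h1 : HasDerivWithinAt (fun y : ℝ => (y, t)) ((1 : ℝ), (0 : ℝ)) A x :=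
    (hasDerivWithinAt_id x _).prodMk (hasDerivWithinAt_const x _ t)
  exact HasFDerivWithinAt.comp_hasDerivWithinAt x (hf (x, t) ⟨hx, ht⟩).hasFDerivWithinAt h1
    (fun y hy => ⟨hy, ht⟩)

theorem hasDerivWithinAt_snd {f : ℝ × ℝ → ℂ} {A B : Set ℝ}
    (hf : DifferentiableOn ℝ f (A ×ˢ B)) {x t : ℝ}
    (hx : x ∈ A) (ht : t ∈ B) :
    HasDerivWithinAt (fun s => f (x, s)) (fderivWithin ℝ f (A ×ˢ B) (x, t) (0, 1)) B t := by
  have h1 : HasDerivWithinAt (fun s : ℝ => (x, s)) ((0 : ℝ), (1 : ℝ)) B t :=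
    (hasDerivWithinAt_const t _ x).prodMk (hasDerivWithinAt_id t _)
  exact HasFDerivWithinAt.comp_hasDerivWithinAt t (hf (x, t) ⟨hx, ht⟩).hasFDerivWithinAt h1
    (fun y hy => ⟨hx, hy⟩)

theorem contDiffOn_fderivWithin_apply {f : ℝ × ℝ → ℂ} {S : Set (ℝ × ℝ)} (hS : UniqueDiffOn ℝ S)
    {n : ℕ} (hf : ContDiffOn ℝ ((n + 1 : ℕ) : WithTop ℕ∞) f S) (v : ℝ × ℝ) :
    ContDiffOn ℝ (n : WithTop ℕ∞) (fun p => fderivWithin ℝ f S p v) S :=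
  (hf.fderivWithin hS (by push_cast; exact le_rfl)).clm_apply contDiffOn_const

theorem eq_zero_of_hasDerivWithinAt_of_eq_zero {f : ℝ → ℂ} {f' : ℂ} {a b x : ℝ} (hab : a < b)
    (hx : x ∈ Icc a b) (h : HasDerivWithinAt f f' (Icc a b) x) (h0 : ∀ y ∈ Icc a b, f y = 0) :
    f' = 0 := by
  have h1 : HasDerivWithinAt f 0 (Icc a b) x :=
    (hasDerivWithinAt_const x (Icc a b) (0 : ℂ)).congr h0 (h0 x hx)
  exact (uniqueDiffOn_Icc hab x hx).eq_deriv _ h h1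

end PartialDerivatives

/-- The equation passes to the closed rectangle by continuity. On the edge t = 0 the tangential
derivatives q_x and q_xx vanish with q, the equation then gives q_t = 0, and q_xt = 0 follows. These
vanishing values are what lets the large-k expansion start at t = 0 without an oscillating
correction. -/
theorem IsSolution.exists_smoothData {lam L T : ℝ} {q : ℝ → ℝ → ℂ} (hL : 0 < L) (hT : 0 < T)
    (h : IsSolution 4 lam L T q) :
    ∃ qx qxx qt qtt qxt qxtt : ℝ → ℝ → ℂ, SmoothData lam L T q qx qxx qt qtt qxt qxtt := by
  set S : Set (ℝ × ℝ) := Icc 0 L ×ˢ Icc 0 T with hS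
  have hU : UniqueDiffOn ℝ S := (uniqueDiffOn_Icc hL).prod (uniqueDiffOn_Icc hT)
  set f : ℝ × ℝ → ℂ := fun p => q p.1 p.2 with hfdef
  have hf : ContDiffOn ℝ ((3 + 1 : ℕ) : WithTop ℕ∞) f S := h.contDiffOn
  set fx : ℝ × ℝ → ℂ := fun p => fderivWithin ℝ f S p (1, 0) with hfxdef
  set ft : ℝ × ℝ → ℂ := fun p => fderivWithin ℝ f S p (0, 1) with hftdef
  have hfx : ContDiffOn ℝ ((2 + 1 : ℕ) : WithTop ℕ∞) fx S := contDiffOn_fderivWithin_apply hU hf _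
  have hft : ContDiffOn ℝ ((2 + 1 : ℕ) : WithTop ℕ∞) ft S := contDiffOn_fderivWithin_apply hU hf _
  set fxx : ℝ × ℝ → ℂ := fun p => fderivWithin ℝ fx S p (1, 0) with hfxxdef
  set ftt : ℝ × ℝ → ℂ := fun p => fderivWithin ℝ ft S p (0, 1) with hfttdef
  set fxt : ℝ × ℝ → ℂ := fun p => fderivWithin ℝ fx S p (0, 1) with hfxtdef
  have hfxx : ContDiffOn ℝ ((1 + 1 : ℕ) : WithTop ℕ∞) fxx S :=
    contDiffOn_fderivWithin_apply hU hfx _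
  have hftt : ContDiffOn ℝ ((1 + 1 : ℕ) : WithTop ℕ∞) ftt S :=
    contDiffOn_fderivWithin_apply hU hft _
  have hfxt : ContDiffOn ℝ ((1 + 1 : ℕ) : WithTop ℕ∞) fxt S :=
    contDiffOn_fderivWithin_apply hU hfx _
  set fxtt : ℝ × ℝ → ℂ := fun p => fderivWithin ℝ fxt S p (0, 1) with hfxttdef
  have hfxtt : ContDiffOn ℝ ((1 : ℕ) : WithTop ℕ∞) fxtt S :=
    contDiffOn_fderivWithin_apply hU hfxt _
  have df : DifferentiableOn ℝ f S := hf.differentiableOn (by norm_num)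
  have dfx : DifferentiableOn ℝ fx S := hfx.differentiableOn (by norm_num)
  have dft : DifferentiableOn ℝ ft S := hft.differentiableOn (by norm_num)
  have dfxt : DifferentiableOn ℝ fxt S := hfxt.differentiableOn (by norm_num)
  have hnls : ∀ p ∈ S, Complex.I * ft p + fxx p
      - 2 * (lam : ℂ) * (f p * (starRingEnd ℂ) (f p)) * f p = 0 := by
    have hcl : closure (Ioo 0 L ×ˢ Ioo 0 T) = S := by
      rw [closure_prod_eq, closure_Ioo hL.ne, closure_Ioo hT.ne]
    have heq : EqOn (fun p => Complex.I * ft p + fxx p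
        - 2 * (lam : ℂ) * (f p * (starRingEnd ℂ) (f p)) * f p) (fun _ => 0)
        (Ioo 0 L ×ˢ Ioo 0 T) := by
      rintro ⟨x, t⟩ ⟨hx, ht⟩
      have hx' := Ioo_subset_Icc_self hx
      have ht' := Ioo_subset_Icc_self ht
      have e1 : deriv (fun s => q x s) t = ft (x, t) :=
        ((hasDerivWithinAt_snd df hx' ht').hasDerivAt (Icc_mem_nhds ht.1 ht.2)).deriv
      have e2 : ∀ y ∈ Ioo 0 L, deriv (fun y => q y t) y = fx (y, t) := fun y hy =>
        ((hasDerivWithinAt_fst df (Ioo_subset_Icc_self hy) ht').hasDerivAt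
          (Icc_mem_nhds hy.1 hy.2)).deriv
      have e3 : deriv (deriv (fun y => q y t)) x = fxx (x, t) := by
        have : deriv (fun y => q y t) =ᶠ[𝓝 x] fun y => fx (y, t) :=
          Filter.eventually_of_mem (Ioo_mem_nhds hx.1 hx.2) e2
        rw [this.deriv_eq]
        exact ((hasDerivWithinAt_fst dfx hx' ht').hasDerivAt (Icc_mem_nhds hx.1 hx.2)).deriv
      have := h.nls x hx t ht
      rw [e1, e3] at this
      simp only [hfdef, Complex.mul_conj'] 
      push_cast at this
      exact this
    have hc : ContinuousOn (fun p => Complex.I * ft p + fxx p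
        - 2 * (lam : ℂ) * (f p * (starRingEnd ℂ) (f p)) * f p) S := by
      have c1 := hft.continuousOn
      have c2 := hfxx.continuousOn
      have c3 := hf.continuousOn
      have c4 : ContinuousOn (fun p => (starRingEnd ℂ) (f p)) S :=
        Complex.continuous_conj.comp_continuousOn c3
      fun_prop
    intro p hp
    exact heq.of_subset_closure hc continuousOn_const
      (prod_mono Ioo_subset_Icc_self Ioo_subset_Icc_self) hcl.symm.subset hp
  have h0T : (0 : ℝ) ∈ Icc 0 T := ⟨le_rfl, hT.le⟩
  have z0 : ∀ x ∈ Icc 0 L, f (x, 0) = 0 := h.initial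
  have zx : ∀ x ∈ Icc 0 L, fx (x, 0) = 0 := fun x hx =>
    eq_zero_of_hasDerivWithinAt_of_eq_zero hL hx (hasDerivWithinAt_fst df hx h0T) z0
  have zxx : ∀ x ∈ Icc 0 L, fxx (x, 0) = 0 := fun x hx =>
    eq_zero_of_hasDerivWithinAt_of_eq_zero hL hx (hasDerivWithinAt_fst dfx hx h0T) zx
  have zt : ∀ x ∈ Icc 0 L, ft (x, 0) = 0 := fun x hx => by
    have := hnls (x, 0) ⟨hx, h0T⟩
    rw [zxx x hx, z0 x hx] at this
    simpa using this
  -- By construction q_xt is the t-derivative of q_x, which is not tangential to the edge. Symmetry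
  -- of the second derivative, valid at boundary points in the closure of the interior, makes it the
  -- x-derivative of q_t, which vanishes along the edge.
  have zxt : ∀ x ∈ Icc 0 L, fxt (x, 0) = 0 := by
    intro x hx
    have hp : ((x, 0) : ℝ × ℝ) ∈ S := ⟨hx, h0T⟩
    have hint : ((x, 0) : ℝ × ℝ) ∈ closure (interior S) := by
      rw [interior_prod_eq, interior_Icc, interior_Icc, closure_prod_eq, closure_Ioo hL.ne,
        closure_Ioo hT.ne]
      exact hp
    have hsymm : IsSymmSndFDerivWithinAt ℝ f S (x, 0) :=
      (hf (x, 0) hp).isSymmSndFDerivWithinAt (by simp; norm_num) hU hint hp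
    have hdd : DifferentiableWithinAt ℝ (fderivWithin ℝ f S) S (x, 0) :=
      ((hf.fderivWithin (m := 1) hU (by norm_num)).differentiableOn (by norm_num)) _ hp
    have happ : ∀ v w : ℝ × ℝ, fderivWithin ℝ (fun p => fderivWithin ℝ f S p v) S (x, 0) w
        = fderivWithin ℝ (fderivWithin ℝ f S) S (x, 0) w v := by
      intro v w
      have := (hdd.hasFDerivWithinAt.clm_apply (hasFDerivWithinAt_const v _ _)).fderivWithin
        (hU _ hp)
      rw [this]; simp
    have h1 : fxt (x, 0) = fderivWithin ℝ ft S (x, 0) (1, 0) := by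
      simp only [hfxtdef, hfxdef, hftdef]
      rw [happ, happ]
      exact hsymm _ _
    rw [h1]
    exact eq_zero_of_hasDerivWithinAt_of_eq_zero hL hx (hasDerivWithinAt_fst dft hx h0T) zt
  exact ⟨fun x t => fx (x, t), fun x t => fxx (x, t), fun x t => ft (x, t), fun x t => ftt (x, t),
    fun x t => fxt (x, t), fun x t => fxtt (x, t),
    { L_pos := hL
      T_pos := hT
      cont := hf.continuousOn
      cont_x := hfx.continuousOn
      cont_t := hft.continuousOn
      cont_tt := hftt.continuousOn
      cont_xt := hfxt.continuousOn
      cont_xtt := hfxtt.continuousOn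
      deriv_x := fun x hx t ht => hasDerivWithinAt_fst df hx ht
      deriv_xx := fun x hx t ht => hasDerivWithinAt_fst dfx hx ht
      deriv_t := fun x hx t ht => hasDerivWithinAt_snd df hx ht
      deriv_tt := fun x hx t ht => hasDerivWithinAt_snd dft hx ht
      deriv_xt := fun x hx t ht => hasDerivWithinAt_snd dfx hx ht
      deriv_xtt := fun x hx t ht => hasDerivWithinAt_snd dfxt hx ht
      nls := fun x hx t ht => hnls (x, t) ⟨hx, ht⟩
      zero := z0
      zero_x := zx
      zero_t := zt
      zero_xt := zxt }⟩

/-! ### The Lax pair and the eigenfunctions -/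

/-- The `t`-part of the Lax pair for the second column of an eigenfunction, on a side of the
rectangle with Dirichlet value `u₀` and Neumann value `u₁`. -/
abbrev TSys (lam T : ℝ) (u₀ u₁ : ℝ → ℂ) (k : ℂ) (y z : ℝ → ℂ) : Prop :=
  LinSys 0 T
    (fun t => -4 * Complex.I * k ^ 2 - Complex.I * lam * (u₀ t * (starRingEnd ℂ) (u₀ t)))
    (fun t => 2 * k * u₀ t + Complex.I * u₁ t)
    (fun t => lam * (2 * k * (starRingEnd ℂ) (u₀ t) - Complex.I * (starRingEnd ℂ) (u₁ t)))
    (fun t => Complex.I * lam * (u₀ t * (starRingEnd ℂ) (u₀ t))) y z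

/-- The `x`-part of the Lax pair for the second column of an eigenfunction. -/
abbrev XSys (lam L : ℝ) (u : ℝ → ℂ) (k : ℂ) (y z : ℝ → ℂ) : Prop :=
  LinSys 0 L (fun _ => -2 * Complex.I * k) u (fun x => lam * (starRingEnd ℂ) (u x))
    (fun _ => 0) y z

theorem ContinuousOn.conj {X : Type*} [TopologicalSpace X] {f : X → ℂ} {s : Set X}
    (hf : ContinuousOn f s) : ContinuousOn (fun x => (starRingEnd ℂ) (f x)) s :=
  Complex.continuous_conj.comp_continuousOn hf

section Coefficients

variable {T : ℝ} {u₀ u₁ : ℝ → ℂ}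

theorem TSys.unique {lam : ℝ} {k : ℂ} {y z y' z' : ℝ → ℂ} (h : TSys lam T u₀ u₁ k y z)
    (h' : TSys lam T u₀ u₁ k y' z') (h₀ : ContinuousOn u₀ (Icc 0 T))
    (h₁ : ContinuousOn u₁ (Icc 0 T)) {t₀ : ℝ} (ht₀ : t₀ = 0 ∨ t₀ = T) (hy : y t₀ = y' t₀)
    (hz : z t₀ = z' t₀) {t : ℝ} (ht : t ∈ Icc 0 T) : y t = y' t ∧ z t = z' t := by
  have c₀ := ContinuousOn.conj h₀
  have c₁ := ContinuousOn.conj h₁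
  exact LinSys.unique h h' (by fun_prop) (by fun_prop) (by fun_prop) (by fun_prop) ht₀ hy hz ht

theorem XSys.unique {lam L : ℝ} {u : ℝ → ℂ} {k : ℂ} {y z y' z' : ℝ → ℂ} (h : XSys lam L u k y z)
    (h' : XSys lam L u k y' z') (hu : ContinuousOn u (Icc 0 L)) {t₀ : ℝ} (ht₀ : t₀ = 0 ∨ t₀ = L)
    (hy : y t₀ = y' t₀) (hz : z t₀ = z' t₀) {t : ℝ} (ht : t ∈ Icc 0 L) :
    y t = y' t ∧ z t = z' t := by
  have c₀ := ContinuousOn.conj hu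
  exact LinSys.unique h h' (by fun_prop) (by fun_prop) (by fun_prop) (by fun_prop) ht₀ hy hz ht

end Coefficients

/-- A continuous solution of the Lax pair in the integrated form: the `t`-part holds on the side
`x = x₀` and the `x`-part on all horizontal lines. -/
structure LaxSol (lam L T : ℝ) (q qx : ℝ → ℝ → ℂ) (x₀ : ℝ) (k : ℂ) (y z : ℝ → ℝ → ℂ) : Prop where
  cont_fst : ContinuousOn (fun p : ℝ × ℝ => y p.1 p.2) (Icc 0 L ×ˢ Icc 0 T)
  cont_snd : ContinuousOn (fun p : ℝ × ℝ => z p.1 p.2) (Icc 0 L ×ˢ Icc 0 T)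
  t_part : TSys lam T (q x₀) (qx x₀) k (y x₀) (z x₀)
  x_part : ∀ t ∈ Icc 0 T, XSys lam L (fun x => q x t) k (fun x => y x t) (fun x => z x t)

section Slices

variable {L T : ℝ}

theorem continuousOn_slice_fst {f : ℝ → ℝ → ℂ}
    (hf : ContinuousOn (fun p : ℝ × ℝ => f p.1 p.2) (Icc 0 L ×ˢ Icc 0 T)) {t : ℝ}
    (ht : t ∈ Icc 0 T) : ContinuousOn (fun x => f x t) (Icc 0 L) :=
  hf.comp (f := fun x => (x, t)) (by fun_prop) fun _ hx => ⟨hx, ht⟩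

theorem continuousOn_slice_snd {f : ℝ → ℝ → ℂ}
    (hf : ContinuousOn (fun p : ℝ × ℝ => f p.1 p.2) (Icc 0 L ×ˢ Icc 0 T)) {x : ℝ}
    (hx : x ∈ Icc 0 L) : ContinuousOn (f x) (Icc 0 T) :=
  hf.comp (f := fun t => (x, t)) (by fun_prop) fun _ ht => ⟨hx, ht⟩

end Slices

namespace SmoothData

variable {lam L T : ℝ} {q qx qxx qt qtt qxt qxtt : ℝ → ℝ → ℂ} {x₀ t₀ : ℝ} {k : ℂ}

theorem laxSol_unique (D : SmoothData lam L T q qx qxx qt qtt qxt qxtt) {y z y' z' : ℝ → ℝ → ℂ}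
    (hx₀ : x₀ = 0 ∨ x₀ = L) (ht₀ : t₀ = 0 ∨ t₀ = T) (h : LaxSol lam L T q qx x₀ k y z)
    (h' : LaxSol lam L T q qx x₀ k y' z') (hy : y x₀ t₀ = y' x₀ t₀) (hz : z x₀ t₀ = z' x₀ t₀)
    {x t : ℝ} (hx : x ∈ Icc 0 L) (ht : t ∈ Icc 0 T) : y x t = y' x t ∧ z x t = z' x t := by
  have hm : x₀ ∈ Icc 0 L := by
    rcases hx₀ with rfl | rfl
    exacts [⟨le_rfl, D.L_pos.le⟩, ⟨D.L_pos.le, le_rfl⟩]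
  have h1 := TSys.unique h.t_part h'.t_part (continuousOn_slice_snd D.cont hm)
    (continuousOn_slice_snd D.cont_x hm) ht₀ hy hz ht
  exact XSys.unique (h.x_part t ht) (h'.x_part t ht) (continuousOn_slice_fst D.cont ht) hx₀
    h1.1 h1.2 hx

theorem exists_laxSol (D : SmoothData lam L T q qx qxx qt qtt qxt qxtt)
    (hx₀ : x₀ = 0 ∨ x₀ = L) (ht₀ : t₀ = 0 ∨ t₀ = T) (k c d : ℂ) :
    ∃ y z : ℝ → ℝ → ℂ, LaxSol lam L T q qx x₀ k y z ∧ y x₀ t₀ = c ∧ z x₀ t₀ = d := by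
  have hm : x₀ ∈ Icc 0 L := by
    rcases hx₀ with rfl | rfl
    exacts [⟨le_rfl, D.L_pos.le⟩, ⟨D.L_pos.le, le_rfl⟩]
  have hxm : MapsTo (fun p : ℝ × ℝ => (x₀, p.2)) (Icc (0 : ℝ) 1 ×ˢ Icc 0 T)
      (Icc 0 L ×ˢ Icc 0 T) := fun p hp => ⟨hm, hp.2⟩
  have c0 : ContinuousOn (fun p : ℝ × ℝ => q x₀ p.2) (Icc (0 : ℝ) 1 ×ˢ Icc 0 T) :=
    D.cont.comp (f := fun p : ℝ × ℝ => (x₀, p.2)) (by fun_prop) hxm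
  have c1 : ContinuousOn (fun p : ℝ × ℝ => qx x₀ p.2) (Icc (0 : ℝ) 1 ×ˢ Icc 0 T) :=
    D.cont_x.comp (f := fun p : ℝ × ℝ => (x₀, p.2)) (by fun_prop) hxm
  have c0' := ContinuousOn.conj c0
  have c1' := ContinuousOn.conj c1
  -- On the side x = x₀ there is no parameter; `[0, 1]` is a dummy parameter interval.
  obtain ⟨Y, Z, -, -, H⟩ := LinSys.exists_param (c := 0) (d := 1) D.T_pos.le zero_le_one
    (α := fun _ t => -4 * Complex.I * k ^ 2
      - Complex.I * lam * (q x₀ t * (starRingEnd ℂ) (q x₀ t)))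
    (β := fun _ t => 2 * k * q x₀ t + Complex.I * qx x₀ t)
    (γ := fun _ t => lam * (2 * k * (starRingEnd ℂ) (q x₀ t)
      - Complex.I * (starRingEnd ℂ) (qx x₀ t)))
    (δ := fun _ t => Complex.I * lam * (q x₀ t * (starRingEnd ℂ) (q x₀ t)))
    (y₀ := fun _ => c) (z₀ := fun _ => d)
    (continuousOn_const.sub (continuousOn_const.mul (c0.mul c0')))
    ((continuousOn_const.mul c0).add (continuousOn_const.mul c1))
    (by fun_prop) (continuousOn_const.mul (c0.mul c0'))
    continuousOn_const continuousOn_const ht₀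
  obtain ⟨h1, h2, h3⟩ := H 0 ⟨le_rfl, zero_le_one⟩
  have cs : ContinuousOn (fun p : ℝ × ℝ => q p.2 p.1) (Icc 0 T ×ˢ Icc 0 L) :=
    D.cont.comp (f := fun p : ℝ × ℝ => (p.2, p.1)) (by fun_prop) fun p hp => ⟨hp.2, hp.1⟩
  have cs' := ContinuousOn.conj cs
  -- Now t is the parameter of the x-systems, which start from the solution on the side; this gives
  -- continuity jointly in (x,t).
  obtain ⟨y, z, hy, hz, H'⟩ := LinSys.exists_param D.L_pos.le D.T_pos.le
    (α := fun _ _ => -2 * Complex.I * k) (β := fun t x => q x t)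
    (γ := fun t x => lam * (starRingEnd ℂ) (q x t)) (δ := fun _ _ => 0) (y₀ := Y 0) (z₀ := Z 0)
    (by fun_prop) cs (by fun_prop) (by fun_prop) h1.continuousOn_fst h1.continuousOn_snd hx₀
  have hsw : MapsTo (fun p : ℝ × ℝ => (p.2, p.1)) (Icc 0 L ×ˢ Icc 0 T) (Icc 0 T ×ˢ Icc 0 L) :=
    fun p hp => ⟨hp.2, hp.1⟩
  have ht₀' : t₀ ∈ Icc 0 T := by
    rcases ht₀ with rfl | rfl
    exacts [⟨le_rfl, D.T_pos.le⟩, ⟨D.T_pos.le, le_rfl⟩]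
  refine ⟨fun x t => y t x, fun x t => z t x, ⟨hy.comp (f := fun p : ℝ × ℝ => (p.2, p.1))
    (by fun_prop) hsw, hz.comp (f := fun p : ℝ × ℝ => (p.2, p.1)) (by fun_prop) hsw, ?_,
    fun t ht => (H' t ht).1⟩, (H' t₀ ht₀').2.1.trans h2, (H' t₀ ht₀').2.2.trans h3⟩
  have e1 : EqOn (fun t => y t x₀) (Y 0) (Icc 0 T) := fun t ht => (H' t ht).2.1
  have e2 : EqOn (fun t => z t x₀) (Z 0) (Icc 0 T) := fun t ht => (H' t ht).2.2
  constructor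
  · intro t ht
    simp only [(H' t ht).2.1, (H' t ht).2.2]
    exact (h1.fst t ht).congr e1 (e1 ht)
  · intro t ht
    simp only [(H' t ht).2.1, (H' t ht).2.2]
    exact (h1.snd t ht).congr e2 (e2 ht)

end SmoothData

/-- The weights of the adjoint action of `σ₃`, divided by two. -/
def adWeight (i j : Fin 2) : ℂ := !![0, 1; -1, 0] i j

/-- Conjugation by a diagonal matrix acts on each entry by a scalar, so the matrix integral equation
splits into scalar Duhamel formulas. -/
theorem expHat_apply (a : ℂ) (M : Matrix (Fin 2) (Fin 2) ℂ) (i j : Fin 2) :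
    expHat a M i j = Complex.exp (2 * adWeight i j * a) * M i j := by
  have h : Complex.exp (-a) * Complex.exp a = 1 := by rw [← Complex.exp_add]; simp
  have h2 : Complex.exp (2 * a) = Complex.exp a * Complex.exp a := by
    rw [← Complex.exp_add]; ring_nf
  have h3 : Complex.exp (-(2 * a)) = Complex.exp (-a) * Complex.exp (-a) := by
    rw [← Complex.exp_add]; ring_nf
  fin_cases i <;> fin_cases j <;>
    simp [expHat, adWeight, Matrix.mul_apply, Fin.sum_univ_two, Matrix.vecMul, dotProduct,
      h2, h3]
  · linear_combination (M 0 0) * h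
  · ring
  · ring
  · linear_combination (M 1 1) * h

theorem laxQ_mul_apply (lam : ℝ) (q : ℝ → ℝ → ℂ) (x t : ℝ) (M : Matrix (Fin 2) (Fin 2) ℂ)
    (j : Fin 2) : (laxQ lam q x t * M) 0 j = q x t * M 1 j ∧
      (laxQ lam q x t * M) 1 j = lam * (starRingEnd ℂ) (q x t) * M 0 j := by
  simp [laxQ, Matrix.mul_apply, Fin.sum_univ_two]

theorem laxQt_mul_apply {lam L : ℝ} {q : ℝ → ℝ → ℂ} {x t : ℝ} {p : ℂ}
    (hp : derivWithin (fun y => q y t) (Icc 0 L) x = p) (k : ℂ)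
    (M : Matrix (Fin 2) (Fin 2) ℂ) (j : Fin 2) :
    (laxQt lam L q x t k * M) 0 j = -Complex.I * lam * (q x t * (starRingEnd ℂ) (q x t)) * M 0 j
        + (2 * k * q x t + Complex.I * p) * M 1 j ∧
      (laxQt lam L q x t k * M) 1 j =
        lam * (2 * k * (starRingEnd ℂ) (q x t) - Complex.I * (starRingEnd ℂ) p) * M 0 j
        + Complex.I * lam * (q x t * (starRingEnd ℂ) (q x t)) * M 1 j := by
  rw [Complex.mul_conj']
  constructor <;>
  · simp [laxQt, laxQ, laxQx, sigma3, Matrix.mul_apply, Fin.sum_univ_two, hp,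
      -mul_eq_mul_right_iff, -mul_eq_mul_left_iff, -add_left_inj, -add_right_inj]
    ring

/-- The weight is zero on the diagonal and the identity matrix is zero off it. The homogeneous term
of Duhamel's formula therefore stays equal to the identity. -/
theorem one_apply_mul_exp_adWeight (i j : Fin 2) (s : ℂ) :
    (1 : Matrix (Fin 2) (Fin 2) ℂ) i j * Complex.exp (adWeight i j * s)
      = (1 : Matrix (Fin 2) (Fin 2) ℂ) i j := by
  fin_cases i <;> fin_cases j <;> simp [adWeight]

theorem ContinuousOn.matrix_apply {X : Type*} [TopologicalSpace X] {s : Set X}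
    {f : X → Matrix (Fin 2) (Fin 2) ℂ} (hf : ContinuousOn f s) (i j : Fin 2) :
    ContinuousOn (fun x => f x i j) s :=
  (continuous_id.matrix_elem i j).comp_continuousOn hf

namespace SmoothData

variable {lam L T : ℝ} {q qx qxx qt qtt qxt qxtt : ℝ → ℝ → ℂ} {x₀ t₀ : ℝ} {k : ℂ}

theorem derivWithin_eq (D : SmoothData lam L T q qx qxx qt qtt qxt qxtt) {x t : ℝ}
    (hx : x ∈ Icc 0 L) (ht : t ∈ Icc 0 T) :
    derivWithin (fun y => q y t) (Icc 0 L) x = qx x t :=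
  (D.deriv_x x hx t ht).derivWithin (uniqueDiffOn_Icc D.L_pos x hx)

/-- The integral equations of an eigenfunction are equivalent to the Lax pair. -/
theorem isEigenfunction_iff (D : SmoothData lam L T q qx qxx qt qtt qxt qxtt)
    (hx₀ : x₀ ∈ Icc 0 L) (ht₀ : t₀ ∈ Icc 0 T) {μ : ℝ → ℝ → ℂ → Matrix (Fin 2) (Fin 2) ℂ} :
    IsEigenfunction lam L T q x₀ t₀ μ ↔
      (∀ k, ContinuousOn (fun p : ℝ × ℝ => μ p.1 p.2 k) (Icc 0 L ×ˢ Icc 0 T)) ∧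
      ∀ k i j, μ x₀ t₀ k i j = (1 : Matrix (Fin 2) (Fin 2) ℂ) i j ∧
        (∀ t ∈ Icc 0 T, HasDerivWithinAt (fun t => μ x₀ t k i j)
          (-4 * Complex.I * k ^ 2 * adWeight i j * μ x₀ t k i j
            + (laxQt lam L q x₀ t k * μ x₀ t k) i j) (Icc 0 T) t) ∧
        ∀ t ∈ Icc 0 T, ∀ x ∈ Icc 0 L, HasDerivWithinAt (fun x => μ x t k i j)
          (-2 * Complex.I * k * adWeight i j * μ x t k i j
            + (laxQ lam q x t * μ x t k) i j) (Icc 0 L) x := by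
  have hgt : (∀ k, ContinuousOn (fun p : ℝ × ℝ => μ p.1 p.2 k) (Icc 0 L ×ˢ Icc 0 T)) →
      ∀ k i j, ContinuousOn (fun t => (laxQt lam L q x₀ t k * μ x₀ t k) i j) (Icc 0 T) := by
    intro h k i j
    have hm : ∀ i j, ContinuousOn (fun t => μ x₀ t k i j) (Icc 0 T) := fun i j =>
      continuousOn_slice_snd (f := fun x t => μ x t k i j) ((h k).matrix_apply i j) hx₀
    have c0 := continuousOn_slice_snd D.cont hx₀
    have c1 := continuousOn_slice_snd D.cont_x hx₀
    have c0' := ContinuousOn.conj c0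
    have c1' := ContinuousOn.conj c1
    have m0 := hm 0 j
    have m1 := hm 1 j
    fin_cases i
    · refine ContinuousOn.congr ?_ fun t ht =>
        (laxQt_mul_apply (D.derivWithin_eq hx₀ ht) k (μ x₀ t k) j).1
      fun_prop
    · refine ContinuousOn.congr ?_ fun t ht =>
        (laxQt_mul_apply (D.derivWithin_eq hx₀ ht) k (μ x₀ t k) j).2
      fun_prop
  have hgx : (∀ k, ContinuousOn (fun p : ℝ × ℝ => μ p.1 p.2 k) (Icc 0 L ×ˢ Icc 0 T)) →
      ∀ k i j, ∀ t ∈ Icc 0 T, ContinuousOn (fun x => (laxQ lam q x t * μ x t k) i j) (Icc 0 L) := by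
    intro h k i j t ht
    have hm : ∀ i j, ContinuousOn (fun x => μ x t k i j) (Icc 0 L) := fun i j =>
      continuousOn_slice_fst (f := fun x t => μ x t k i j) ((h k).matrix_apply i j) ht
    have c0 := continuousOn_slice_fst D.cont ht
    have c0' := ContinuousOn.conj c0
    have m0 := hm 0 j
    have m1 := hm 1 j
    fin_cases i
    · refine ContinuousOn.congr ?_ fun x hx => (laxQ_mul_apply lam q x t (μ x t k) j).1
      exact c0.mul m1
    · refine ContinuousOn.congr ?_ fun x hx => (laxQ_mul_apply lam q x t (μ x t k) j).2
      exact (continuousOn_const.mul c0').mul m0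
  -- The exponential in x − x₀ factors out of the t-integral. What is left is the value at x₀, which
  -- becomes the initial value in Duhamel's formula along the horizontal line.
  have hI1 : ∀ (k : ℂ) (i j : Fin 2) (x t : ℝ), (∫ t' in t₀..t,
      expHat (-Complex.I * (k * ((x - x₀ : ℝ) : ℂ) + 2 * k ^ 2 * ((t - t' : ℝ) : ℂ)))
            (laxQt lam L q x₀ t' k * μ x₀ t' k) i j)
      = Complex.exp (-2 * Complex.I * k * adWeight i j * ((x - x₀ : ℝ) : ℂ)) * ∫ t' in t₀..t,
        Complex.exp (-4 * Complex.I * k ^ 2 * adWeight i j * ((t - t' : ℝ) : ℂ)) *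
          (laxQt lam L q x₀ t' k * μ x₀ t' k) i j := by
    intro k i j x t
    rw [← intervalIntegral.integral_const_mul]
    refine intervalIntegral.integral_congr fun s _ => ?_
    have e : Complex.exp (2 * adWeight i j * (-Complex.I * (k * ((x - x₀ : ℝ) : ℂ)
        + 2 * k ^ 2 * ((t - s : ℝ) : ℂ))))
        = Complex.exp (-2 * Complex.I * k * adWeight i j * ((x - x₀ : ℝ) : ℂ)) *
          Complex.exp (-4 * Complex.I * k ^ 2 * adWeight i j * ((t - s : ℝ) : ℂ)) := by
      rw [← Complex.exp_add]; ring_nf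
    rw [expHat_apply, e, mul_assoc]
  have hI2 : ∀ (k : ℂ) (i j : Fin 2) (x t : ℝ), (∫ x' in x₀..x,
          expHat (-Complex.I * (k * ((x - x' : ℝ) : ℂ))) (laxQ lam q x' t * μ x' t k) i j)
      = ∫ x' in x₀..x, Complex.exp (-2 * Complex.I * k * adWeight i j * ((x - x' : ℝ) : ℂ)) *
          (laxQ lam q x' t * μ x' t k) i j := by
    intro k i j x t
    refine intervalIntegral.integral_congr fun s _ => ?_
    rw [expHat_apply]
    ring_nf
  have hδ1 : ∀ (k : ℂ) (i j : Fin 2) (t : ℝ), (1 : Matrix (Fin 2) (Fin 2) ℂ) i j *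
      Complex.exp (-4 * Complex.I * k ^ 2 * adWeight i j * ((t - t₀ : ℝ) : ℂ))
      = (1 : Matrix (Fin 2) (Fin 2) ℂ) i j := by
    intro k i j t
    rw [show -4 * Complex.I * k ^ 2 * adWeight i j * ((t - t₀ : ℝ) : ℂ)
      = adWeight i j * (-4 * Complex.I * k ^ 2 * ((t - t₀ : ℝ) : ℂ)) by ring,
      one_apply_mul_exp_adWeight]
  have hδ2 : ∀ (k : ℂ) (i j : Fin 2) (x : ℝ), (1 : Matrix (Fin 2) (Fin 2) ℂ) i j *
      Complex.exp (-2 * Complex.I * k * adWeight i j * ((x - x₀ : ℝ) : ℂ))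
      = (1 : Matrix (Fin 2) (Fin 2) ℂ) i j := by
    intro k i j x
    rw [show -2 * Complex.I * k * adWeight i j * ((x - x₀ : ℝ) : ℂ)
      = adWeight i j * (-2 * Complex.I * k * ((x - x₀ : ℝ) : ℂ)) by ring,
      one_apply_mul_exp_adWeight]
  constructor
  · intro h
    have hc := h.continuousOn
    refine ⟨hc, fun k i j => ?_⟩
    have h1 : ∀ t ∈ Icc 0 T, μ x₀ t k i j = (1 : Matrix (Fin 2) (Fin 2) ℂ) i j
        * Complex.exp (-4 * Complex.I * k ^ 2 * adWeight i j * ((t - t₀ : ℝ) : ℂ))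
        + ∫ t' in t₀..t,
          Complex.exp (-4 * Complex.I * k ^ 2 * adWeight i j * ((t - t' : ℝ) : ℂ)) *
          (laxQt lam L q x₀ t' k * μ x₀ t' k) i j := by
      intro t ht
      rw [h.integral_eq x₀ hx₀ t ht k i j, hI1, hδ1]
      simp
    obtain ⟨h2, h3⟩ := (duhamel_iff ht₀ _ _ (hgt hc k i j)).1 h1
    refine ⟨h2, h3, fun t ht => ?_⟩
    refine ((duhamel_iff hx₀ (-2 * Complex.I * k * adWeight i j) (μ x₀ t k i j)
      (hgx hc k i j t ht)).1 fun x hx => ?_).2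
    rw [h.integral_eq x hx t ht k i j, hI1, hI2, h1 t ht, hδ1, add_mul, hδ2,
      mul_comm (∫ t' in t₀..t, _)]
  · rintro ⟨hc, h⟩
    refine ⟨hc, fun x hx t ht k i j => ?_⟩
    obtain ⟨h0, h1, h2⟩ := h k i j
    have h3 := (duhamel_iff ht₀ _ _ (hgt hc k i j)).2 ⟨h0, h1⟩ t ht
    have h4 := (duhamel_iff hx₀ _ (μ x₀ t k i j) (hgx hc k i j t ht)).2 ⟨rfl, h2 t ht⟩ x hx
    rw [h4, h3, hI1, hI2, hδ1, add_mul, hδ2, mul_comm (∫ t' in t₀..t, _)]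

/-- Multiplication by this factor turns the second type of column into the first. -/
noncomputable def _root_.NLSInterval.phase (k : ℂ) (x t : ℝ) : ℂ :=
  Complex.exp (2 * Complex.I * k * x + 4 * Complex.I * k ^ 2 * t)

theorem _root_.NLSInterval.hasDerivAt_phase_fst (k : ℂ) (x t : ℝ) :
    HasDerivAt (fun x => phase k x t) (2 * Complex.I * k * phase k x t) x := by
  have := (((Complex.ofRealCLM.hasDerivAt (x := x)).const_mul (2 * Complex.I * k)).add_const
    (4 * Complex.I * k ^ 2 * t)).cexp
  exact this.congr_deriv (by simp [phase]; ring)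

theorem _root_.NLSInterval.hasDerivAt_phase_snd (k : ℂ) (x t : ℝ) :
    HasDerivAt (fun t => phase k x t) (4 * Complex.I * k ^ 2 * phase k x t) t := by
  have := (((Complex.ofRealCLM.hasDerivAt (x := t)).const_mul (4 * Complex.I * k ^ 2)).const_add
    (2 * Complex.I * k * x)).cexp
  exact this.congr_deriv (by simp [phase]; ring)

theorem _root_.NLSInterval.hasDerivAt_phase_inv_fst (k : ℂ) (x t : ℝ) :
    HasDerivAt (fun x => (phase k x t)⁻¹) (-2 * Complex.I * k * (phase k x t)⁻¹) x := by
  have hne : phase k x t ≠ 0 := Complex.exp_ne_zero _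
  exact ((hasDerivAt_phase_fst k x t).fun_inv hne).congr_deriv (by field_simp)

theorem _root_.NLSInterval.hasDerivAt_phase_inv_snd (k : ℂ) (x t : ℝ) :
    HasDerivAt (fun t => (phase k x t)⁻¹) (-4 * Complex.I * k ^ 2 * (phase k x t)⁻¹) t := by
  have hne : phase k x t ≠ 0 := Complex.exp_ne_zero _
  exact ((hasDerivAt_phase_snd k x t).fun_inv hne).congr_deriv (by field_simp)

theorem _root_.NLSInterval.continuous_phase (k : ℂ) :
    Continuous fun p : ℝ × ℝ => phase k p.1 p.2 := by
  unfold phase; fun_prop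

/-- The columns of an eigenfunction solve the Lax pair. -/
theorem laxSol_of_isEigenfunction (D : SmoothData lam L T q qx qxx qt qtt qxt qxtt)
    (hx₀ : x₀ ∈ Icc 0 L) (ht₀ : t₀ ∈ Icc 0 T) {μ : ℝ → ℝ → ℂ → Matrix (Fin 2) (Fin 2) ℂ}
    (hμ : IsEigenfunction lam L T q x₀ t₀ μ) (k : ℂ) :
    LaxSol lam L T q qx x₀ k (fun x t => μ x t k 0 1) (fun x t => μ x t k 1 1) ∧
      LaxSol lam L T q qx x₀ k (fun x t => (phase k x t)⁻¹ * μ x t k 0 0)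
        (fun x t => (phase k x t)⁻¹ * μ x t k 1 0) := by
  obtain ⟨hc, h⟩ := (D.isEigenfunction_iff hx₀ ht₀).1 hμ
  have hci : Continuous fun p : ℝ × ℝ => (phase k p.1 p.2)⁻¹ :=
    (continuous_phase k).inv₀ fun p => Complex.exp_ne_zero _
  have hQt : ∀ t ∈ Icc 0 T, ∀ j, _ := fun t ht j =>
    laxQt_mul_apply (lam := lam) (D.derivWithin_eq hx₀ ht) k (μ x₀ t k) j
  have hQ : ∀ x t : ℝ, ∀ j, _ := fun x t j => laxQ_mul_apply lam q x t (μ x t k) j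
  refine ⟨⟨(hc k).matrix_apply 0 1, (hc k).matrix_apply 1 1, ⟨fun t ht => ?_, fun t ht => ?_⟩,
    fun t ht => ⟨fun x hx => ?_, fun x hx => ?_⟩⟩,
    ⟨hci.continuousOn.mul ((hc k).matrix_apply 0 0), hci.continuousOn.mul ((hc k).matrix_apply 1 0),
    ⟨fun t ht => ?_, fun t ht => ?_⟩, fun t ht => ⟨fun x hx => ?_, fun x hx => ?_⟩⟩⟩
  · refine ((h k 0 1).2.1 t ht).congr_deriv ?_
    rw [(hQt t ht 1).1]; simp [adWeight]; ring
  · refine ((h k 1 1).2.1 t ht).congr_deriv ?_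
    rw [(hQt t ht 1).2]; simp [adWeight]
  · refine ((h k 0 1).2.2 t ht x hx).congr_deriv ?_
    rw [(hQ x t 1).1]; simp [adWeight]
  · refine ((h k 1 1).2.2 t ht x hx).congr_deriv ?_
    rw [(hQ x t 1).2]; simp [adWeight]
  · refine ((hasDerivAt_phase_inv_snd k x₀ t).hasDerivWithinAt.mul
      ((h k 0 0).2.1 t ht)).congr_deriv ?_
    rw [(hQt t ht 0).1]; simp [adWeight]; ring
  · refine ((hasDerivAt_phase_inv_snd k x₀ t).hasDerivWithinAt.mul
      ((h k 1 0).2.1 t ht)).congr_deriv ?_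
    rw [(hQt t ht 0).2]; simp [adWeight]; ring
  · refine ((hasDerivAt_phase_inv_fst k x t).hasDerivWithinAt.mul
      ((h k 0 0).2.2 t ht x hx)).congr_deriv ?_
    rw [(hQ x t 0).1]; simp [adWeight]; ring
  · refine ((hasDerivAt_phase_inv_fst k x t).hasDerivWithinAt.mul
      ((h k 1 0).2.2 t ht x hx)).congr_deriv ?_
    rw [(hQ x t 0).2]; simp [adWeight]; ring

/-- Converse of `laxSol_of_isEigenfunction`. The initial value of the pair y', z' is the inverse
phase, so that after multiplication by `phase` the first column is (1, 0) at the corner. -/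
theorem isEigenfunction_of_laxSol (D : SmoothData lam L T q qx qxx qt qtt qxt qxtt)
    (hx₀ : x₀ ∈ Icc 0 L) (ht₀ : t₀ ∈ Icc 0 T) {y z y' z' : ℂ → ℝ → ℝ → ℂ}
    (h : ∀ k, LaxSol lam L T q qx x₀ k (y k) (z k)) (h₁ : ∀ k, y k x₀ t₀ = 0)
    (h₂ : ∀ k, z k x₀ t₀ = 1) (h' : ∀ k, LaxSol lam L T q qx x₀ k (y' k) (z' k))
    (h₁' : ∀ k, y' k x₀ t₀ = (phase k x₀ t₀)⁻¹) (h₂' : ∀ k, z' k x₀ t₀ = 0) :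
    IsEigenfunction lam L T q x₀ t₀ fun x t k =>
      !![phase k x t * y' k x t, y k x t; phase k x t * z' k x t, z k x t] := by
  rw [D.isEigenfunction_iff hx₀ ht₀]
  constructor
  · intro k
    have c0 := continuous_phase k
    have c1 := (h k).cont_fst
    have c2 := (h k).cont_snd
    have c3 := (h' k).cont_fst
    have c4 := (h' k).cont_snd
    refine continuousOn_pi.2 fun i => continuousOn_pi.2 fun j => ?_
    fin_cases i <;> fin_cases j
    exacts [c0.continuousOn.mul c3, c1, c0.continuousOn.mul c4, c2]
  · intro k i j
    have hne : phase k x₀ t₀ ≠ 0 := Complex.exp_ne_zero _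
    have hQt : ∀ t ∈ Icc 0 T, ∀ M, ∀ j, _ := fun t ht M j =>
      laxQt_mul_apply (lam := lam) (D.derivWithin_eq hx₀ ht) k M j
    have hQ : ∀ x t : ℝ, ∀ M, ∀ j, _ := fun x t M j => laxQ_mul_apply lam q x t M j
    refine ⟨?_, fun t ht => ?_, fun t ht x hx => ?_⟩
    · fin_cases i <;> fin_cases j <;> simp [h₁, h₂, h₁', h₂', hne]
    · fin_cases i <;> fin_cases j
      · refine ((hasDerivAt_phase_snd k x₀ t).hasDerivWithinAt.mul
          ((h' k).t_part.fst t ht)).congr_deriv ?_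
        simp only [Fin.zero_eta, Fin.isValue, (hQt t ht _ _).1]
        simp [adWeight]; ring
      · refine ((h k).t_part.fst t ht).congr_deriv ?_
        simp only [Fin.zero_eta, Fin.isValue, Fin.mk_one, (hQt t ht _ _).1]
        simp [adWeight]; ring
      · refine ((hasDerivAt_phase_snd k x₀ t).hasDerivWithinAt.mul
          ((h' k).t_part.snd t ht)).congr_deriv ?_
        simp only [Fin.zero_eta, Fin.isValue, Fin.mk_one, (hQt t ht _ _).2]
        simp [adWeight]; ring
      · refine ((h k).t_part.snd t ht).congr_deriv ?_
        simp only [Fin.isValue, Fin.mk_one, (hQt t ht _ _).2]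
        simp [adWeight]
    · fin_cases i <;> fin_cases j
      · refine ((hasDerivAt_phase_fst k x t).hasDerivWithinAt.mul
          (((h' k).x_part t ht).fst x hx)).congr_deriv ?_
        simp only [Fin.zero_eta, Fin.isValue, (hQ _ _ _ _).1]
        simp [adWeight]; ring
      · refine (((h k).x_part t ht).fst x hx).congr_deriv ?_
        simp only [Fin.zero_eta, Fin.isValue, Fin.mk_one, (hQ _ _ _ _).1]
        simp [adWeight]
      · refine ((hasDerivAt_phase_fst k x t).hasDerivWithinAt.mul
          (((h' k).x_part t ht).snd x hx)).congr_deriv ?_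
        simp only [Fin.zero_eta, Fin.isValue, Fin.mk_one, (hQ _ _ _ _).2]
        simp [adWeight]; ring
      · refine (((h k).x_part t ht).snd x hx).congr_deriv ?_
        simp only [Fin.isValue, Fin.mk_one, (hQ _ _ _ _).2]
        simp [adWeight]

theorem mem_Icc_left (D : SmoothData lam L T q qx qxx qt qtt qxt qxtt)
    (hx₀ : x₀ = 0 ∨ x₀ = L) : x₀ ∈ Icc 0 L := by
  rcases hx₀ with rfl | rfl
  exacts [⟨le_rfl, D.L_pos.le⟩, ⟨D.L_pos.le, le_rfl⟩]

theorem mem_Icc_right (D : SmoothData lam L T q qx qxx qt qtt qxt qxtt)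
    (ht₀ : t₀ = 0 ∨ t₀ = T) : t₀ ∈ Icc 0 T := by
  rcases ht₀ with rfl | rfl
  exacts [⟨le_rfl, D.T_pos.le⟩, ⟨D.T_pos.le, le_rfl⟩]

theorem exists_isEigenfunction (D : SmoothData lam L T q qx qxx qt qtt qxt qxtt)
    (hx₀ : x₀ = 0 ∨ x₀ = L) (ht₀ : t₀ = 0 ∨ t₀ = T) :
    ∃ μ, IsEigenfunction lam L T q x₀ t₀ μ := by
  choose y z h hy hz using fun k => D.exists_laxSol hx₀ ht₀ k 0 1
  choose y' z' h' hy' hz' using fun k => D.exists_laxSol hx₀ ht₀ k (phase k x₀ t₀)⁻¹ 0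
  exact ⟨_, D.isEigenfunction_of_laxSol (D.mem_Icc_left hx₀) (D.mem_Icc_right ht₀)
    h hy hz h' hy' hz'⟩

theorem isEigenfunction_unique (D : SmoothData lam L T q qx qxx qt qtt qxt qxtt)
    (hx₀ : x₀ = 0 ∨ x₀ = L) (ht₀ : t₀ = 0 ∨ t₀ = T)
    {μ μ' : ℝ → ℝ → ℂ → Matrix (Fin 2) (Fin 2) ℂ} (hμ : IsEigenfunction lam L T q x₀ t₀ μ)
    (hμ' : IsEigenfunction lam L T q x₀ t₀ μ') {x t : ℝ} (hx : x ∈ Icc 0 L) (ht : t ∈ Icc 0 T)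
    (k : ℂ) : μ x t k = μ' x t k := by
  have mx := D.mem_Icc_left hx₀
  have mt := D.mem_Icc_right ht₀
  obtain ⟨h1, h2⟩ := D.laxSol_of_isEigenfunction mx mt hμ k
  obtain ⟨h1', h2'⟩ := D.laxSol_of_isEigenfunction mx mt hμ' k
  have h0 : μ x₀ t₀ k = μ' x₀ t₀ k := by
    ext i j
    rw [(((D.isEigenfunction_iff mx mt).1 hμ).2 k i j).1,
      (((D.isEigenfunction_iff mx mt).1 hμ').2 k i j).1]
  have u1 := D.laxSol_unique hx₀ ht₀ h1 h1' (by simp [h0]) (by simp [h0]) hx ht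
  have u2 := D.laxSol_unique hx₀ ht₀ h2 h2' (by simp [h0]) (by simp [h0]) hx ht
  have hne : (phase k x t)⁻¹ ≠ 0 := inv_ne_zero (Complex.exp_ne_zero _)
  ext i j
  fin_cases i <;> fin_cases j
  exacts [mul_left_cancel₀ hne u2.1, u1.1, mul_left_cancel₀ hne u2.2, u1.2]

end SmoothData

/-! ### Symmetry, Wronskian and dependence on k on a vertical side -/

theorem HasDerivWithinAt.conj {f : ℝ → ℂ} {f' : ℂ} {s : Set ℝ} {t : ℝ}
    (h : HasDerivWithinAt f f' s t) :
    HasDerivWithinAt (fun t => (starRingEnd ℂ) (f t)) ((starRingEnd ℂ) f') s t :=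
  (Complex.conjCLE.toContinuousLinearMap.hasFDerivAt.comp_hasDerivWithinAt t h :)

section Side

variable {lam T : ℝ} {u₀ u₁ : ℝ → ℂ}

/-- The symmetry of the Lax pair under complex conjugation. -/
theorem TSys.conj {k : ℂ} {y z : ℝ → ℂ} (h : TSys lam T u₀ u₁ ((starRingEnd ℂ) k) y z) (x₀ : ℝ) :
    TSys lam T u₀ u₁ k (fun t => (phase k x₀ t)⁻¹ * (starRingEnd ℂ) (z t))
      (fun t => (phase k x₀ t)⁻¹ * (lam * (starRingEnd ℂ) (y t))) := by
  constructor
  · intro t ht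
    refine ((hasDerivAt_phase_inv_snd k x₀ t).hasDerivWithinAt.mul
      (HasDerivWithinAt.conj (h.snd t ht))).congr_deriv ?_
    simp only [map_add, map_mul, map_sub, Complex.conj_conj, Complex.conj_ofReal, Complex.conj_I,
      map_ofNat]
    ring
  · intro t ht
    refine ((hasDerivAt_phase_inv_snd k x₀ t).hasDerivWithinAt.mul
      ((HasDerivWithinAt.conj (h.fst t ht)).const_mul (lam : ℂ))).congr_deriv ?_
    simp only [map_add, map_mul, map_sub, map_neg, map_pow, Complex.conj_conj, Complex.conj_ofReal,
      Complex.conj_I, map_ofNat]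
    ring

/-- The terms with |u₀|² cancel in the trace of the t-part, which is −4ik². -/
theorem TSys.wronskian {k : ℂ} {y z y' z' : ℝ → ℂ} (h : TSys lam T u₀ u₁ k y z)
    (h' : TSys lam T u₀ u₁ k y' z') {t₀ t : ℝ} (ht₀ : t₀ ∈ Icc 0 T) (ht : t ∈ Icc 0 T) :
    y t * z' t - y' t * z t = (y t₀ * z' t₀ - y' t₀ * z t₀)
      * Complex.exp (-4 * Complex.I * k ^ 2 * ((t - t₀ : ℝ) : ℂ)) := by
  have := (duhamel_iff (y := fun t => y t * z' t - y' t * z t) (g := fun _ => 0) ht₀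
    (-4 * Complex.I * k ^ 2) (y t₀ * z' t₀ - y' t₀ * z t₀) continuousOn_const).2
    ⟨rfl, fun s hs => (LinSys.det_const h h' hs).congr_deriv (by ring)⟩ t ht
  simpa using this

/-- Duhamel's formula with rate −4ik² in the first equation and rate 0 in the second; the remaining
terms are treated as forcing. -/
theorem TSys.volterraSystem {g₀ g₁ : ℝ → ℂ} {F₁ F₂ : ℝ → ℂ → ℂ}
    (hc₀ : ContinuousOn u₀ (Icc 0 T)) (hc₁ : ContinuousOn u₁ (Icc 0 T))
    (h : ∀ k, TSys lam T u₀ u₁ k (fun t => F₁ t k) (fun t => F₂ t k)) (h₁ : ∀ k, F₁ 0 k = 0)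
    (h₂ : ∀ k, F₂ 0 k = 1) (hg₀ : ∀ t ∈ Icc 0 T, u₀ t = g₀ t) (hg₁ : ∀ t ∈ Icc 0 T, u₁ t = g₁ t) :
    VolterraSystem lam T g₀ g₁ F₁ F₂ := by
  intro t ht k
  have h0 : (0 : ℝ) ∈ Icc 0 T := ⟨le_rfl, ht.1.trans ht.2⟩
  have c0' := ContinuousOn.conj hc₀
  have c1' := ContinuousOn.conj hc₁
  have cF := (h k).continuousOn_fst
  have cG := (h k).continuousOn_snd
  have hsub : uIcc 0 t ⊆ Icc 0 T := uIcc_subset_Icc h0 ht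
  constructor
  · have := (duhamel_iff (y := fun t => F₁ t k) (g := fun t =>
      -Complex.I * lam * (u₀ t * (starRingEnd ℂ) (u₀ t)) * F₁ t k
        + (2 * k * u₀ t + Complex.I * u₁ t) * F₂ t k) h0 (-4 * Complex.I * k ^ 2) 0
      (by fun_prop)).2 ⟨h₁ k, fun s hs => ((h k).fst s hs).congr_deriv (by ring)⟩ t ht
    simp only [zero_mul, zero_add] at this
    rw [this]
    refine intervalIntegral.integral_congr fun s hs => ?_
    rw [hg₀ s (hsub hs), hg₁ s (hsub hs), Complex.mul_conj']
    push_cast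
    ring_nf
  · have := (duhamel_iff (y := fun t => F₂ t k) (g := fun t =>
      lam * ((2 * k * (starRingEnd ℂ) (u₀ t) - Complex.I * (starRingEnd ℂ) (u₁ t)) * F₁ t k
        + Complex.I * (u₀ t * (starRingEnd ℂ) (u₀ t)) * F₂ t k)) h0 0 1
      (by fun_prop)).2 ⟨h₂ k, fun s hs => ((h k).snd s hs).congr_deriv (by ring)⟩ t ht
    simp only [zero_mul, Complex.exp_zero, one_mul, intervalIntegral.integral_const_mul] at this
    rw [this]
    congr 2
    refine intervalIntegral.integral_congr fun s hs => ?_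
    rw [hg₀ s (hsub hs), hg₁ s (hsub hs), Complex.mul_conj']
    push_cast
    rfl

theorem hasDerivAt_of_quadratic_bound {f : ℂ → ℂ} {f' k : ℂ} {C : ℝ}
    (h : ∀ k', ‖k' - k‖ ≤ 1 → ‖f k' - f k - (k' - k) * f'‖ ≤ C * ‖k' - k‖ ^ 2) :
    HasDerivAt f f' k := by
  rw [hasDerivAt_iff_isLittleO]
  have h1 : (fun k' => f k' - f k - (k' - k) • f') =O[𝓝 k] fun k' => ‖k' - k‖ ^ 2 := by
    refine Asymptotics.IsBigO.of_bound C ?_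
    filter_upwards [Metric.closedBall_mem_nhds k one_pos] with k' hk'
    have := h k' (by simpa [dist_eq_norm] using hk')
    simpa using this
  refine h1.trans_isLittleO ?_
  have : Tendsto (fun k' => k' - k) (𝓝 k) (𝓝 0) := by
    have : Continuous fun k' : ℂ => k' - k := by fun_prop
    simpa using this.tendsto k
  exact (Asymptotics.isLittleO_norm_pow_id one_lt_two).comp_tendsto this

/-- Solutions of the `t`-part with fixed initial values are entire functions of `k`. -/
theorem TSys.differentiable {F₁ F₂ : ℝ → ℂ → ℂ} (hT : 0 ≤ T)
    (hc₀ : ContinuousOn u₀ (Icc 0 T)) (hc₁ : ContinuousOn u₁ (Icc 0 T))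
    (h : ∀ k, TSys lam T u₀ u₁ k (fun t => F₁ t k) (fun t => F₂ t k)) {c d : ℂ}
    (h₁ : ∀ k, F₁ 0 k = c) (h₂ : ∀ k, F₂ 0 k = d) {t : ℝ} (ht : t ∈ Icc 0 T) :
    Differentiable ℂ (F₁ t) ∧ Differentiable ℂ (F₂ t) := by
  suffices H : ∀ k, ∃ p s : ℂ, HasDerivAt (F₁ t) p k ∧ HasDerivAt (F₂ t) s k from
    ⟨fun k => (H k).elim fun p hp => hp.elim fun s hs => hs.1.differentiableAt,
      fun k => (H k).elim fun p hp => hp.elim fun s hs => hs.2.differentiableAt⟩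
  intro k
  have c0' := ContinuousOn.conj hc₀
  have c1' := ContinuousOn.conj hc₁
  have cF := (h k).continuousOn_fst
  have cG := (h k).continuousOn_snd
  have hsnd : MapsTo (fun p : ℝ × ℝ => p.2) (Icc (0 : ℝ) 1 ×ˢ Icc 0 T) (Icc 0 T) :=
    fun p hp => hp.2
  have hlift : ∀ {f : ℝ → ℂ}, ContinuousOn f (Icc 0 T) →
      ContinuousOn (fun p : ℝ × ℝ => f p.2) (Icc (0 : ℝ) 1 ×ˢ Icc 0 T) :=
    fun hf => hf.comp (f := fun p : ℝ × ℝ => p.2) (by fun_prop) hsnd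
  have cα : ContinuousOn (fun t => -4 * Complex.I * k ^ 2
      - Complex.I * lam * (u₀ t * (starRingEnd ℂ) (u₀ t))) (Icc 0 T) := by fun_prop
  have cβ : ContinuousOn (fun t => 2 * k * u₀ t + Complex.I * u₁ t) (Icc 0 T) := by fun_prop
  have cγ : ContinuousOn (fun t => lam * (2 * k * (starRingEnd ℂ) (u₀ t)
      - Complex.I * (starRingEnd ℂ) (u₁ t))) (Icc 0 T) := by fun_prop
  have cδ : ContinuousOn (fun t => Complex.I * lam * (u₀ t * (starRingEnd ℂ) (u₀ t)))
      (Icc 0 T) := by fun_prop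
  have cr : ContinuousOn (fun t => -8 * Complex.I * k * F₁ t k + 2 * u₀ t * F₂ t k)
      (Icc 0 T) := by fun_prop
  have cs : ContinuousOn (fun t => 2 * lam * (starRingEnd ℂ) (u₀ t) * F₁ t k) (Icc 0 T) := by
    fun_prop
  -- P and S solve the system formally differentiated in k, with zero initial values because those
  -- of F₁ and F₂ do not depend on k.
  obtain ⟨P, S, -, -, H⟩ := exists_forced_solution_left (c := 0) (d := 1) hT zero_le_one
    (α := fun _ t => -4 * Complex.I * k ^ 2 - Complex.I * lam * (u₀ t * (starRingEnd ℂ) (u₀ t)))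
    (β := fun _ t => 2 * k * u₀ t + Complex.I * u₁ t)
    (γ := fun _ t => lam * (2 * k * (starRingEnd ℂ) (u₀ t) - Complex.I * (starRingEnd ℂ) (u₁ t)))
    (δ := fun _ t => Complex.I * lam * (u₀ t * (starRingEnd ℂ) (u₀ t)))
    (r := fun _ t => -8 * Complex.I * k * F₁ t k + 2 * u₀ t * F₂ t k)
    (s := fun _ t => 2 * lam * (starRingEnd ℂ) (u₀ t) * F₁ t k)
    (y₀ := fun _ => 0) (z₀ := fun _ => 0)
    (hlift cα) (hlift cβ) (hlift cγ) (hlift cδ) (hlift cr) (hlift cs) continuousOn_const continuousOn_const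
  obtain ⟨hP, hS, hP0, hS0⟩ := H 0 ⟨le_rfl, zero_le_one⟩
  have cP : ContinuousOn (P 0) (Icc 0 T) := fun t ht => (hP t ht).continuousWithinAt
  have cS : ContinuousOn (S 0) (Icc 0 T) := fun t ht => (hS t ht).continuousWithinAt
  obtain ⟨B₀, hB₀, hB₀'⟩ := exists_norm_le_Icc hc₀
  obtain ⟨B₁, hB₁, hB₁'⟩ := exists_norm_le_Icc hc₁
  obtain ⟨BP, hBP, hBP'⟩ := exists_norm_le_Icc cP
  obtain ⟨BS, hBS, hBS'⟩ := exists_norm_le_Icc cS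
  obtain ⟨BF, hBF, hBF'⟩ := exists_norm_le_Icc cF
  -- K bounds the coefficients at all k' with ‖k' − k‖ ≤ 1. M bounds the forcing in the equation for
  -- F(k') − F(k) − (k' − k)F'(k), once its factor (k' − k)² is removed.
  set K : ℝ := 4 * (‖k‖ + 1) ^ 2 + |lam| * B₀ ^ 2 + (1 + |lam|) * (2 * (‖k‖ + 1) * B₀ + B₁) with hK
  set M : ℝ := 4 * BF + 4 * (2 * ‖k‖ + 1) * BP + 2 * B₀ * BS + 2 * |lam| * B₀ * BP with hM
  have hKpos : 0 ≤ K := by positivity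
  have hMpos : 0 ≤ M := by positivity
  have bound : ∀ k', ‖k' - k‖ ≤ 1 →
      ‖F₁ t k' - F₁ t k - (k' - k) * P 0 t‖ ^ 2 + ‖F₂ t k' - F₂ t k - (k' - k) * S 0 t‖ ^ 2
        ≤ (0 + 0 + 2 * (M * ‖k' - k‖ ^ 2) ^ 2) * Real.exp ((4 * K + 1) * (t - 0)) := by
    intro k' hk'
    have hn : ‖k'‖ ≤ ‖k‖ + 1 := by
      calc ‖k'‖ = ‖k + (k' - k)‖ := by ring_nf
        _ ≤ ‖k‖ + ‖k' - k‖ := norm_add_le _ _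
        _ ≤ _ := by linarith
    have hnn : ∀ s ∈ Icc 0 T, ‖u₀ s * (starRingEnd ℂ) (u₀ s)‖ ≤ B₀ ^ 2 := by
      intro s hs
      rw [norm_mul, RCLike.norm_conj, ← sq]
      gcongr
      exact hB₀' s hs
    have := energy_estimate (K := K) (ε := M * ‖k' - k‖ ^ 2) (a := 0) (b := T)
      (y := fun t => F₁ t k' - F₁ t k - (k' - k) * P 0 t)
      (z := fun t => F₂ t k' - F₂ t k - (k' - k) * S 0 t)
      (α := fun t => -4 * Complex.I * k' ^ 2 - Complex.I * lam * (u₀ t * (starRingEnd ℂ) (u₀ t)))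
      (β := fun t => 2 * k' * u₀ t + Complex.I * u₁ t)
      (γ := fun t => lam * (2 * k' * (starRingEnd ℂ) (u₀ t) - Complex.I * (starRingEnd ℂ) (u₁ t)))
      (δ := fun t => Complex.I * lam * (u₀ t * (starRingEnd ℂ) (u₀ t)))
      (r := fun t => (k' - k) ^ 2 * (-4 * Complex.I * F₁ t k
        - 4 * Complex.I * (k' + k) * P 0 t + 2 * u₀ t * S 0 t))
      (s := fun t => (k' - k) ^ 2 * (2 * lam * (starRingEnd ℂ) (u₀ t) * P 0 t)) hKpos
      (fun s hs => ((((h k').fst s hs).sub ((h k).fst s hs)).sub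
        ((hP s hs).const_mul (k' - k))).congr_deriv (by ring))
      (fun s hs => ((((h k').snd s hs).sub ((h k).snd s hs)).sub
        ((hS s hs).const_mul (k' - k))).congr_deriv (by ring))
      (fun s hs => ?_) (fun s hs => ?_) (fun s hs => ?_) (fun s hs => ?_) (fun s hs => ?_)
      (fun s hs => ?_) ht
    · simpa [h₁, h₂, hP0, hS0] using this
    · refine (Complex.re_le_norm _).trans ((norm_sub_le _ _).trans ?_)
      have e1 : ‖-4 * Complex.I * k' ^ 2‖ ≤ 4 * (‖k‖ + 1) ^ 2 := by
        simp only [norm_mul, norm_neg, norm_pow, Complex.norm_I, Complex.norm_ofNat]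
        have : ‖k'‖ ^ 2 ≤ (‖k‖ + 1) ^ 2 := by gcongr
        linarith
      have e2 : ‖Complex.I * lam * (u₀ s * (starRingEnd ℂ) (u₀ s))‖ ≤ |lam| * B₀ ^ 2 := by
        rw [norm_mul, norm_mul, Complex.norm_I, Complex.norm_real, one_mul, Real.norm_eq_abs]
        gcongr
        exact hnn s hs
      have e3 : 0 ≤ (1 + |lam|) * (2 * (‖k‖ + 1) * B₀ + B₁) := by positivity
      linarith
    · refine (Complex.re_le_norm _).trans ?_
      have e2 : ‖Complex.I * lam * (u₀ s * (starRingEnd ℂ) (u₀ s))‖ ≤ |lam| * B₀ ^ 2 := by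
        rw [norm_mul, norm_mul, Complex.norm_I, Complex.norm_real, one_mul, Real.norm_eq_abs]
        gcongr
        exact hnn s hs
      have e3 : 0 ≤ (1 + |lam|) * (2 * (‖k‖ + 1) * B₀ + B₁) := by positivity
      have e4 : 0 ≤ 4 * (‖k‖ + 1) ^ 2 := by positivity
      linarith
    · have e1 : ‖2 * k' * u₀ s + Complex.I * u₁ s‖ ≤ 2 * (‖k‖ + 1) * B₀ + B₁ := by
        refine (norm_add_le _ _).trans ?_
        simp only [norm_mul, Complex.norm_I, Complex.norm_ofNat, one_mul]
        gcongr
        exacts [hB₀' s hs, hB₁' s hs]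
      have e2 : 0 ≤ |lam| * (2 * (‖k‖ + 1) * B₀ + B₁) := by positivity
      have e4 : 0 ≤ 4 * (‖k‖ + 1) ^ 2 + |lam| * B₀ ^ 2 := by positivity
      linarith
    · have e1 : ‖2 * k' * (starRingEnd ℂ) (u₀ s) - Complex.I * (starRingEnd ℂ) (u₁ s)‖
          ≤ 2 * (‖k‖ + 1) * B₀ + B₁ := by
        refine (norm_sub_le _ _).trans ?_
        simp only [norm_mul, Complex.norm_I, Complex.norm_ofNat, one_mul, RCLike.norm_conj]
        gcongr
        exacts [hB₀' s hs, hB₁' s hs]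
      rw [norm_mul, Complex.norm_real, Real.norm_eq_abs]
      have e2 : |lam| * ‖2 * k' * (starRingEnd ℂ) (u₀ s) - Complex.I * (starRingEnd ℂ) (u₁ s)‖
          ≤ |lam| * (2 * (‖k‖ + 1) * B₀ + B₁) := by gcongr
      have e3 : 0 ≤ 2 * (‖k‖ + 1) * B₀ + B₁ := by positivity
      have e4 : 0 ≤ 4 * (‖k‖ + 1) ^ 2 + |lam| * B₀ ^ 2 := by positivity
      linarith
    · rw [norm_mul, norm_pow, mul_comm M]
      gcongr
      have e1 : ‖-4 * Complex.I * F₁ s k‖ ≤ 4 * BF := by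
        simp only [norm_mul, norm_neg, Complex.norm_I, Complex.norm_ofNat]
        linarith [hBF' s hs]
      have e2 : ‖4 * Complex.I * (k' + k) * P 0 s‖ ≤ 4 * (2 * ‖k‖ + 1) * BP := by
        simp only [norm_mul, Complex.norm_I, Complex.norm_ofNat, mul_one]
        have : ‖k' + k‖ ≤ 2 * ‖k‖ + 1 := (norm_add_le _ _).trans (by linarith)
        gcongr
        exact hBP' s hs
      have e3 : ‖2 * u₀ s * S 0 s‖ ≤ 2 * B₀ * BS := by
        simp only [norm_mul, Complex.norm_ofNat]
        gcongr
        exacts [hB₀' s hs, hBS' s hs]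
      have e4 : 0 ≤ 2 * |lam| * B₀ * BP := by positivity
      refine (norm_add_le _ _).trans ?_
      have := norm_sub_le (-4 * Complex.I * F₁ s k) (4 * Complex.I * (k' + k) * P 0 s)
      linarith
    · rw [norm_mul, norm_pow, mul_comm M]
      gcongr
      have e1 : ‖2 * lam * (starRingEnd ℂ) (u₀ s) * P 0 s‖ ≤ 2 * |lam| * B₀ * BP := by
        simp only [norm_mul, Complex.norm_ofNat, Complex.norm_real, Real.norm_eq_abs,
          RCLike.norm_conj]
        gcongr
        exacts [hB₀' s hs, hBP' s hs]
      have e4 : 0 ≤ 4 * BF + 4 * (2 * ‖k‖ + 1) * BP + 2 * B₀ * BS := by positivity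
      linarith
  set N : ℝ := Real.exp ((4 * K + 1) * (t - 0)) with hN
  have hN1 : 1 ≤ N := Real.one_le_exp (mul_nonneg (by positivity) (by linarith [ht.1]))
  have hsq : ∀ k', (0 + 0 + 2 * (M * ‖k' - k‖ ^ 2) ^ 2) * N ≤ (2 * M * N * ‖k' - k‖ ^ 2) ^ 2 := by
    intro k'
    have : N ≤ N ^ 2 := by nlinarith
    have h0 : 0 ≤ (M * ‖k' - k‖ ^ 2) ^ 2 := by positivity
    nlinarith [mul_nonneg h0 (sub_nonneg.2 this), mul_nonneg h0 (sq_nonneg N)]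
  refine ⟨P 0 t, S 0 t, hasDerivAt_of_quadratic_bound (C := 2 * M * N) fun k' hk' => ?_,
    hasDerivAt_of_quadratic_bound (C := 2 * M * N) fun k' hk' => ?_⟩
  · refine (abs_le_of_sq_le_sq' ?_ (by positivity)).2
    linarith [bound k' hk', hsq k', sq_nonneg ‖F₂ t k' - F₂ t k - (k' - k) * S 0 t‖]
  · refine (abs_le_of_sq_le_sq' ?_ (by positivity)).2
    linarith [bound k' hk', hsq k', sq_nonneg ‖F₁ t k' - F₁ t k - (k' - k) * P 0 t‖]

end Side

namespace SmoothData

variable {lam L T : ℝ} {q qx qxx qt qtt qxt qxtt : ℝ → ℝ → ℂ} {x₀ t₀ : ℝ}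

theorem isEigenfunction_corner (D : SmoothData lam L T q qx qxx qt qtt qxt qxtt)
    (hx₀ : x₀ ∈ Icc 0 L) (ht₀ : t₀ ∈ Icc 0 T)
    {μ : ℝ → ℝ → ℂ → Matrix (Fin 2) (Fin 2) ℂ} (hμ : IsEigenfunction lam L T q x₀ t₀ μ) (k : ℂ) :
    μ x₀ t₀ k = 1 := by
  ext i j
  exact (((D.isEigenfunction_iff hx₀ ht₀).1 hμ).2 k i j).1

/-- The first column without its phase and the conjugated second column at k̄ solve the same t-part
and agree at the corner. -/
theorem eigenfunction_symm (D : SmoothData lam L T q qx qxx qt qtt qxt qxtt)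
    (hx₀ : x₀ ∈ Icc 0 L) (ht₀ : t₀ = 0 ∨ t₀ = T)
    {μ : ℝ → ℝ → ℂ → Matrix (Fin 2) (Fin 2) ℂ} (hμ : IsEigenfunction lam L T q x₀ t₀ μ)
    {t : ℝ} (ht : t ∈ Icc 0 T) (k : ℂ) :
    μ x₀ t k = symMatrix lam (fun k => μ x₀ t k 0 1) (fun k => μ x₀ t k 1 1) k := by
  have mt := D.mem_Icc_right ht₀
  have h1 := (D.laxSol_of_isEigenfunction hx₀ mt hμ k).2.t_part
  have h2 := TSys.conj (D.laxSol_of_isEigenfunction hx₀ mt hμ ((starRingEnd ℂ) k)).1.t_part x₀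
  have h0 := D.isEigenfunction_corner hx₀ mt hμ
  obtain ⟨e1, e2⟩ := TSys.unique h1 h2 (continuousOn_slice_snd D.cont hx₀)
    (continuousOn_slice_snd D.cont_x hx₀) ht₀ (by simp [h0]) (by simp [h0]) ht
  have hne : (phase k x₀ t)⁻¹ ≠ 0 := inv_ne_zero (Complex.exp_ne_zero _)
  have e1' := mul_left_cancel₀ hne e1
  have e2' := mul_left_cancel₀ hne e2
  ext i j
  fin_cases i <;> fin_cases j <;> simp [symMatrix, bar, e1', e2']

/-- The exponential in the Wronskian of the two columns is exactly the phase that was divided out of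
the first one. -/
theorem eigenfunction_det (D : SmoothData lam L T q qx qxx qt qtt qxt qxtt)
    (hx₀ : x₀ ∈ Icc 0 L) (ht₀ : t₀ ∈ Icc 0 T)
    {μ : ℝ → ℝ → ℂ → Matrix (Fin 2) (Fin 2) ℂ} (hμ : IsEigenfunction lam L T q x₀ t₀ μ)
    {t : ℝ} (ht : t ∈ Icc 0 T) (k : ℂ) :
    μ x₀ t k 0 0 * μ x₀ t k 1 1 - μ x₀ t k 0 1 * μ x₀ t k 1 0 = 1 := by
  obtain ⟨h1, h2⟩ := D.laxSol_of_isEigenfunction hx₀ ht₀ hμ k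
  have h := TSys.wronskian h2.t_part h1.t_part ht₀ ht
  have h0 := D.isEigenfunction_corner hx₀ ht₀ hμ k
  have hne : phase k x₀ t ≠ 0 := Complex.exp_ne_zero _
  have hne0 : phase k x₀ t₀ ≠ 0 := Complex.exp_ne_zero _
  have hp : phase k x₀ t * Complex.exp (-4 * Complex.I * k ^ 2 * ((t - t₀ : ℝ) : ℂ))
      = phase k x₀ t₀ := by
    unfold phase; rw [← Complex.exp_add]; push_cast; ring_nf
  simp only [h0, Matrix.one_apply_eq, mul_one, ne_eq, zero_ne_one, not_false_eq_true,
    Matrix.one_apply_ne, zero_mul, sub_zero] at h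
  have h3 : μ x₀ t k 0 0 * μ x₀ t k 1 1 - μ x₀ t k 0 1 * μ x₀ t k 1 0
      = phase k x₀ t * ((phase k x₀ t₀)⁻¹ *
        Complex.exp (-4 * Complex.I * k ^ 2 * ((t - t₀ : ℝ) : ℂ))) := by
    rw [← h]; field_simp
  rw [h3, mul_left_comm, hp, inv_mul_cancel₀ hne0]

/-- The relation between the eigenfunctions normalized at the two ends of a vertical side. -/
theorem eigenfunction_top_bottom (D : SmoothData lam L T q qx qxx qt qtt qxt qxtt)
    (hx₀ : x₀ ∈ Icc 0 L) {μ ν : ℝ → ℝ → ℂ → Matrix (Fin 2) (Fin 2) ℂ}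
    (hμ : IsEigenfunction lam L T q x₀ T μ) (hν : IsEigenfunction lam L T q x₀ 0 ν) (k : ℂ) :
    μ x₀ 0 k 1 1 = ν x₀ T k 0 0 ∧
      μ x₀ 0 k 0 1 = -ν x₀ T k 0 1 * Complex.exp (4 * Complex.I * k ^ 2 * T) := by
  have mT : T ∈ Icc 0 T := D.mem_Icc_right (Or.inr rfl)
  have m0 : (0 : ℝ) ∈ Icc 0 T := D.mem_Icc_right (Or.inl rfl)
  have h1 := (D.laxSol_of_isEigenfunction hx₀ mT hμ k).1.t_part
  obtain ⟨h2, h3⟩ := D.laxSol_of_isEigenfunction hx₀ m0 hν k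
  -- The combination of the columns of ν that equals (0, 1) at t = T: its coefficients come from the
  -- inverse of ν(x₀,T,k), a matrix of determinant one. By uniqueness it is the second column of μ.
  have h4 := (h3.t_part.const_mul (-(phase k x₀ T * ν x₀ T k 0 1))).add
    (h2.t_part.const_mul (ν x₀ T k 0 0))
  have i1 := D.isEigenfunction_corner hx₀ mT hμ k
  have i2 := D.isEigenfunction_corner hx₀ m0 hν k
  have hdet := D.eigenfunction_det hx₀ m0 hν mT k
  have hne : phase k x₀ T ≠ 0 := Complex.exp_ne_zero _
  have hne0 : phase k x₀ 0 ≠ 0 := Complex.exp_ne_zero _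
  obtain ⟨e1, e2⟩ := TSys.unique h1 h4 (continuousOn_slice_snd D.cont hx₀)
    (continuousOn_slice_snd D.cont_x hx₀) (Or.inr rfl)
    (by simp only [i1]; simp; field_simp; ring)
    (by simp only [i1]; simp; field_simp; linear_combination -hdet) m0
  have hp : phase k x₀ T = phase k x₀ 0 * Complex.exp (4 * Complex.I * k ^ 2 * T) := by
    unfold phase; rw [← Complex.exp_add]; push_cast; ring_nf
  simp only [i2] at e1 e2
  constructor
  · simpa using e2
  · rw [e1, hp]; simp; field_simp

end SmoothData

/-! ### Compatibility of the Lax pair -/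

theorem norm_sub_le_of_deriv_bound {T C : ℝ} {f f' : ℝ → ℂ}
    (hf : ∀ t ∈ Icc 0 T, HasDerivWithinAt f (f' t) (Icc 0 T) t)
    (hC : ∀ t ∈ Icc 0 T, ‖f' t‖ ≤ C) {t t' : ℝ} (ht : t ∈ Icc 0 T) (ht' : t' ∈ Icc 0 T) :
    ‖f t' - f t‖ ≤ C * |t' - t| :=
  (convex_Icc 0 T).norm_image_sub_le_of_norm_hasDerivWithin_le hf hC ht ht'

/-- The mean value inequality applied twice; the sharp constant C/2 is not needed. -/
theorem norm_taylor_le {T C : ℝ} {f f' f'' : ℝ → ℂ}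
    (hf : ∀ t ∈ Icc 0 T, HasDerivWithinAt f (f' t) (Icc 0 T) t)
    (hf' : ∀ t ∈ Icc 0 T, HasDerivWithinAt f' (f'' t) (Icc 0 T) t)
    (hC : ∀ t ∈ Icc 0 T, ‖f'' t‖ ≤ C) {t t' : ℝ} (ht : t ∈ Icc 0 T) (ht' : t' ∈ Icc 0 T) :
    ‖f t' - f t - (t' - t) * f' t‖ ≤ C * |t' - t| ^ 2 := by
  have hC0 : 0 ≤ C := (norm_nonneg _).trans (hC t ht)
  have hsub : uIcc t t' ⊆ Icc 0 T := uIcc_subset_Icc ht ht'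
  have hd : ∀ s ∈ uIcc t t', HasDerivWithinAt (fun s : ℝ => f s - s * f' t) (f' s - f' t)
      (uIcc t t') s := by
    intro s hs
    have h1 : HasDerivWithinAt (fun s : ℝ => (s : ℂ)) 1 (uIcc t t') s :=
      Complex.ofRealCLM.hasDerivAt.hasDerivWithinAt
    exact (((hf s (hsub hs)).mono hsub).sub (h1.mul_const _)).congr_deriv (by ring)
  have hb : ∀ s ∈ uIcc t t', ‖f' s - f' t‖ ≤ C * |t' - t| := by
    intro s hs
    refine (norm_sub_le_of_deriv_bound hf' hC ht (hsub hs)).trans ?_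
    exact mul_le_mul_of_nonneg_left (abs_sub_left_of_mem_uIcc hs) hC0
  have := (convex_uIcc t t').norm_image_sub_le_of_norm_hasDerivWithin_le hd hb left_mem_uIcc
    right_mem_uIcc
  rw [Real.norm_eq_abs] at this
  calc _ = ‖f t' - t' * f' t - (f t - t * f' t)‖ := by ring_nf
    _ ≤ _ := this
    _ = _ := by ring

namespace SmoothData

variable {lam L T : ℝ} {q qx qxx qt qtt qxt qxtt : ℝ → ℝ → ℂ} {k : ℂ} {y z : ℝ → ℝ → ℂ}

theorem exists_bound {f : ℝ → ℝ → ℂ}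
    (hf : ContinuousOn (fun p : ℝ × ℝ => f p.1 p.2) (Icc 0 L ×ˢ Icc 0 T)) :
    ∃ C, 0 ≤ C ∧ ∀ x ∈ Icc 0 L, ∀ t ∈ Icc 0 T, ‖f x t‖ ≤ C := by
  obtain ⟨C, hC⟩ := (isCompact_Icc.prod isCompact_Icc).exists_bound_of_continuousOn hf
  exact ⟨max C 0, le_max_right _ _, fun x hx t ht => (hC (x, t) ⟨hx, ht⟩).trans (le_max_left _ _)⟩

/-- Compatibility of the Lax pair: the `t`-part propagates from the side `x = 0` to all `x`. -/
theorem tSys_of_laxSol (D : SmoothData lam L T q qx qxx qt qtt qxt qxtt)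
    (h : LaxSol lam L T q qx 0 k y z) {x : ℝ} (hx : x ∈ Icc 0 L) :
    TSys lam T (q x) (qx x) k (y x) (z x) := by
  have m0 : (0 : ℝ) ∈ Icc 0 L := D.mem_Icc_left (Or.inl rfl)
  suffices H : ∀ t ∈ Icc 0 T,
      HasDerivWithinAt (y x) ((-4 * Complex.I * k ^ 2 - Complex.I * lam *
        (q x t * (starRingEnd ℂ) (q x t))) * y x t + (2 * k * q x t + Complex.I * qx x t) * z x t)
        (Icc 0 T) t ∧
      HasDerivWithinAt (z x) (lam * (2 * k * (starRingEnd ℂ) (q x t)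
        - Complex.I * (starRingEnd ℂ) (qx x t)) * y x t
        + Complex.I * lam * (q x t * (starRingEnd ℂ) (q x t)) * z x t) (Icc 0 T) t from
    ⟨fun t ht => (H t ht).1, fun t ht => (H t ht).2⟩
  intro t ht
  -- R₁ and R₂ are the right-hand sides of the t-part at time t, the candidates for the
  -- t-derivatives of y and z, whose differentiability in t is not yet known for x ≠ 0.
  set R₁ : ℝ → ℂ := fun x => (-4 * Complex.I * k ^ 2 - Complex.I * lam *
        (q x t * (starRingEnd ℂ) (q x t))) * y x t + (2 * k * q x t + Complex.I * qx x t) * z x t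
    with hR₁
  set R₂ : ℝ → ℂ := fun x => lam * (2 * k * (starRingEnd ℂ) (q x t)
        - Complex.I * (starRingEnd ℂ) (qx x t)) * y x t
        + Complex.I * lam * (q x t * (starRingEnd ℂ) (q x t)) * z x t with hR₂
  -- Zero curvature: because q solves the nonlinear equation, R₁ and R₂ satisfy the x-part
  -- differentiated formally in t.
  have dR₁ : ∀ x ∈ Icc 0 L, HasDerivWithinAt R₁
      (-2 * Complex.I * k * R₁ x + q x t * R₂ x + qt x t * z x t) (Icc 0 L) x := by
    intro x hx
    have dq := D.deriv_x x hx t ht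
    have dqx := D.deriv_xx x hx t ht
    have dy := (h.x_part t ht).fst x hx
    have dz := (h.x_part t ht).snd x hx
    refine ((((dq.mul (HasDerivWithinAt.conj dq)).const_mul (Complex.I * lam)).const_sub
      (-4 * Complex.I * k ^ 2)).mul dy |>.add
      (((dq.const_mul (2 * k)).add (dqx.const_mul Complex.I)).mul dz)).congr_deriv ?_
    have hn := D.nls x hx t ht
    have hI := Complex.I_mul_I
    simp only [hR₁, hR₂, Pi.mul_apply, Pi.add_apply]
    linear_combination (Complex.I * z x t) * hn + (-qt x t * z x t + 2 * k * qx x t * z x t) * hI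
  have dR₂ : ∀ x ∈ Icc 0 L, HasDerivWithinAt R₂
      (lam * (starRingEnd ℂ) (q x t) * R₁ x + lam * (starRingEnd ℂ) (qt x t) * y x t)
      (Icc 0 L) x := by
    intro x hx
    have dq := D.deriv_x x hx t ht
    have dqx := D.deriv_xx x hx t ht
    have dy := (h.x_part t ht).fst x hx
    have dz := (h.x_part t ht).snd x hx
    refine (((((HasDerivWithinAt.conj dq).const_mul (2 * k)).sub
      ((HasDerivWithinAt.conj dqx).const_mul Complex.I)).const_mul (lam : ℂ)).mul dy |>.add
      (((dq.mul (HasDerivWithinAt.conj dq)).const_mul (Complex.I * lam)).mul dz)).congr_deriv ?_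
    have hn := congrArg (starRingEnd ℂ) (D.nls x hx t ht)
    simp only [map_add, map_mul, map_sub, Complex.conj_conj, Complex.conj_ofReal, Complex.conj_I,
      map_ofNat, map_zero] at hn
    have hI := Complex.I_mul_I
    simp only [hR₁, Pi.mul_apply, Pi.sub_apply]
    linear_combination (-Complex.I * lam * y x t) * hn +
      (-lam * (starRingEnd ℂ) (qt x t) * y x t
        + 2 * lam * k * (starRingEnd ℂ) (qx x t) * y x t) * hI
  obtain ⟨Cq, hCq, hCq'⟩ := exists_bound D.cont
  obtain ⟨Ct, hCt, hCt'⟩ := exists_bound D.cont_t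
  obtain ⟨Ctt, hCtt, hCtt'⟩ := exists_bound D.cont_tt
  obtain ⟨Cy, hCy, hCy'⟩ := exists_bound h.cont_fst
  obtain ⟨Cz, hCz, hCz'⟩ := exists_bound h.cont_snd
  obtain ⟨B₁, hB₁, hB₁'⟩ := exists_norm_le_Icc fun x hx => (dR₁ x hx).continuousWithinAt
  obtain ⟨B₂, hB₂, hB₂'⟩ := exists_norm_le_Icc fun x hx => (dR₂ x hx).continuousWithinAt
  set K : ℝ := 2 * ‖k‖ + Cq + |lam| * Cq with hK
  set M : ℝ := (Ctt * Cz + Ct * B₂) + |lam| * (Ctt * Cy + Ct * B₁) with hM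
  set E : ℝ := Real.exp ((4 * K + 1) * (x - 0)) with hE
  have hKpos : 0 ≤ K := by positivity
  have hMpos : 0 ≤ M := by positivity
  have hE1 : 1 ≤ E := Real.one_le_exp (mul_nonneg (by positivity) (by linarith [hx.1]))
  -- The remainders y(x,t') − y(x,t) − (t' − t)R₁ and their analogues for z solve the x-part at time
  -- t' with forcing O((t' − t)²). The energy estimate in x bounds them by their values at x = 0 and
  -- this forcing.
  have bound : ∀ t' ∈ Icc 0 T,
      ‖y x t' - y x t - (t' - t) * R₁ x‖ ^ 2 + ‖z x t' - z x t - (t' - t) * R₂ x‖ ^ 2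
        ≤ (‖y 0 t' - y 0 t - (t' - t) * R₁ 0‖ ^ 2 + ‖z 0 t' - z 0 t - (t' - t) * R₂ 0‖ ^ 2
          + 2 * (M * |t' - t| ^ 2) ^ 2) * E := by
    intro t' ht'
    have hh : ‖((t' : ℂ) - t)‖ = |t' - t| := by
      rw [← Complex.ofReal_sub, Complex.norm_real, Real.norm_eq_abs]
    have d1 : ∀ s ∈ Icc 0 L, ‖q s t' - q s t‖ ≤ Ct * |t' - t| := fun s hs =>
      norm_sub_le_of_deriv_bound (D.deriv_t s hs) (hCt' s hs) ht ht'
    have d2 : ∀ s ∈ Icc 0 L, ‖q s t' - q s t - (t' - t) * qt s t‖ ≤ Ctt * |t' - t| ^ 2 :=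
      fun s hs => norm_taylor_le (D.deriv_t s hs) (D.deriv_tt s hs) (hCtt' s hs) ht ht'
    have d3 : ∀ s ∈ Icc 0 L, ∀ (w R : ℂ) (W B : ℝ), ‖w‖ ≤ W → ‖R‖ ≤ B →
        ‖q s t' - q s t - (t' - t) * qt s t‖ * ‖w‖ + |t' - t| * ‖q s t' - q s t‖ * ‖R‖
          ≤ (Ctt * W + Ct * B) * |t' - t| ^ 2 := by
      intro s hs w R W B hw hR
      have e1 : ‖q s t' - q s t - (t' - t) * qt s t‖ * ‖w‖ ≤ Ctt * |t' - t| ^ 2 * W :=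
        mul_le_mul (d2 s hs) hw (norm_nonneg _) (by positivity)
      have e2 : |t' - t| * ‖q s t' - q s t‖ * ‖R‖ ≤ |t' - t| * (Ct * |t' - t|) * B := by
        have := d1 s hs
        gcongr
      nlinarith
    refine energy_estimate (K := K) (ε := M * |t' - t| ^ 2) (a := 0) (b := L)
      (y := fun x => y x t' - y x t - (t' - t) * R₁ x)
      (z := fun x => z x t' - z x t - (t' - t) * R₂ x)
      (α := fun _ => -2 * Complex.I * k) (β := fun x => q x t')
      (γ := fun x => lam * (starRingEnd ℂ) (q x t')) (δ := fun _ => 0)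
      (r := fun x => (q x t' - q x t - (t' - t) * qt x t) * z x t
        + (t' - t) * (q x t' - q x t) * R₂ x)
      (s := fun x => lam * ((starRingEnd ℂ) (q x t' - q x t - (t' - t) * qt x t) * y x t
        + (t' - t) * (starRingEnd ℂ) (q x t' - q x t) * R₁ x)) hKpos
      (fun s hs => (((((h.x_part t' ht').fst s hs).sub ((h.x_part t ht).fst s hs)).sub
        ((dR₁ s hs).const_mul ((t' : ℂ) - t))).congr_deriv (by ring)))
      (fun s hs => (((((h.x_part t' ht').snd s hs).sub ((h.x_part t ht).snd s hs)).sub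
        ((dR₂ s hs).const_mul ((t' : ℂ) - t))).congr_deriv ?_))
      (fun s hs => ?_) (fun s hs => ?_) (fun s hs => ?_) (fun s hs => ?_) (fun s hs => ?_)
      (fun s hs => ?_) hx
    · simp only [map_sub, map_mul, Complex.conj_ofReal]; ring
    · refine (Complex.re_le_norm _).trans ?_
      simp only [norm_mul, norm_neg, Complex.norm_I, Complex.norm_ofNat, mul_one]
      have : 0 ≤ |lam| * Cq := by positivity
      linarith
    · simpa using hKpos
    · have : 0 ≤ |lam| * Cq := by positivity
      linarith [hCq' s hs t' ht', norm_nonneg k]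
    · rw [norm_mul, Complex.norm_real, Real.norm_eq_abs, RCLike.norm_conj]
      have : |lam| * ‖q s t'‖ ≤ |lam| * Cq := by
        gcongr
        exact hCq' s hs t' ht'
      linarith [norm_nonneg k]
    · refine (norm_add_le _ _).trans ?_
      rw [norm_mul, norm_mul, norm_mul, hh]
      refine (d3 s hs _ _ Cz B₂ (hCz' s hs t ht) (hB₂' s hs)).trans ?_
      gcongr
      have : 0 ≤ |lam| * (Ctt * Cy + Ct * B₁) := by positivity
      linarith
    · rw [norm_mul, Complex.norm_real, Real.norm_eq_abs]
      have := (norm_add_le ((starRingEnd ℂ) (q s t' - q s t - (t' - t) * qt s t) * y s t)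
        ((t' - t) * (starRingEnd ℂ) (q s t' - q s t) * R₁ s))
      rw [norm_mul, norm_mul, norm_mul, hh, RCLike.norm_conj, RCLike.norm_conj] at this
      have h2 := this.trans (d3 s hs _ _ Cy B₁ (hCy' s hs t ht) (hB₁' s hs))
      calc _ ≤ |lam| * ((Ctt * Cy + Ct * B₁) * |t' - t| ^ 2) := by gcongr
        _ = (|lam| * (Ctt * Cy + Ct * B₁)) * |t' - t| ^ 2 := by ring
        _ ≤ _ := by
          gcongr
          have : 0 ≤ Ctt * Cz + Ct * B₂ := by positivity
          linarith
  have key : ∀ a b c e : ℝ, 0 ≤ a → 0 ≤ b → 0 ≤ c → 0 ≤ e →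
      e ^ 2 ≤ (a ^ 2 + b ^ 2 + 2 * c ^ 2) * E → e ≤ E * (a + b + 2 * c) := by
    intro a b c e ha hb hc he h
    refine (abs_le_of_sq_le_sq' (h.trans ?_) (by positivity)).2
    have h1 : a ^ 2 + b ^ 2 + 2 * c ^ 2 ≤ (a + b + 2 * c) ^ 2 := by
      have p1 := mul_nonneg ha hb
      have p2 := mul_nonneg ha hc
      have p3 := mul_nonneg hb hc
      nlinarith
    have h2 : E ≤ E ^ 2 := by nlinarith
    calc _ ≤ (a + b + 2 * c) ^ 2 * E ^ 2 := by gcongr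
      _ = _ := by ring
  -- On x = 0 the t-part holds, so there the remainders are o(t' − t); by `bound` this spreads to x.
  have o1 := hasDerivWithinAt_iff_isLittleO.1 (h.t_part.fst t ht)
  have o2 := hasDerivWithinAt_iff_isLittleO.1 (h.t_part.snd t ht)
  simp only [Complex.real_smul, Complex.ofReal_sub] at o1 o2
  have o3 : (fun t' : ℝ => |t' - t| ^ 2) =o[𝓝[Icc 0 T] t] fun t' => t' - t := by
    have : Tendsto (fun t' : ℝ => t' - t) (𝓝[Icc 0 T] t) (𝓝 0) := by
      have : Continuous fun t' : ℝ => t' - t := by fun_prop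
      simpa using (this.tendsto t).mono_left nhdsWithin_le_nhds
    exact (Asymptotics.isLittleO_norm_pow_id one_lt_two).comp_tendsto this
  have o4 : (fun t' : ℝ => E * (‖y 0 t' - y 0 t - (t' - t) * R₁ 0‖
      + ‖z 0 t' - z 0 t - (t' - t) * R₂ 0‖ + 2 * (M * |t' - t| ^ 2))) =o[𝓝[Icc 0 T] t]
      fun t' => t' - t :=
    ((o1.norm_left.add o2.norm_left).add ((o3.const_mul_left M).const_mul_left 2)).const_mul_left E
  constructor
  · rw [hasDerivWithinAt_iff_isLittleO]
    refine (Asymptotics.IsBigO.of_bound 1 ?_).trans_isLittleO o4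
    filter_upwards [self_mem_nhdsWithin] with t' ht'
    rw [Complex.real_smul, Complex.ofReal_sub, one_mul]
    refine (key _ _ _ _ (norm_nonneg _) (norm_nonneg _) (by positivity) (norm_nonneg _)
      (le_trans (le_add_of_nonneg_right (sq_nonneg _)) (bound t' ht'))).trans (Real.le_norm_self _)
  · rw [hasDerivWithinAt_iff_isLittleO]
    refine (Asymptotics.IsBigO.of_bound 1 ?_).trans_isLittleO o4
    filter_upwards [self_mem_nhdsWithin] with t' ht'
    rw [Complex.real_smul, Complex.ofReal_sub, one_mul]
    refine (key _ _ _ _ (norm_nonneg _) (norm_nonneg _) (by positivity) (norm_nonneg _)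
      (le_trans (le_add_of_nonneg_left (sq_nonneg _)) (bound t' ht'))).trans (Real.le_norm_self _)

end SmoothData

/-! ### Large-k asymptotics on a vertical side -/

/-- `G t κ` is bounded for `0 ≤ t ≤ T`, `|κ| ≤ 1`. -/
def BoundedSymbol (T : ℝ) (G : ℝ → ℂ → ℂ) : Prop :=
  ∃ C, 0 ≤ C ∧ ∀ t ∈ Icc 0 T, ∀ κ : ℂ, ‖κ‖ ≤ 1 → ‖G t κ‖ ≤ C

namespace BoundedSymbol

variable {T : ℝ} {G H : ℝ → ℂ → ℂ}

theorem const (c : ℂ) : BoundedSymbol T fun _ _ => c :=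
  ⟨‖c‖, norm_nonneg _, fun _ _ _ _ => le_rfl⟩

theorem id : BoundedSymbol T fun _ κ => κ :=
  ⟨1, zero_le_one, fun _ _ _ h => h⟩

theorem of_continuousOn {f : ℝ → ℂ} (hf : ContinuousOn f (Icc 0 T)) :
    BoundedSymbol T fun t _ => f t := by
  obtain ⟨C, h0, hC⟩ := exists_norm_le_Icc hf
  exact ⟨C, h0, fun t ht _ _ => hC t ht⟩

theorem add (hG : BoundedSymbol T G) (hH : BoundedSymbol T H) :
    BoundedSymbol T fun t κ => G t κ + H t κ := by
  obtain ⟨C, h0, hC⟩ := hG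
  obtain ⟨D, h1, hD⟩ := hH
  exact ⟨C + D, by positivity, fun t ht κ hκ =>
    (norm_add_le _ _).trans (add_le_add (hC t ht κ hκ) (hD t ht κ hκ))⟩

theorem neg (hG : BoundedSymbol T G) : BoundedSymbol T fun t κ => -G t κ := by
  obtain ⟨C, h0, hC⟩ := hG
  exact ⟨C, h0, fun t ht κ hκ => by rw [norm_neg]; exact hC t ht κ hκ⟩

theorem sub (hG : BoundedSymbol T G) (hH : BoundedSymbol T H) :
    BoundedSymbol T fun t κ => G t κ - H t κ := by
  simpa only [sub_eq_add_neg] using hG.add hH.neg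

theorem mul (hG : BoundedSymbol T G) (hH : BoundedSymbol T H) :
    BoundedSymbol T fun t κ => G t κ * H t κ := by
  obtain ⟨C, h0, hC⟩ := hG
  obtain ⟨D, h1, hD⟩ := hH
  exact ⟨C * D, by positivity, fun t ht κ hκ => by
    rw [norm_mul]
    exact mul_le_mul (hC t ht κ hκ) (hD t ht κ hκ) (norm_nonneg _) h0⟩

theorem pow (hG : BoundedSymbol T G) (n : ℕ) : BoundedSymbol T fun t κ => G t κ ^ n := by
  obtain ⟨C, h0, hC⟩ := hG
  exact ⟨C ^ n, by positivity, fun t ht κ hκ => by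
    rw [norm_pow]
    exact pow_le_pow_left₀ (norm_nonneg _) (hC t ht κ hκ) n⟩

end BoundedSymbol

/-- A scalar equation `y' = α y + r` with `y(0) = 0` and `Re α` bounded above. -/
theorem norm_le_of_forced {T K ε : ℝ} {α r y : ℝ → ℂ} (hK : 0 ≤ K) (h0 : y 0 = 0)
    (hy : ∀ t ∈ Icc 0 T, HasDerivWithinAt y (α t * y t + r t) (Icc 0 T) t)
    (hα : ∀ t ∈ Icc 0 T, (α t).re ≤ K) (hr : ∀ t ∈ Icc 0 T, ‖r t‖ ≤ ε) {t : ℝ}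
    (ht : t ∈ Icc 0 T) : ‖y t‖ ≤ 2 * ε * Real.exp ((4 * K + 1) * T) := by
  have hε : 0 ≤ ε := (norm_nonneg _).trans (hr t ht)
  have h := energy_estimate (K := K) (ε := ε) (a := 0) (b := T) (y := y) (z := fun _ => 0)
    (α := α) (β := fun _ => 0) (γ := fun _ => 0) (δ := fun _ => 0) (r := r) (s := fun _ => 0) hK
    (fun s hs => (hy s hs).congr_deriv (by ring))
    (fun s _ => (hasDerivWithinAt_const s _ (0 : ℂ)).congr_deriv (by ring)) hα (by simpa using
      fun _ _ _ => hK) (by simpa using fun _ _ _ => hK) (by simpa using fun _ _ _ => hK) hr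
    (by simpa using fun _ _ _ => hε) ht
  simp only [h0, norm_zero] at h
  have h1 : Real.exp ((4 * K + 1) * (t - 0)) ≤ Real.exp ((4 * K + 1) * T) := by
    have := ht.2
    gcongr
    linarith
  set N := Real.exp ((4 * K + 1) * T)
  have hN : 1 ≤ N := Real.one_le_exp (mul_nonneg (by positivity) (ht.1.trans ht.2))
  refine (abs_le_of_sq_le_sq' ?_ (by positivity)).2
  have h2 : N ≤ N ^ 2 := by nlinarith
  calc ‖y t‖ ^ 2 ≤ 2 * ε ^ 2 * Real.exp ((4 * K + 1) * (t - 0)) := by linarith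
    _ ≤ 2 * ε ^ 2 * N ^ 2 := by gcongr; exact h1.trans h2
    _ ≤ (2 * ε * N) ^ 2 := by nlinarith [mul_nonneg (sq_nonneg ε) (sq_nonneg N)]

/-- Estimates for a system that is triangular up to small terms. -/
theorem exists_triangular_estimate {T K : ℝ} (hT : 0 ≤ T) (hK : 0 ≤ K) :
    ∃ D, 0 ≤ D ∧ ∀ (k κ : ℂ) (w v A P Γ B E b : ℝ → ℂ), ‖κ‖ ≤ 1 → (k ^ 2).im ≤ 0 →
      (∀ t ∈ Icc 0 T, ‖A t‖ ≤ K) → (∀ t ∈ Icc 0 T, ‖P t‖ ≤ K) → (∀ t ∈ Icc 0 T, ‖Γ t‖ ≤ K) →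
      (∀ t ∈ Icc 0 T, ‖B t‖ ≤ K) → (∀ t ∈ Icc 0 T, ‖E t‖ ≤ K) →
      (∀ t ∈ Icc 0 T, HasDerivWithinAt w
        ((-4 * Complex.I * k ^ 2 + A t) * w t + κ ^ 3 * P t * v t) (Icc 0 T) t) →
      (∀ t ∈ Icc 0 T, HasDerivWithinAt v (Γ t * w t + κ * (B t + κ * E t) * v t) (Icc 0 T) t) →
      (∀ t ∈ Icc 0 T, HasDerivWithinAt b (B t) (Icc 0 T) t) →
      w 0 = 0 → v 0 = 1 → b 0 = 0 → ∀ t ∈ Icc 0 T,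
        ‖w t‖ ≤ D * ‖κ‖ ^ 3 ∧ ‖v t‖ ≤ D ∧ ‖v t - 1‖ ≤ D * ‖κ‖ ∧
          ‖v t - 1 - κ * b t‖ ≤ D * ‖κ‖ ^ 2 := by
  obtain ⟨N, hN⟩ : ∃ N, N = Real.exp ((4 * (2 * K) + 1) * T) := ⟨_, rfl⟩
  have hN1 : 1 ≤ N := hN ▸ Real.one_le_exp (mul_nonneg (by positivity) hT)
  -- A bootstrap: the energy estimate bounds v by N. Then D₁ controls w through its forcing κ³Pv, D₂
  -- controls v − 1, and D₃ controls v − 1 − κb.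
  obtain ⟨D₁, hD₁⟩ : ∃ D, D = 2 * (K * N) * N := ⟨_, rfl⟩
  obtain ⟨D₂, hD₂⟩ : ∃ D, D = 2 * (K * D₁ + 2 * K * N) * N := ⟨_, rfl⟩
  obtain ⟨D₃, hD₃⟩ : ∃ D, D = 2 * (K * D₁ + K * D₂ + K * N) * N := ⟨_, rfl⟩
  have hD₁0 : 0 ≤ D₁ := by rw [hD₁]; positivity
  have hD₂0 : 0 ≤ D₂ := by rw [hD₂]; positivity
  have hD₃0 : 0 ≤ D₃ := by rw [hD₃]; positivity
  refine ⟨N + D₁ + D₂ + D₃, by positivity, ?_⟩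
  intro k κ w v A P Γ B E b hκ hk hA hP hΓ hB hE dw dv db w0 v0 b0
  have hκ0 := norm_nonneg κ
  have hκ2 : ‖κ‖ ^ 2 ≤ ‖κ‖ := by nlinarith
  have hκ3 : ‖κ‖ ^ 3 ≤ ‖κ‖ ^ 2 := by nlinarith [sq_nonneg ‖κ‖]
  -- The real part of −4ik² is 4 Im k² ≤ 0. This is where the restriction to the closed second and
  -- fourth quadrants enters: the large coefficient can only damp w.
  have hre : ∀ t ∈ Icc 0 T, (-4 * Complex.I * k ^ 2 + A t).re ≤ 2 * K := by
    intro t ht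
    have h1 := (Complex.re_le_norm (A t)).trans (hA t ht)
    have h2 : (-4 * Complex.I * k ^ 2).re = 4 * (k ^ 2).im := by
      rw [mul_assoc, ← Complex.re_add_im (k ^ 2)]
      simp
    rw [Complex.add_re, h2]
    linarith
  have hη : ∀ t ∈ Icc 0 T, ‖κ * (B t + κ * E t)‖ ≤ ‖κ‖ * (2 * K) := by
    intro t ht
    rw [norm_mul]
    have h1 := norm_add_le (B t) (κ * E t)
    have h2 : ‖κ * E t‖ ≤ 1 * K := by
      rw [norm_mul]; exact mul_le_mul hκ (hE t ht) (norm_nonneg _) zero_le_one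
    gcongr
    linarith [hB t ht]
  have hP' : ∀ t ∈ Icc 0 T, ‖κ ^ 3 * P t‖ ≤ ‖κ‖ ^ 3 * K := by
    intro t ht
    rw [norm_mul, norm_pow]
    have := hP t ht
    gcongr
  have hv : ∀ t ∈ Icc 0 T, ‖v t‖ ≤ N := by
    intro t ht
    have h := energy_estimate (K := 2 * K) (ε := 0) (a := 0) (b := T) (y := w) (z := v)
      (α := fun t => -4 * Complex.I * k ^ 2 + A t) (β := fun t => κ ^ 3 * P t) (γ := Γ)
      (δ := fun t => κ * (B t + κ * E t)) (r := fun _ => 0) (s := fun _ => 0) (by positivity)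
      (fun s hs => (dw s hs).congr_deriv (by ring)) (fun s hs => (dv s hs).congr_deriv (by ring))
      hre
      (fun s hs => (Complex.re_le_norm _).trans ((hη s hs).trans (by nlinarith)))
      (fun s hs => (hP' s hs).trans (by nlinarith)) (fun s hs => (hΓ s hs).trans (by linarith))
      (by simp) (by simp) ht
    rw [w0, v0, norm_zero, norm_one] at h
    have h1 : Real.exp ((4 * (2 * K) + 1) * (t - 0)) ≤ N := by
      rw [hN]
      have := ht.2
      gcongr
      linarith
    refine (abs_le_of_sq_le_sq' ?_ (by positivity)).2
    nlinarith [sq_nonneg ‖w t‖]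
  have hw : ∀ t ∈ Icc 0 T, ‖w t‖ ≤ D₁ * ‖κ‖ ^ 3 := by
    intro t ht
    have h := norm_le_of_forced (K := 2 * K) (ε := ‖κ‖ ^ 3 * K * N) (by positivity) w0 dw hre
      (fun s hs => by
        rw [norm_mul]
        exact mul_le_mul (hP' s hs) (hv s hs) (norm_nonneg _) (by positivity)) ht
    rw [← hN] at h
    refine h.trans (le_of_eq ?_)
    rw [hD₁]; ring
  have hΓw : ∀ t ∈ Icc 0 T, ‖Γ t * w t‖ ≤ K * (D₁ * ‖κ‖ ^ 3) := by
    intro t ht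
    rw [norm_mul]
    exact mul_le_mul (hΓ t ht) (hw t ht) (norm_nonneg _) hK
  have integrate : ∀ (f r : ℝ → ℂ) (ε : ℝ), f 0 = 0 →
      (∀ t ∈ Icc 0 T, HasDerivWithinAt f (r t) (Icc 0 T) t) → (∀ t ∈ Icc 0 T, ‖r t‖ ≤ ε) →
      ∀ t ∈ Icc 0 T, ‖f t‖ ≤ 2 * ε * N := by
    intro f r ε f0 hf hr t ht
    have h := norm_le_of_forced (K := 2 * K) (α := fun _ => 0) (by positivity) f0
      (fun s hs => (hf s hs).congr_deriv (by ring)) (by simpa using fun _ _ _ => hK) hr ht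
    rwa [← hN] at h
  have hv1 : ∀ t ∈ Icc 0 T, ‖v t - 1‖ ≤ D₂ * ‖κ‖ := by
    intro t ht
    have h := integrate (fun t => v t - 1) _ ((K * D₁ + 2 * K * N) * ‖κ‖) (by simp [v0])
      (fun s hs => (dv s hs).sub_const 1) (fun s hs => by
        refine (norm_add_le _ _).trans ?_
        rw [norm_mul _ (v s)]
        have h1 := hΓw s hs
        have h2 := mul_le_mul (hη s hs) (hv s hs) (norm_nonneg _) (by positivity)
        have h3 : K * (D₁ * ‖κ‖ ^ 3) ≤ K * (D₁ * ‖κ‖) := by gcongr; exact hκ3.trans hκ2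
        linarith) t ht
    refine h.trans (le_of_eq ?_)
    rw [hD₂]; ring
  have hv2 : ∀ t ∈ Icc 0 T, ‖v t - 1 - κ * b t‖ ≤ D₃ * ‖κ‖ ^ 2 := by
    intro t ht
    have h := integrate (fun t => v t - 1 - κ * b t)
      (fun t => Γ t * w t + κ * (B t * (v t - 1)) + κ ^ 2 * (E t * v t))
      ((K * D₁ + K * D₂ + K * N) * ‖κ‖ ^ 2) (by simp [v0, b0])
      (fun s hs => (((dv s hs).sub_const 1).sub ((db s hs).const_mul κ)).congr_deriv (by ring))
      (fun s hs => by
        refine (norm_add₃_le).trans ?_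
        rw [norm_mul κ, norm_mul (B s), norm_mul (κ ^ 2), norm_mul (E s), norm_pow]
        have h1 := hΓw s hs
        have h2 : ‖κ‖ * (‖B s‖ * ‖v s - 1‖) ≤ ‖κ‖ * (K * (D₂ * ‖κ‖)) := by
          gcongr
          exacts [hB s hs, hv1 s hs]
        have h3 : ‖κ‖ ^ 2 * (‖E s‖ * ‖v s‖) ≤ ‖κ‖ ^ 2 * (K * N) := by
          gcongr
          exacts [hE s hs, hv s hs]
        have h4 : K * (D₁ * ‖κ‖ ^ 3) ≤ K * (D₁ * ‖κ‖ ^ 2) := by gcongr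
        nlinarith) t ht
    refine h.trans (le_of_eq ?_)
    rw [hD₃]; ring
  intro t ht
  refine ⟨(hw t ht).trans ?_, (hv t ht).trans ?_, (hv1 t ht).trans ?_, (hv2 t ht).trans ?_⟩
  · gcongr; linarith
  · linarith
  · gcongr; linarith
  · gcongr; linarith

/-- The residual of an approximate solution of the Riccati equation. -/
noncomputable def riccatiResidual (lam u c₀ c₁ ρ₁ ρ₂ ρ₃ ρ₄ d₃ d₄ κ : ℂ) : ℂ :=
  -2 * Complex.I * lam * (u * c₀) * (ρ₃ + κ * ρ₄) - (d₃ + κ * d₄)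
    - 2 * lam * c₀ * (2 * ρ₁ * (ρ₃ + κ * ρ₄) + (ρ₂ + κ * ρ₃ + κ ^ 2 * ρ₄) ^ 2)
    + Complex.I * lam * c₁ * (2 * ρ₁ * (ρ₂ + κ * ρ₃ + κ ^ 2 * ρ₄)
      + κ * (ρ₂ + κ * ρ₃ + κ ^ 2 * ρ₄) ^ 2)

/-- The ratio F₁/F₂ satisfies a Riccati equation. The hypotheses `e₁` to `e₄` say that the
coefficients of k, 1, κ and κ² vanish when the expansion is inserted, so the residual starts at κ³.
-/
theorem riccati_identity {lam u u₁ c₀ c₁ ρ₁ ρ₂ ρ₃ ρ₄ d₁ d₂ d₃ d₄ k κ : ℂ} (hk : k * κ = 1)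
    (e₁ : u = 2 * Complex.I * ρ₁) (e₂ : u₁ = 4 * ρ₂)
    (e₃ : -4 * Complex.I * ρ₃ - 2 * Complex.I * lam * (u * c₀) * ρ₁ - d₁
      - 2 * lam * c₀ * ρ₁ ^ 2 = 0)
    (e₄ : -4 * Complex.I * ρ₄ - 2 * Complex.I * lam * (u * c₀) * ρ₂ - d₂
      - 4 * lam * c₀ * ρ₁ * ρ₂ + Complex.I * lam * c₁ * ρ₁ ^ 2 = 0) {ρ : ℂ}
    (hρ : ρ = κ * ρ₁ + κ ^ 2 * ρ₂ + κ ^ 3 * ρ₃ + κ ^ 4 * ρ₄) :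
    (-4 * Complex.I * k ^ 2 - Complex.I * lam * (u * c₀)) * ρ + (2 * k * u + Complex.I * u₁)
      - (κ * d₁ + κ ^ 2 * d₂ + κ ^ 3 * d₃ + κ ^ 4 * d₄)
      - lam * (2 * k * c₀ - Complex.I * c₁) * ρ ^ 2 - Complex.I * lam * (u * c₀) * ρ
      = κ ^ 3 * riccatiResidual lam u c₀ c₁ ρ₁ ρ₂ ρ₃ ρ₄ d₃ d₄ κ := by
  obtain ⟨m, hm⟩ : ∃ m, m = ρ₂ + κ * ρ₃ + κ ^ 2 * ρ₄ := ⟨_, rfl⟩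
  obtain ⟨r, hr⟩ : ∃ r, r = ρ₁ + κ * m := ⟨_, rfl⟩
  have hρ' : ρ = κ * r := by rw [hρ, hr, hm]; ring
  have h : (-4 * Complex.I * k ^ 2 - Complex.I * lam * (u * c₀)) * (κ * r)
      + (2 * k * u + Complex.I * u₁) - (κ * d₁ + κ ^ 2 * d₂ + κ ^ 3 * d₃ + κ ^ 4 * d₄)
      - lam * (2 * k * c₀ - Complex.I * c₁) * (κ * r) ^ 2 - Complex.I * lam * (u * c₀) * (κ * r)
      = -4 * Complex.I * k * r + 2 * k * u + Complex.I * u₁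
        - 2 * Complex.I * lam * (u * c₀) * κ * r
        - (κ * d₁ + κ ^ 2 * d₂ + κ ^ 3 * d₃ + κ ^ 4 * d₄)
        - 2 * lam * c₀ * κ * r ^ 2 + Complex.I * lam * c₁ * κ ^ 2 * r ^ 2 := by
    linear_combination (-4 * Complex.I * k * r - 2 * lam * c₀ * κ * r ^ 2) * hk
  have h2 : -4 * Complex.I * k * r = -4 * Complex.I * k * ρ₁ - 4 * Complex.I * m := by
    rw [hr]; linear_combination (-4 * Complex.I * m) * hk
  rw [hρ', h, h2, riccatiResidual, ← hm, hr]
  generalize Complex.I = I at *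
  linear_combination (2 * k) * e₁ + I * e₂ + κ * e₃ + κ ^ 2 * e₄ - 4 * I * hm
    + (κ ^ 2 * (-2 * I * lam * (u * c₀) - 4 * lam * c₀ * ρ₁) + κ ^ 3 * 0) * hm

/-- The equation for w = F₁ − ρF₂: only the Riccati residual multiplies F₂. Then F₂ is written as v
− σw with v = F₂ + σw, and the extra term goes into the coefficient of w. -/
theorem wkb_fst_identity {lam u u₁ c₀ c₁ δ k κ ρ dρ P σ F₁ F₂ : ℂ}
    (hR : (-4 * Complex.I * k ^ 2 - Complex.I * lam * (u * c₀)) * ρ + (2 * k * u + Complex.I * u₁)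
      - dρ - lam * (2 * k * c₀ - Complex.I * c₁) * ρ ^ 2 - δ * ρ = κ ^ 3 * P) :
    (-4 * Complex.I * k ^ 2 - Complex.I * lam * (u * c₀)) * F₁
        + (2 * k * u + Complex.I * u₁) * F₂
        - (dρ * F₂ + ρ * (lam * (2 * k * c₀ - Complex.I * c₁) * F₁ + δ * F₂))
      = (-4 * Complex.I * k ^ 2 + (-Complex.I * lam * (u * c₀)
          - lam * (2 * k * c₀ - Complex.I * c₁) * ρ - κ ^ 3 * P * σ)) * (F₁ - ρ * F₂)
        + κ ^ 3 * P * (F₂ + σ * (F₁ - ρ * F₂)) := by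
  linear_combination F₂ * hR

/-- The equation for F₂ contains 2kλc₀w, which is too large. With σ = −(i/2)κλc₀ the term σ(−4ik²)w
cancels it, so v = F₂ + σw has a bounded coefficient at w. The coefficient at v starts only at order
κ, because 2c₀ρ₁ + iuc₀ = 0 by `e₁`. -/
theorem wkb_snd_identity {lam u c₀ c₁ dc k κ m n ρ₁ ρ₂ P w v F₁ F₂ : ℂ} (hk : k * κ = 1)
    (e₁ : u = 2 * Complex.I * ρ₁) (hm : m = ρ₂ + κ * n)
    (hw : w = F₁ - κ * (ρ₁ + κ * m) * F₂)
    (hv : v = F₂ + -Complex.I / 2 * κ * lam * c₀ * w) {G σ : ℂ}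
    (hG : G = lam * (2 * c₀ - Complex.I * c₁ * κ) * (ρ₁ + κ * m))
    (hσ : σ = -Complex.I / 2 * κ * lam * c₀) :
    lam * (2 * k * c₀ - Complex.I * c₁) * F₁ + Complex.I * lam * (u * c₀) * F₂
        + (-Complex.I / 2 * κ * lam * dc * w + σ *
          ((-4 * Complex.I * k ^ 2 + (-Complex.I * lam * (u * c₀) - G - κ ^ 3 * P * σ)) * w
            + κ ^ 3 * P * v))
      = (-Complex.I * lam * c₁ + -Complex.I / 2 * κ * lam * dc
          - 2 * Complex.I * lam * (u * c₀) * σ - 2 * σ * G - σ ^ 2 * (κ ^ 3 * P)) * w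
        + κ * (lam * (2 * c₀ * ρ₂ - Complex.I * c₁ * ρ₁)
          + κ * (lam * (2 * c₀ * n - Complex.I * c₁ * m)
            + -Complex.I / 2 * lam * c₀ * (κ ^ 2 * P))) * v := by
  have hI := Complex.I_mul_I
  have hF₁ : F₁ = w + κ * (ρ₁ + κ * m) * (v - σ * w) := by rw [hv, hw, hσ]; ring
  have hF₂ : F₂ = v - σ * w := by rw [hv, hσ]; ring
  have h1 : lam * (2 * k * c₀ - Complex.I * c₁) * (κ * (ρ₁ + κ * m)) = G := by
    rw [hG]; linear_combination 2 * lam * c₀ * (ρ₁ + κ * m) * hk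
  have h2 : σ * (-4 * Complex.I * k ^ 2) = -2 * k * lam * c₀ := by
    rw [hσ]
    linear_combination (2 * Complex.I * Complex.I * lam * c₀ * k) * hk + (2 * k * lam * c₀) * hI
  have h3 : G + Complex.I * lam * (u * c₀) + σ * κ ^ 3 * P
      = κ * (lam * (2 * c₀ * ρ₂ - Complex.I * c₁ * ρ₁)
          + κ * (lam * (2 * c₀ * n - Complex.I * c₁ * m)
            + -Complex.I / 2 * lam * c₀ * (κ ^ 2 * P))) := by
    rw [hG, hσ, e₁, hm]
    linear_combination (2 * lam * ρ₁ * c₀) * hI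
  rw [← h3, hF₁, hF₂]
  linear_combination (v - σ * w) * h1 + w * h2

/-- Large-`k` asymptotics of the solution of the `t`-part in the closed second and fourth quadrants,
in terms of an approximate solution `κ ρ₁ + ⋯ + κ⁴ ρ₄`, `κ = k⁻¹`, of the associated Riccati
equation. -/
theorem TSys.asymptotics {lam T : ℝ} (hT : 0 ≤ T)
    {u₀ u₁ du₀ ρ₁ ρ₂ ρ₃ ρ₄ d₁ d₂ d₃ d₄ b : ℝ → ℂ} {F₁ F₂ : ℝ → ℂ → ℂ}
    (hF : ∀ k, TSys lam T u₀ u₁ k (fun t => F₁ t k) (fun t => F₂ t k))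
    (hF₁ : ∀ k, F₁ 0 k = 0) (hF₂ : ∀ k, F₂ 0 k = 1)
    (cu₀ : ContinuousOn u₀ (Icc 0 T)) (cu₁ : ContinuousOn u₁ (Icc 0 T))
    (cdu₀ : ContinuousOn du₀ (Icc 0 T)) (cd₃ : ContinuousOn d₃ (Icc 0 T))
    (cd₄ : ContinuousOn d₄ (Icc 0 T))
    (hu₀ : ∀ t ∈ Icc 0 T, HasDerivWithinAt u₀ (du₀ t) (Icc 0 T) t)
    (hd₁ : ∀ t ∈ Icc 0 T, HasDerivWithinAt ρ₁ (d₁ t) (Icc 0 T) t)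
    (hd₂ : ∀ t ∈ Icc 0 T, HasDerivWithinAt ρ₂ (d₂ t) (Icc 0 T) t)
    (hd₃ : ∀ t ∈ Icc 0 T, HasDerivWithinAt ρ₃ (d₃ t) (Icc 0 T) t)
    (hd₄ : ∀ t ∈ Icc 0 T, HasDerivWithinAt ρ₄ (d₄ t) (Icc 0 T) t)
    (hb : ∀ t ∈ Icc 0 T, HasDerivWithinAt b (lam * (2 * (starRingEnd ℂ) (u₀ t) * ρ₂ t
      - Complex.I * (starRingEnd ℂ) (u₁ t) * ρ₁ t)) (Icc 0 T) t)
    (z₁ : ρ₁ 0 = 0) (z₂ : ρ₂ 0 = 0) (z₃ : ρ₃ 0 = 0) (z₄ : ρ₄ 0 = 0) (zb : b 0 = 0)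
    (zu : u₀ 0 = 0)
    (e₁ : ∀ t ∈ Icc 0 T, u₀ t = 2 * Complex.I * ρ₁ t) (e₂ : ∀ t ∈ Icc 0 T, u₁ t = 4 * ρ₂ t)
    (e₃ : ∀ t ∈ Icc 0 T, -4 * Complex.I * ρ₃ t
      - 2 * Complex.I * lam * (u₀ t * (starRingEnd ℂ) (u₀ t)) * ρ₁ t - d₁ t
      - 2 * lam * (starRingEnd ℂ) (u₀ t) * ρ₁ t ^ 2 = 0)
    (e₄ : ∀ t ∈ Icc 0 T, -4 * Complex.I * ρ₄ t
      - 2 * Complex.I * lam * (u₀ t * (starRingEnd ℂ) (u₀ t)) * ρ₂ t - d₂ t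
      - 4 * lam * (starRingEnd ℂ) (u₀ t) * ρ₁ t * ρ₂ t
      + Complex.I * lam * (starRingEnd ℂ) (u₁ t) * ρ₁ t ^ 2 = 0) :
    ∃ C, 0 ≤ C ∧ ∀ k : ℂ, 1 ≤ ‖k‖ → (k ^ 2).im ≤ 0 → ∀ t ∈ Icc 0 T,
      ‖F₁ t k - ρ₁ t * k⁻¹ - (ρ₂ t + ρ₁ t * b t) * k⁻¹ ^ 2‖ ≤ C * ‖k⁻¹‖ ^ 3 ∧
      ‖F₂ t k - 1 - b t * k⁻¹‖ ≤ C * ‖k⁻¹‖ ^ 2 := by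
  have b0 := BoundedSymbol.of_continuousOn cu₀
  have b1 := BoundedSymbol.of_continuousOn cu₁
  have b0' := BoundedSymbol.of_continuousOn (ContinuousOn.conj cu₀)
  have b1' := BoundedSymbol.of_continuousOn (ContinuousOn.conj cu₁)
  have bdu := BoundedSymbol.of_continuousOn (ContinuousOn.conj cdu₀)
  have br1 := BoundedSymbol.of_continuousOn fun t ht => (hd₁ t ht).continuousWithinAt
  have br2 := BoundedSymbol.of_continuousOn fun t ht => (hd₂ t ht).continuousWithinAt
  have br3 := BoundedSymbol.of_continuousOn fun t ht => (hd₃ t ht).continuousWithinAt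
  have br4 := BoundedSymbol.of_continuousOn fun t ht => (hd₄ t ht).continuousWithinAt
  have bd3 := BoundedSymbol.of_continuousOn cd₃
  have bd4 := BoundedSymbol.of_continuousOn cd₄
  have bκ := BoundedSymbol.id (T := T)
  have br34 : BoundedSymbol T fun t κ => ρ₃ t + κ * ρ₄ t := br3.add (bκ.mul br4)
  obtain ⟨m, hm⟩ : ∃ m : ℝ → ℂ → ℂ, ∀ t κ, m t κ = ρ₂ t + κ * ρ₃ t + κ ^ 2 * ρ₄ t :=
    ⟨_, fun _ _ => rfl⟩
  have bm : BoundedSymbol T m := by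
    rw [show m = _ from funext₂ hm]
    exact (br2.add (bκ.mul br3)).add ((bκ.pow 2).mul br4)
  obtain ⟨P, hP⟩ : ∃ P : ℝ → ℂ → ℂ, ∀ t κ, P t κ =
      -2 * Complex.I * lam * (u₀ t * (starRingEnd ℂ) (u₀ t)) * (ρ₃ t + κ * ρ₄ t)
      - (d₃ t + κ * d₄ t)
      - 2 * lam * (starRingEnd ℂ) (u₀ t) * (2 * ρ₁ t * (ρ₃ t + κ * ρ₄ t) + m t κ ^ 2)
      + Complex.I * lam * (starRingEnd ℂ) (u₁ t) * (2 * ρ₁ t * m t κ + κ * m t κ ^ 2) :=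
    ⟨_, fun _ _ => rfl⟩
  have bP : BoundedSymbol T P := by
    rw [show P = _ from funext₂ hP]
    repeat' first | assumption | exact BoundedSymbol.const _ | apply BoundedSymbol.add |
      apply BoundedSymbol.sub | apply BoundedSymbol.mul
  obtain ⟨σ, hσ⟩ : ∃ σ : ℝ → ℂ → ℂ, ∀ t κ, σ t κ =
      -Complex.I / 2 * κ * lam * (starRingEnd ℂ) (u₀ t) := ⟨_, fun _ _ => rfl⟩
  have bσ : BoundedSymbol T σ := by
    rw [show σ = _ from funext₂ hσ]
    exact (((BoundedSymbol.const _).mul bκ).mul (BoundedSymbol.const _)).mul b0'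
  obtain ⟨G, hG⟩ : ∃ G : ℝ → ℂ → ℂ, ∀ t κ, G t κ =
      lam * (2 * (starRingEnd ℂ) (u₀ t) - Complex.I * (starRingEnd ℂ) (u₁ t) * κ)
        * (ρ₁ t + κ * m t κ) := ⟨_, fun _ _ => rfl⟩
  have bG : BoundedSymbol T G := by
    rw [show G = _ from funext₂ hG]
    repeat' first | assumption | exact BoundedSymbol.const _ | apply BoundedSymbol.sub |
      apply BoundedSymbol.mul | apply BoundedSymbol.add
  have bA : BoundedSymbol T fun t κ =>
      -Complex.I * lam * (u₀ t * (starRingEnd ℂ) (u₀ t)) - G t κ - κ ^ 3 * P t κ * σ t κ := by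
    repeat' first | assumption | exact BoundedSymbol.const _ | apply BoundedSymbol.sub |
      apply BoundedSymbol.mul
  have bΓ : BoundedSymbol T fun t κ => -Complex.I * lam * (starRingEnd ℂ) (u₁ t)
      + -Complex.I / 2 * κ * lam * (starRingEnd ℂ) (du₀ t)
      - 2 * Complex.I * lam * (u₀ t * (starRingEnd ℂ) (u₀ t)) * σ t κ
      - 2 * σ t κ * G t κ - σ t κ ^ 2 * (κ ^ 3 * P t κ) := by
    repeat' first | assumption | exact BoundedSymbol.const _ | apply BoundedSymbol.add |
      apply BoundedSymbol.sub | apply BoundedSymbol.mul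
  have bB : BoundedSymbol T fun t _ => lam * (2 * (starRingEnd ℂ) (u₀ t) * ρ₂ t
      - Complex.I * (starRingEnd ℂ) (u₁ t) * ρ₁ t) := by
    repeat' first | assumption | exact BoundedSymbol.const _ | apply BoundedSymbol.sub |
      apply BoundedSymbol.mul
  have bE : BoundedSymbol T fun t κ => lam * (2 * (starRingEnd ℂ) (u₀ t)
      * (ρ₃ t + κ * ρ₄ t) - Complex.I * (starRingEnd ℂ) (u₁ t) * m t κ)
      + -Complex.I / 2 * lam * (starRingEnd ℂ) (u₀ t) * (κ ^ 2 * P t κ) := by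
    repeat' first | assumption | exact BoundedSymbol.const _ | apply BoundedSymbol.add |
      apply BoundedSymbol.sub | apply BoundedSymbol.mul
  obtain ⟨CP, CP0, CP'⟩ := bP
  obtain ⟨CA, CA0, CA'⟩ := bA
  obtain ⟨CΓ, CΓ0, CΓ'⟩ := bΓ
  obtain ⟨CB, CB0, CB'⟩ := bB
  obtain ⟨CE, CE0, CE'⟩ := bE
  obtain ⟨CS, CS0, CS'⟩ := (BoundedSymbol.const (T := T) (-Complex.I / 2 * lam)).mul b0'
  obtain ⟨C1, C10, C1'⟩ := br1
  obtain ⟨C2, C20, C2'⟩ := br2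
  obtain ⟨C34, C340, C34'⟩ := br34
  obtain ⟨D, D0, hD⟩ := exists_triangular_estimate (T := T) (K := CP + CA + CΓ + CB + CE) hT
    (by positivity)
  obtain ⟨D₁, hD₁⟩ : ∃ D₁, D₁ = D + CS * D := ⟨_, rfl⟩
  have hD₁0 : 0 ≤ D₁ := by rw [hD₁]; positivity
  refine ⟨D₁ + (D + C1 * D₁ + C2 * D₁ + C34 * D₁), by positivity, fun k hk1 hkim => ?_⟩
  have hk0 : k ≠ 0 := by rintro rfl; norm_num at hk1
  have hκ1 : ‖k⁻¹‖ ≤ 1 := by rw [norm_inv]; exact inv_le_one_of_one_le₀ hk1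
  have hkκ : k * k⁻¹ = 1 := mul_inv_cancel₀ hk0
  generalize k⁻¹ = κ at *
  have hκ0 : 0 ≤ ‖κ‖ := norm_nonneg _
  obtain ⟨w, hw⟩ : ∃ w : ℝ → ℂ, ∀ t, w t = F₁ t k
    - (κ * ρ₁ t + κ ^ 2 * ρ₂ t + κ ^ 3 * ρ₃ t + κ ^ 4 * ρ₄ t) * F₂ t k := ⟨_, fun _ => rfl⟩
  obtain ⟨v, hv⟩ : ∃ v : ℝ → ℂ, ∀ t, v t = F₂ t k + σ t κ * w t := ⟨_, fun _ => rfl⟩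
  have hρ : ∀ t, κ * ρ₁ t + κ ^ 2 * ρ₂ t + κ ^ 3 * ρ₃ t + κ ^ 4 * ρ₄ t = κ * (ρ₁ t + κ * m t κ) :=
    fun t => by rw [hm]; ring
  have dw : ∀ t ∈ Icc 0 T, HasDerivWithinAt w
      ((-4 * Complex.I * k ^ 2 + (-Complex.I * lam * (u₀ t * (starRingEnd ℂ) (u₀ t)) - G t κ
        - κ ^ 3 * P t κ * σ t κ)) * w t + κ ^ 3 * P t κ * v t) (Icc 0 T) t := by
    intro t ht
    have h := (((hF k).fst t ht).sub ((((((hd₁ t ht).const_mul κ).add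
      ((hd₂ t ht).const_mul (κ ^ 2))).add ((hd₃ t ht).const_mul (κ ^ 3))).add
      ((hd₄ t ht).const_mul (κ ^ 4))).mul ((hF k).snd t ht)))
    rw [show w = _ from funext hw]
    refine h.congr_deriv ?_
    have h2 := wkb_fst_identity (P := riccatiResidual lam (u₀ t) _ _ _ _ _ _ (d₃ t) (d₄ t) κ)
      (F₁ := F₁ t k) (F₂ := F₂ t k) (σ := σ t κ)
      (riccati_identity hkκ (e₁ t ht) (e₂ t ht) (e₃ t ht) (e₄ t ht) rfl)
    refine h2.trans ?_
    beta_reduce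
    have h3 : lam * (2 * k * (starRingEnd ℂ) (u₀ t) - Complex.I * (starRingEnd ℂ) (u₁ t))
        * (κ * (ρ₁ t + κ * m t κ)) = G t κ := by
      rw [hG]
      linear_combination (2 * lam * (starRingEnd ℂ) (u₀ t) * (ρ₁ t + κ * m t κ)) * hkκ
    have h4 : riccatiResidual lam (u₀ t) ((starRingEnd ℂ) (u₀ t)) ((starRingEnd ℂ) (u₁ t)) (ρ₁ t)
        (ρ₂ t) (ρ₃ t) (ρ₄ t) (d₃ t) (d₄ t) κ = P t κ := by rw [hP, hm, riccatiResidual]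
    rw [h4, ← hw, ← hv, hρ, h3]
  have dv : ∀ t ∈ Icc 0 T, HasDerivWithinAt v ((-Complex.I * lam * (starRingEnd ℂ) (u₁ t)
      + -Complex.I / 2 * κ * lam * (starRingEnd ℂ) (du₀ t)
      - 2 * Complex.I * lam * (u₀ t * (starRingEnd ℂ) (u₀ t)) * σ t κ
      - 2 * σ t κ * G t κ - σ t κ ^ 2 * (κ ^ 3 * P t κ)) * w t
      + κ * (lam * (2 * (starRingEnd ℂ) (u₀ t) * ρ₂ t
      - Complex.I * (starRingEnd ℂ) (u₁ t) * ρ₁ t) + κ * (lam * (2 * (starRingEnd ℂ) (u₀ t)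
      * (ρ₃ t + κ * ρ₄ t) - Complex.I * (starRingEnd ℂ) (u₁ t) * m t κ)
      + -Complex.I / 2 * lam * (starRingEnd ℂ) (u₀ t) * (κ ^ 2 * P t κ))) * v t) (Icc 0 T) t := by
    intro t ht
    have dσ : HasDerivWithinAt (fun t => σ t κ)
        (-Complex.I / 2 * κ * lam * (starRingEnd ℂ) (du₀ t)) (Icc 0 T) t := by
      simp only [hσ]
      exact (HasDerivWithinAt.conj (hu₀ t ht)).const_mul _
    rw [show v = _ from funext hv]
    refine (((hF k).snd t ht).add (dσ.mul (dw t ht))).congr_deriv ?_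
    beta_reduce
    rw [← hv]
    exact wkb_snd_identity hkκ (e₁ t ht) ((hm t κ).trans (by ring)) (by rw [hw, hρ])
      (by rw [hv, hσ]) (hG t κ) (hσ t κ)
  -- All coefficients of the expansion vanish at t = 0, so w starts from zero and no free
  -- oscillation e^{−4ik²t} appears.
  have w0 : w 0 = 0 := by rw [hw, hF₁, z₁, z₂, z₃, z₄]; ring
  have v0 : v 0 = 1 := by rw [hv, hσ, zu, hF₂]; simp
  intro t ht
  obtain ⟨E1, E2, E3, E4⟩ := hD k κ w v _ (fun t => P t κ) _ _ _ b hκ1 hkim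
    (fun t ht => (CA' t ht κ hκ1).trans (by linarith))
    (fun t ht => (CP' t ht κ hκ1).trans (by linarith))
    (fun t ht => (CΓ' t ht κ hκ1).trans (by linarith))
    (fun t ht => (CB' t ht κ hκ1).trans (by linarith))
    (fun t ht => (CE' t ht κ hκ1).trans (by linarith)) dw dv hb w0 v0 zb t ht
  have hκ2 : ‖κ‖ ^ 2 ≤ ‖κ‖ := by nlinarith
  have hκ3 : ‖κ‖ ^ 3 ≤ ‖κ‖ ^ 2 := by nlinarith [sq_nonneg ‖κ‖]
  have hF₂v : F₂ t k = v t - σ t κ * w t := by rw [hv]; ring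
  have hσw : ‖σ t κ * w t‖ ≤ CS * D * ‖κ‖ ^ 3 := by
    have h1 : σ t κ = κ * (-Complex.I / 2 * lam * (starRingEnd ℂ) (u₀ t)) := by rw [hσ]; ring
    have h2 := CS' t ht κ hκ1
    rw [h1, mul_assoc, norm_mul, norm_mul]
    calc _ ≤ 1 * (CS * (D * ‖κ‖ ^ 3)) := by gcongr
      _ = _ := by ring
  have X2 : ‖F₂ t k - 1 - b t * κ‖ ≤ D₁ * ‖κ‖ ^ 2 := by
    rw [show F₂ t k - 1 - b t * κ = (v t - 1 - κ * b t) - σ t κ * w t by rw [hF₂v]; ring]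
    refine (norm_sub_le _ _).trans ?_
    have : CS * D * ‖κ‖ ^ 3 ≤ CS * D * ‖κ‖ ^ 2 := by gcongr
    rw [hD₁]
    linarith
  have X1 : ‖F₂ t k - 1‖ ≤ D₁ * ‖κ‖ := by
    rw [show F₂ t k - 1 = (v t - 1) - σ t κ * w t by rw [hF₂v]; ring]
    refine (norm_sub_le _ _).trans ?_
    have : CS * D * ‖κ‖ ^ 3 ≤ CS * D * ‖κ‖ := by gcongr; exact hκ3.trans hκ2
    rw [hD₁]
    linarith
  have X0 : ‖F₂ t k‖ ≤ D₁ := by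
    rw [hF₂v]
    refine (norm_sub_le _ _).trans ?_
    have : CS * D * ‖κ‖ ^ 3 ≤ CS * D * 1 := by
      gcongr; exact (hκ3.trans hκ2).trans hκ1
    rw [hD₁]
    linarith
  -- F₁ = w + ρF₂, with F₂ replaced by 1 + bκ in the κ-term and by 1 in the κ²-term.
  have e : F₁ t k - ρ₁ t * κ - (ρ₂ t + ρ₁ t * b t) * κ ^ 2 = w t
      + κ * (ρ₁ t * (F₂ t k - 1 - b t * κ)) + κ ^ 2 * (ρ₂ t * (F₂ t k - 1))
      + κ ^ 3 * ((ρ₃ t + κ * ρ₄ t) * F₂ t k) := by rw [hw]; ring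
  constructor
  · rw [e]
    have y1 : ‖κ * (ρ₁ t * (F₂ t k - 1 - b t * κ))‖ ≤ ‖κ‖ * (C1 * (D₁ * ‖κ‖ ^ 2)) := by
      rw [norm_mul, norm_mul]; gcongr; exact C1' t ht κ hκ1
    have y2 : ‖κ ^ 2 * (ρ₂ t * (F₂ t k - 1))‖ ≤ ‖κ‖ ^ 2 * (C2 * (D₁ * ‖κ‖)) := by
      rw [norm_mul, norm_mul, norm_pow]; gcongr; exact C2' t ht κ hκ1
    have y3 : ‖κ ^ 3 * ((ρ₃ t + κ * ρ₄ t) * F₂ t k)‖ ≤ ‖κ‖ ^ 3 * (C34 * D₁) := by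
      rw [norm_mul, norm_mul, norm_pow]; gcongr; exact C34' t ht κ hκ1
    have := norm_add₄_le (a := w t) (b := κ * (ρ₁ t * (F₂ t k - 1 - b t * κ)))
      (c := κ ^ 2 * (ρ₂ t * (F₂ t k - 1))) (d := κ ^ 3 * ((ρ₃ t + κ * ρ₄ t) * F₂ t k))
    have hp : 0 ≤ D₁ * ‖κ‖ ^ 3 := by positivity
    calc _ ≤ _ := this
      _ ≤ D * ‖κ‖ ^ 3 + ‖κ‖ * (C1 * (D₁ * ‖κ‖ ^ 2)) + ‖κ‖ ^ 2 * (C2 * (D₁ * ‖κ‖))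
          + ‖κ‖ ^ 3 * (C34 * D₁) := by gcongr
      _ ≤ _ := by linarith
  · refine X2.trans ?_
    gcongr
    have : 0 ≤ D + C1 * D₁ + C2 * D₁ + C34 * D₁ := by positivity
    linarith

theorem exists_antideriv {T : ℝ} (hT : 0 ≤ T) {f : ℝ → ℂ} (hf : ContinuousOn f (Icc 0 T)) :
    ∃ b : ℝ → ℂ, b 0 = 0 ∧ ∀ t ∈ Icc 0 T, HasDerivWithinAt b (f t) (Icc 0 T) t := by
  have h := (duhamel_iff (y := fun t => ∫ s in (0 : ℝ)..t, f s) (left_mem_Icc.2 hT) 0 0 hf).1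
    (fun t _ => by simp)
  exact ⟨_, h.1, fun t ht => (h.2 t ht).congr_deriv (by simp)⟩

theorem eq_of_deriv_eq {T : ℝ} {f f' : ℝ → ℂ}
    (hf : ∀ t ∈ Icc 0 T, HasDerivWithinAt f (f' t) (Icc 0 T) t) (h : ∀ t ∈ Icc 0 T, f' t = 0) :
    ∀ t ∈ Icc 0 T, f t = f 0 := by
  intro t ht
  have := norm_sub_le_of_deriv_bound (C := 0) hf (fun s hs => by simp [h s hs])
    (left_mem_Icc.2 (ht.1.trans ht.2)) ht
  rw [zero_mul] at this
  exact sub_eq_zero.1 (norm_le_zero_iff.1 this)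

/-- Large-`k` asymptotics of the second column of the eigenfunction on a vertical line. -/
theorem SmoothData.asymptotics {lam L T : ℝ} {q qx qxx qt qtt qxt qxtt : ℝ → ℝ → ℂ}
    (D : SmoothData lam L T q qx qxx qt qtt qxt qxtt) {x : ℝ} (hx : x ∈ Icc 0 L)
    {F₁ F₂ : ℝ → ℂ → ℂ}
    (hF : ∀ k, TSys lam T (q x) (qx x) k (fun t => F₁ t k) (fun t => F₂ t k))
    (hF₁ : ∀ k, F₁ 0 k = 0) (hF₂ : ∀ k, F₂ 0 k = 1) :
    ∃ b : ℝ → ℂ, (∀ t ∈ Icc 0 T, (starRingEnd ℂ) (b t) = -b t) ∧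
      ∃ C, 0 ≤ C ∧ ∀ k : ℂ, 1 ≤ ‖k‖ → (k ^ 2).im ≤ 0 → ∀ t ∈ Icc 0 T,
        ‖F₁ t k - q x t / (2 * Complex.I) * k⁻¹
          - (qx x t / 4 + q x t / (2 * Complex.I) * b t) * k⁻¹ ^ 2‖ ≤ C * ‖k⁻¹‖ ^ 3 ∧
        ‖F₂ t k - 1 - b t * k⁻¹‖ ≤ C * ‖k⁻¹‖ ^ 2 := by
  have hT := D.T_pos.le
  have du := D.deriv_t x hx
  have dut := D.deriv_tt x hx
  have dx := D.deriv_xt x hx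
  have dxt := D.deriv_xtt x hx
  have z0 := D.zero x hx
  have zx := D.zero_x x hx
  have zt := D.zero_t x hx
  have zxt := D.zero_xt x hx
  have cu : ContinuousOn (q x) (Icc 0 T) := fun t ht => (du t ht).continuousWithinAt
  have cux : ContinuousOn (qx x) (Icc 0 T) := fun t ht => (dx t ht).continuousWithinAt
  have cut : ContinuousOn (qt x) (Icc 0 T) := fun t ht => (dut t ht).continuousWithinAt
  have cuxt : ContinuousOn (qxt x) (Icc 0 T) := fun t ht => (dxt t ht).continuousWithinAt
  have cutt : ContinuousOn (qtt x) (Icc 0 T) :=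
    D.cont_tt.comp (by fun_prop) (f := fun t => (x, t)) fun t ht => ⟨hx, ht⟩
  have cuxtt : ContinuousOn (qxtt x) (Icc 0 T) :=
    D.cont_xtt.comp (by fun_prop) (f := fun t => (x, t)) fun t ht => ⟨hx, ht⟩
  generalize q x = u₀ at *
  generalize qx x = u₁ at *
  generalize qt x = v₀ at *
  generalize qxt x = v₁ at *
  generalize qtt x = w₀ at *
  generalize qxtt x = w₁ at *
  have cuc := ContinuousOn.conj cu
  have cuxc := ContinuousOn.conj cux
  have cutc := ContinuousOn.conj cut
  have cuxtc := ContinuousOn.conj cuxt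
  have hI := Complex.I_mul_I
  have hd : ∀ z : ℂ, z / (2 * Complex.I) = -Complex.I / 2 * z := fun z => by
    rw [div_eq_mul_inv, mul_inv, Complex.inv_I]; ring
  -- The integrand is (λ/2)(ū₀u₁ − u₀ū₁). It is purely imaginary, and therefore so is b.
  obtain ⟨b, zb, hb⟩ := exists_antideriv hT (f := fun t => lam * (2 * (starRingEnd ℂ) (u₀ t) *
    (u₁ t / 4) - Complex.I * (starRingEnd ℂ) (u₁ t) * (u₀ t / (2 * Complex.I)))) (by fun_prop)
  refine ⟨b, ?_, ?_⟩
  · intro t ht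
    have h := eq_of_deriv_eq (f := fun t => (starRingEnd ℂ) (b t) + b t)
      (fun t ht => (HasDerivWithinAt.conj (hb t ht)).add (hb t ht)) (fun t _ => by
        simp only [map_mul, map_sub, map_div₀, Complex.conj_conj, Complex.conj_ofReal,
          Complex.conj_I, map_ofNat]
        field_simp
        ring) t ht
    simp only [zb, map_zero, add_zero] at h
    exact eq_neg_of_add_eq_zero_left h
  -- The ρⱼ are found by solving `e₁` to `e₄` in turn. Since ρ₃ contains q_t and ρ₄ contains q_xt,
  -- these must vanish at t = 0, and the derivatives of ρ₃ and ρ₄ bring in q_tt and q_xtt.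
  · refine TSys.asymptotics hT (du₀ := v₀) (ρ₁ := fun t => u₀ t / (2 * Complex.I))
      (ρ₂ := fun t => u₁ t / 4)
      (ρ₃ := fun t => v₀ t / 8 + Complex.I / 8 * lam * (u₀ t * (starRingEnd ℂ) (u₀ t)) * u₀ t)
      (ρ₄ := fun t => Complex.I / 4 * (v₁ t / 4
        + Complex.I / 2 * lam * (u₀ t * (starRingEnd ℂ) (u₀ t)) * u₁ t
        - Complex.I / 2 * lam * ((starRingEnd ℂ) (u₀ t) * u₀ t * u₁ t)
        + Complex.I / 4 * lam * ((starRingEnd ℂ) (u₁ t) * (u₀ t * u₀ t))))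
      hF hF₁ hF₂ cu cux cut ?_ ?_ du (fun t ht => (du t ht).div_const _)
      (fun t ht => (dx t ht).div_const _)
      (fun t ht => ((dut t ht).div_const _).add ((((du t ht).mul
        (HasDerivWithinAt.conj (du t ht))).const_mul (Complex.I / 8 * lam)).mul (du t ht)))
      (fun t ht => (((((dxt t ht).div_const _).add ((((du t ht).mul
        (HasDerivWithinAt.conj (du t ht))).const_mul (Complex.I / 2 * lam)).mul (dx t ht))).sub
        ((((HasDerivWithinAt.conj (du t ht)).mul (du t ht)).mul (dx t ht)).const_mul
          (Complex.I / 2 * lam))).add (((HasDerivWithinAt.conj (dx t ht)).mul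
          ((du t ht).mul (du t ht))).const_mul (Complex.I / 4 * lam))).const_mul _)
      hb ?_ ?_ ?_ ?_ zb z0 ?_ ?_ ?_ ?_
    · simp only [Pi.mul_apply]; fun_prop
    · simp only [Pi.mul_apply]; fun_prop
    · simp [z0]
    · simp [zx]
    · simp [zt, z0]
    · simp [z0, zx, zxt]
    · intro t _
      field_simp
    · intro t _
      ring
    · intro t _
      simp only [hd]
      ring
    · intro t _
      simp only [hd]
      linear_combination (-(v₁ t / 4 + Complex.I / 4 * lam * ((starRingEnd ℂ) (u₁ t) * u₀ t ^ 2))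
        + Complex.I / 4 * lam * (starRingEnd ℂ) (u₁ t) * u₀ t ^ 2) * hI

/-! ### The global relation -/

namespace SmoothData

variable {lam L T : ℝ} {q qx qxx qt qtt qxt qxtt : ℝ → ℝ → ℂ}

/-- The global relation: the eigenfunctions normalized at the two lower corners agree on the
side `x = L`, because the potential vanishes at `t = 0`. -/
theorem eigenfunction_bottom (D : SmoothData lam L T q qx qxx qt qtt qxt qxtt)
    {μ ν : ℝ → ℝ → ℂ → Matrix (Fin 2) (Fin 2) ℂ} (hμ : IsEigenfunction lam L T q 0 0 μ)
    (hν : IsEigenfunction lam L T q L 0 ν) {t : ℝ} (ht : t ∈ Icc 0 T) (k : ℂ) :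
    μ L t k = ν L t k := by
  have m0 : (0 : ℝ) ∈ Icc 0 L := D.mem_Icc_left (Or.inl rfl)
  have mL : L ∈ Icc 0 L := D.mem_Icc_left (Or.inr rfl)
  have n0 : (0 : ℝ) ∈ Icc 0 T := D.mem_Icc_right (Or.inl rfl)
  obtain ⟨h1, h2⟩ := D.laxSol_of_isEigenfunction m0 n0 hμ k
  obtain ⟨h1', h2'⟩ := D.laxSol_of_isEigenfunction mL n0 hν k
  have i1 := D.isEigenfunction_corner m0 n0 hμ k
  have i2 := D.isEigenfunction_corner mL n0 hν k
  have cq := continuousOn_slice_fst D.cont n0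
  -- At t = 0 the potential is zero and the x-part is explicit: the matrix μ(x,0,k) is the identity
  -- all along the bottom edge. So μ and ν agree at (L,0), and by compatibility both solve the
  -- t-part on x = L.
  have f1 : XSys lam L (fun x => q x 0) k (fun _ => 0) (fun _ => 1) :=
    ⟨fun x hx => (hasDerivWithinAt_const x _ (0 : ℂ)).congr_deriv (by simp [D.zero x hx]),
      fun x hx => (hasDerivWithinAt_const x _ (1 : ℂ)).congr_deriv (by simp)⟩
  have f2 : XSys lam L (fun x => q x 0) k (fun x => (phase k x 0)⁻¹) (fun _ => 0) :=
    ⟨fun x _ => (hasDerivAt_phase_inv_fst k x 0).hasDerivWithinAt.congr_deriv (by simp),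
      fun x hx => (hasDerivWithinAt_const x _ (0 : ℂ)).congr_deriv (by simp [D.zero x hx])⟩
  have g1 := XSys.unique (h1.x_part 0 n0) f1 cq (Or.inl rfl) (by simp [i1]) (by simp [i1]) mL
  have g2 := XSys.unique (h2.x_part 0 n0) f2 cq (Or.inl rfl) (by simp [i1]) (by simp [i1]) mL
  have c0 := continuousOn_slice_snd D.cont mL
  have c1 := continuousOn_slice_snd D.cont_x mL
  have e1 := TSys.unique (D.tSys_of_laxSol h1 mL) h1'.t_part c0 c1 (Or.inl rfl)
    (g1.1.trans (by simp [i2])) (g1.2.trans (by simp [i2])) ht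
  have e2 := TSys.unique (D.tSys_of_laxSol h2 mL) h2'.t_part c0 c1 (Or.inl rfl)
    (g2.1.trans (by simp [i2])) (g2.2.trans (by simp [i2])) ht
  have hne : (phase k L t)⁻¹ ≠ 0 := inv_ne_zero (Complex.exp_ne_zero _)
  ext i j
  fin_cases i <;> fin_cases j
  exacts [mul_left_cancel₀ hne e2.1, e1.1, mul_left_cancel₀ hne e2.2, e1.2]

/-- The combination of the spectral data on both sides that is of exponential type. -/
theorem exists_exp_bound (D : SmoothData lam L T q qx qxx qt qtt qxt qxtt)
    {μ ν : ℝ → ℝ → ℂ → Matrix (Fin 2) (Fin 2) ℂ} (hμ : IsEigenfunction lam L T q 0 0 μ)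
    (hν : IsEigenfunction lam L T q L 0 ν) {t : ℝ} (ht : t ∈ Icc 0 T) :
    ∃ C, 0 ≤ C ∧ ∀ k : ℂ, ‖ν L t k 0 1 * μ 0 t k 0 0 - ν L t k 0 0 * μ 0 t k 0 1 * expL L (-k)‖
      ≤ Real.exp (C * ‖k‖ + C) := by
  have m0 : (0 : ℝ) ∈ Icc 0 L := D.mem_Icc_left (Or.inl rfl)
  have mL : L ∈ Icc 0 L := D.mem_Icc_left (Or.inr rfl)
  have n0 : (0 : ℝ) ∈ Icc 0 T := D.mem_Icc_right (Or.inl rfl)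
  obtain ⟨Cq, hCq, hCq'⟩ := exists_norm_le_Icc (continuousOn_slice_fst D.cont ht)
  have hL := D.L_pos
  have ha := abs_nonneg lam
  refine ⟨8 * L + (4 * (Cq + |lam| * Cq) + 1) * L, by positivity, fun k => ?_⟩
  obtain ⟨h1, h2⟩ := D.laxSol_of_isEigenfunction m0 n0 hμ k
  have hdet := D.eigenfunction_det m0 n0 hμ ht k
  have hne : phase k 0 t ≠ 0 := Complex.exp_ne_zero _
  -- The coefficients are taken from the first row of μ(0,t,k), so that the combination equals (0,
  -- 1) at x = 0 by the determinant relation. Its first component at x = L is the quantity to be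
  -- bounded, and propagation over the length L costs only an exponential of |k|.
  have hs := ((h1.x_part t ht).const_mul (μ 0 t k 0 0)).sub
    ((h2.x_part t ht).const_mul (μ 0 t k 0 1 * phase k 0 t))
  have h := energy_estimate (K := 2 * ‖k‖ + Cq + |lam| * Cq) (ε := 0)
    (α := fun _ => -2 * Complex.I * k) (β := fun x => q x t)
    (γ := fun x => lam * (starRingEnd ℂ) (q x t)) (δ := fun _ => 0) (r := fun _ => 0)
    (s := fun _ => 0) (by positivity)
    (fun x hx => (hs.fst x hx).congr_deriv (by simp only [add_zero]))
    (fun x hx => (hs.snd x hx).congr_deriv (by simp only [add_zero]))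
    (fun x hx => by
      refine (Complex.re_le_norm _).trans ?_
      simp only [norm_mul, norm_neg, Complex.norm_I, Complex.norm_ofNat, mul_one]
      have : 0 ≤ |lam| * Cq := by positivity
      linarith)
    (fun x hx => by simp only [Complex.zero_re]; positivity)
    (fun x hx => by
      have : 0 ≤ |lam| * Cq := by positivity
      linarith [hCq' x hx, norm_nonneg k])
    (fun x hx => by
      rw [norm_mul, Complex.norm_real, Real.norm_eq_abs, RCLike.norm_conj]
      have : |lam| * ‖q x t‖ ≤ |lam| * Cq := by
        gcongr
        exact hCq' x hx
      linarith [norm_nonneg k])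
    (by simp) (by simp) mL
  have hy0 : μ 0 t k 0 0 * μ 0 t k 0 1 - μ 0 t k 0 1 * phase k 0 t * ((phase k 0 t)⁻¹ * μ 0 t k 0 0)
      = 0 := by field_simp; ring
  have hz0 : μ 0 t k 0 0 * μ 0 t k 1 1 - μ 0 t k 0 1 * phase k 0 t * ((phase k 0 t)⁻¹ * μ 0 t k 1 0)
      = 1 := by rw [← hdet]; field_simp
  have hp : phase k 0 t * (phase k L t)⁻¹ = expL L (-k) := by
    unfold phase expL; rw [← Complex.exp_neg, ← Complex.exp_add]; push_cast; ring_nf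
  have hyL : μ 0 t k 0 0 * μ L t k 0 1 - μ 0 t k 0 1 * phase k 0 t * ((phase k L t)⁻¹ * μ L t k 0 0)
      = ν L t k 0 1 * μ 0 t k 0 0 - ν L t k 0 0 * μ 0 t k 0 1 * expL L (-k) := by
    rw [← D.eigenfunction_bottom hμ hν ht k, ← hp]; ring
  rw [hy0, hz0, hyL] at h
  simp only [norm_zero, norm_one] at h
  set X := ‖ν L t k 0 1 * μ 0 t k 0 0 - ν L t k 0 0 * μ 0 t k 0 1 * expL L (-k)‖
  have hle : (4 * (2 * ‖k‖ + Cq + |lam| * Cq) + 1) * (L - 0)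
      ≤ (8 * L + (4 * (Cq + |lam| * Cq) + 1) * L) * ‖k‖
        + (8 * L + (4 * (Cq + |lam| * Cq) + 1) * L) := by
    have : 0 ≤ (4 * (Cq + |lam| * Cq) + 1) * L * ‖k‖ := by positivity
    linarith
  refine le_trans ?_ (Real.exp_le_exp.2 hle)
  set W := Real.exp ((4 * (2 * ‖k‖ + Cq + |lam| * Cq) + 1) * (L - 0)) with hW
  have hW1 : 1 ≤ W := Real.one_le_exp (by rw [sub_zero]; positivity)
  refine (abs_le_of_sq_le_sq' ?_ (by positivity)).2
  have : 0 ≤ ‖μ 0 t k 0 0 * μ L t k 1 1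
    - μ 0 t k 0 1 * phase k 0 t * ((phase k L t)⁻¹ * μ L t k 1 0)‖ ^ 2 := by positivity
  nlinarith

end SmoothData

/-! ### Exponential type and the Phragmén–Lindelöf principle -/

/-- Functions of exponential type. -/
def ExpType (f : ℂ → ℂ) : Prop := ∃ C, 0 ≤ C ∧ ∀ k, ‖f k‖ ≤ C * Real.exp (C * ‖k‖)

namespace ExpType

variable {f g : ℂ → ℂ}

theorem const (c : ℂ) : ExpType fun _ => c :=
  ⟨‖c‖, norm_nonneg _, fun k =>
    le_mul_of_one_le_right (norm_nonneg _) (Real.one_le_exp (by positivity))⟩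

theorem id : ExpType fun k => k :=
  ⟨1, zero_le_one, fun k => by
    rw [one_mul, one_mul]; linarith [Real.add_one_le_exp ‖k‖]⟩

theorem add (hf : ExpType f) (hg : ExpType g) : ExpType fun k => f k + g k := by
  obtain ⟨C, hC, h⟩ := hf
  obtain ⟨D, hD, h'⟩ := hg
  refine ⟨C + D, by positivity, fun k => (norm_add_le _ _).trans ?_⟩
  rw [add_mul C D (Real.exp _)]
  refine add_le_add ((h k).trans ?_) ((h' k).trans ?_) <;> gcongr <;> linarith

theorem mul (hf : ExpType f) (hg : ExpType g) : ExpType fun k => f k * g k := by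
  obtain ⟨C, hC, h⟩ := hf
  obtain ⟨D, hD, h'⟩ := hg
  refine ⟨C * D + C + D, by positivity, fun k => ?_⟩
  rw [norm_mul]
  have hCD : 0 ≤ C * D := by positivity
  calc ‖f k‖ * ‖g k‖ ≤ (C * Real.exp (C * ‖k‖)) * (D * Real.exp (D * ‖k‖)) :=
        mul_le_mul (h k) (h' k) (norm_nonneg _) (by positivity)
    _ = C * D * Real.exp ((C + D) * ‖k‖) := by rw [add_mul, Real.exp_add]; ring
    _ ≤ _ := by gcongr ?_ * Real.exp (?_ * _) <;> linarith

theorem neg (hf : ExpType f) : ExpType fun k => -f k := by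
  obtain ⟨C, hC, h⟩ := hf
  exact ⟨C, hC, fun k => by rw [norm_neg]; exact h k⟩

theorem sub (hf : ExpType f) (hg : ExpType g) : ExpType fun k => f k - g k := by
  simpa only [sub_eq_add_neg] using hf.add hg.neg

theorem pow (hf : ExpType f) (n : ℕ) : ExpType fun k => f k ^ n := by
  induction n with
  | zero => simpa using const 1
  | succ n ih => simpa only [pow_succ] using ih.mul hf

theorem comp_neg (hf : ExpType f) : ExpType fun k => f (-k) := by
  obtain ⟨C, hC, h⟩ := hf
  exact ⟨C, hC, fun k => by simpa using h (-k)⟩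

end ExpType

theorem norm_expL (L : ℝ) (k : ℂ) : ‖expL L k‖ = Real.exp (-2 * L * k.im) := by
  rw [expL, Complex.norm_exp]
  congr 1
  simp
  ring

theorem expL_mul_expL_neg (L : ℝ) (k : ℂ) : expL L k * expL L (-k) = 1 := by
  rw [expL, expL, ← Complex.exp_add]
  simp

theorem differentiable_expL (L : ℝ) : Differentiable ℂ (expL L) := by
  unfold expL; fun_prop

theorem expType_expL (L : ℝ) : ExpType (expL L) := by
  refine ⟨2 * |L| + 1, by positivity, fun k => ?_⟩
  rw [norm_expL]
  have h1 : -2 * L * k.im ≤ (2 * |L| + 1) * ‖k‖ := by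
    calc -2 * L * k.im ≤ |-2 * L * k.im| := le_abs_self _
      _ = 2 * |L| * |k.im| := by rw [abs_mul, abs_mul]; norm_num
      _ ≤ 2 * |L| * ‖k‖ := by gcongr; exact Complex.abs_im_le_norm k
      _ ≤ _ := by nlinarith [norm_nonneg k]
  calc _ ≤ Real.exp ((2 * |L| + 1) * ‖k‖) := Real.exp_le_exp.2 h1
    _ ≤ _ := le_mul_of_one_le_left (Real.exp_nonneg _) (by linarith [abs_nonneg L])

/-- Phragmén–Lindelöf in the closed lower half plane, for bounds on the axes. -/
theorem ExpType.norm_le_of_axes {f : ℂ → ℂ} (hf : ExpType f) (hd : Differentiable ℂ f) {B : ℝ}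
    (hre : ∀ x : ℝ, ‖f x‖ ≤ B) (him : ∀ x : ℝ, x ≤ 0 → ‖f (x * Complex.I)‖ ≤ B) {k : ℂ}
    (hk : k.im ≤ 0) : ‖f k‖ ≤ B := by
  obtain ⟨C, hC, h⟩ := hf
  have hO : ∀ s : Set ℂ, f =O[Bornology.cobounded ℂ ⊓ 𝓟 s]
      fun z => Real.exp (C * ‖z‖ ^ (1 : ℝ)) := by
    intro s
    refine Asymptotics.IsBigO.of_bound C (Eventually.of_forall fun z => ?_)
    rw [Real.rpow_one, Real.norm_eq_abs, Real.abs_exp]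
    exact h z
  -- The half plane itself would tolerate only order below 1. Each quadrant tolerates order below 2,
  -- at the price of needing a bound on the imaginary half axis as well.
  rcases le_total k.re 0 with h0 | h0
  · exact PhragmenLindelof.quadrant_III hd.diffContOnCl ⟨1, by norm_num, C, hO _⟩
      (fun x _ => hre x) him h0 hk
  · exact PhragmenLindelof.quadrant_IV hd.diffContOnCl ⟨1, by norm_num, C, hO _⟩
      (fun x _ => hre x) him h0 hk

theorem differentiable_bar {f : ℂ → ℂ} (hf : Differentiable ℂ f) : Differentiable ℂ (bar f) :=
  fun k => by
    have := (hf ((starRingEnd ℂ) k)).conj_conj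
    rw [Complex.conj_conj] at this
    exact this

/-- Entire functions with the large-`k` behaviour `F₁ = a₁/k + a₂/k² + O(k⁻³)`,
`F₂ = 1 + b/k + O(k⁻²)` in the closed second and fourth quadrants. -/
structure SideAsymptotics (F₁ F₂ : ℂ → ℂ) (a₁ a₂ b : ℂ) : Prop where
  diff_fst : Differentiable ℂ F₁
  diff_snd : Differentiable ℂ F₂
  conj_b : (starRingEnd ℂ) b = -b
  bound : ∃ C, 0 ≤ C ∧ ∀ k : ℂ, 1 ≤ ‖k‖ → (k ^ 2).im ≤ 0 →
    ‖F₁ k - a₁ * k⁻¹ - a₂ * k⁻¹ ^ 2‖ ≤ C * ‖k⁻¹‖ ^ 3 ∧ ‖F₂ k - 1 - b * k⁻¹‖ ≤ C * ‖k⁻¹‖ ^ 2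

namespace SideAsymptotics

variable {F₁ F₂ G₁ G₂ : ℂ → ℂ} {a₁ a₂ b A₁ A₂ B : ℂ}

/-- On the real and imaginary axes both `F₁` and `bar G₂` are controlled. -/
theorem exists_bound_axes (hF : SideAsymptotics F₁ F₂ a₁ a₂ b)
    (hG : SideAsymptotics G₁ G₂ A₁ A₂ B) :
    ∃ C, 0 ≤ C ∧ ∀ k : ℂ, (k ^ 2).im = 0 →
      ‖k ^ 3 * (F₁ k * bar G₂ k) - k ^ 2 * a₁ - k * (a₂ - a₁ * B)‖ ≤ C := by
  obtain ⟨C, hC, h⟩ := hF.bound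
  obtain ⟨D, hD, h'⟩ := hG.bound
  have hdiff : Differentiable ℂ
      (fun k => k ^ 3 * (F₁ k * bar G₂ k) - k ^ 2 * a₁ - k * (a₂ - a₁ * B)) := by
    have h1 := hF.diff_fst
    have h2 := differentiable_bar hG.diff_snd
    fun_prop
  obtain ⟨K, hK⟩ := (isCompact_closedBall (0 : ℂ) 1).exists_bound_of_continuousOn
    hdiff.continuous.continuousOn
  refine ⟨|K| + (C * (1 + ‖B‖ + D) + ‖a₁‖ * D + ‖a₂‖ * (‖B‖ + D)), by positivity, fun k hk => ?_⟩
  rcases le_total ‖k‖ 1 with hk1 | hk1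
  · have := hK k (by simpa using hk1)
    have h0 : 0 ≤ C * (1 + ‖B‖ + D) + ‖a₁‖ * D + ‖a₂‖ * (‖B‖ + D) := by positivity
    exact this.trans (by linarith [le_abs_self K])
  · have hk0 : k ≠ 0 := by rintro rfl; norm_num at hk1
    have e1 := (h k hk1 hk.le).1
    -- The condition Im k² = 0 is invariant under conjugation, which is why the axes are the place
    -- where F₁ and `bar G₂` are controlled together. As B is purely imaginary, `bar G₂` behaves
    -- like 1 − B/k.
    have e2 := (h' ((starRingEnd ℂ) k) (by rwa [RCLike.norm_conj]) (by
      rw [← map_pow, Complex.conj_im, hk, neg_zero])).2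
    rw [← RCLike.norm_conj (_ - _)] at e2
    simp only [map_sub, map_mul, map_one, map_inv₀, Complex.conj_conj, hG.conj_b] at e2
    rw [← map_inv₀, RCLike.norm_conj] at e2
    change ‖bar G₂ k - 1 - -B * k⁻¹‖ ≤ _ at e2
    have hκ1 : ‖k⁻¹‖ ≤ 1 := by rw [norm_inv]; exact inv_le_one_of_one_le₀ hk1
    have hkκ : k * k⁻¹ = 1 := mul_inv_cancel₀ hk0
    have hκk : ‖k‖ * ‖k⁻¹‖ = 1 := by rw [← norm_mul, hkκ, norm_one]
    generalize k⁻¹ = κ at *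
    have hκ0 := norm_nonneg κ
    obtain ⟨u, hu⟩ : ∃ u, u = k ^ 3 * (F₁ k - a₁ * κ - a₂ * κ ^ 2) := ⟨_, rfl⟩
    obtain ⟨v, hv⟩ : ∃ v, v = k ^ 2 * (bar G₂ k - 1 - -B * κ) := ⟨_, rfl⟩
    have hu' : ‖u‖ ≤ C := by
      rw [hu, norm_mul, norm_pow]
      calc _ ≤ ‖k‖ ^ 3 * (C * ‖κ‖ ^ 3) := by gcongr
        _ = C * (‖k‖ * ‖κ‖) ^ 3 := by ring
        _ = C := by rw [hκk]; ring
    have hv' : ‖v‖ ≤ D := by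
      rw [hv, norm_mul, norm_pow]
      calc _ ≤ ‖k‖ ^ 2 * (D * ‖κ‖ ^ 2) := by gcongr
        _ = D * (‖k‖ * ‖κ‖) ^ 2 := by ring
        _ = D := by rw [hκk]; ring
    have hb : bar G₂ k = 1 - B * κ + κ ^ 2 * v := by
      rw [hv]; linear_combination (-(k * κ + 1) * (bar G₂ k - 1 + B * κ)) * hkκ
    have hb' : ‖bar G₂ k‖ ≤ 1 + ‖B‖ + D := by
      rw [hb]
      refine (norm_add_le _ _).trans (add_le_add ((norm_sub_le _ _).trans ?_) ?_)
      · rw [norm_one, norm_mul]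
        have : ‖B‖ * ‖κ‖ ≤ ‖B‖ * 1 := by gcongr
        linarith
      · rw [norm_mul, norm_pow]
        calc _ ≤ 1 ^ 2 * D := by gcongr
          _ = D := by ring
    have key : k ^ 3 * (F₁ k * bar G₂ k) - k ^ 2 * a₁ - k * (a₂ - a₁ * B)
        = u * bar G₂ k + a₁ * v + a₂ * (-B + κ * v) := by
      rw [hu, hv]
      linear_combination (a₁ * k ^ 2 * bar G₂ k - a₁ * k * B
        + a₂ * (k ^ 2 * κ * bar G₂ k + k - B * (k * κ + 1))) * hkκ
    rw [key]
    have t1 : ‖u * bar G₂ k‖ ≤ C * (1 + ‖B‖ + D) := by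
      rw [norm_mul]; gcongr
    have t2 : ‖a₁ * v‖ ≤ ‖a₁‖ * D := by rw [norm_mul]; gcongr
    have t3 : ‖a₂ * (-B + κ * v)‖ ≤ ‖a₂‖ * (‖B‖ + D) := by
      rw [norm_mul]
      gcongr
      refine (norm_add_le _ _).trans ?_
      rw [norm_neg, norm_mul]
      have : ‖κ‖ * ‖v‖ ≤ 1 * D := by gcongr
      linarith
    refine norm_add₃_le.trans ?_
    linarith [abs_nonneg K]

/-- The global relation determines `M = F₁ bar G₂ - bar F₂ G₁ e^{-2ikL}` in the lower half plane and
`e^{2ikL} M` in the upper half plane, up to `O(k⁻³)`. -/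
theorem exists_bound_global {L : ℝ} (hL : 0 ≤ L) (hF : SideAsymptotics F₁ F₂ a₁ a₂ b)
    (hG : SideAsymptotics G₁ G₂ A₁ A₂ B)
    (hM : ExpType fun k => F₁ k * bar G₂ k - bar F₂ k * G₁ k * expL L (-k)) :
    ∃ (C : ℝ) (P Q : ℂ → ℂ), 0 ≤ C ∧ (∀ k : ℂ, k.im ≤ 0 → ‖P k‖ ≤ C ∧ ‖Q k‖ ≤ C) ∧ ∀ k : ℂ,
      k ^ 3 * (F₁ k * bar G₂ k - bar F₂ k * G₁ k * expL L (-k)) - k ^ 2 * a₁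
        - k * (a₂ - a₁ * B) + expL L (-k) * (k ^ 2 * A₁ + k * (A₂ - A₁ * b)) = P k ∧
      (-k) ^ 3 * (F₁ (-k) * bar G₂ (-k) - bar F₂ (-k) * G₁ (-k) * expL L k) - k ^ 2 * a₁
        + k * (a₂ - a₁ * B) + expL L k * (k ^ 2 * A₁ - k * (A₂ - A₁ * b)) = expL L k * Q k := by
  obtain ⟨C, hC, h⟩ := hF.exists_bound_axes hG
  obtain ⟨D, hD, h'⟩ := hG.exists_bound_axes hF
  obtain ⟨P, hP⟩ : ∃ P : ℂ → ℂ, ∀ k, P k =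
      k ^ 3 * (F₁ k * bar G₂ k - bar F₂ k * G₁ k * expL L (-k)) - k ^ 2 * a₁
        - k * (a₂ - a₁ * B) + expL L (-k) * (k ^ 2 * A₁ + k * (A₂ - A₁ * b)) := ⟨_, fun _ => rfl⟩
  have dP : Differentiable ℂ P := by
    rw [show P = _ from funext hP]
    have h1 := hF.diff_fst
    have h2 := differentiable_bar hF.diff_snd
    have h3 := hG.diff_fst
    have h4 := differentiable_bar hG.diff_snd
    have h5 := differentiable_expL L
    have h6 : Differentiable ℂ fun k => expL L (-k) := h5.comp differentiable_neg
    fun_prop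
  have eP : ExpType P := by
    rw [show P = _ from funext hP]
    have h1 := ExpType.id
    have h2 := (expType_expL L).comp_neg
    exact ((((h1.pow 3).mul hM).sub ((h1.pow 2).mul (.const _))).sub (h1.mul (.const _))).add
      (h2.mul (((h1.pow 2).mul (.const _)).add (h1.mul (.const _))))
  have bP : ∀ k : ℂ, (k ^ 2).im = 0 → ‖P k‖ ≤ C + ‖expL L (-k)‖ * D := by
    intro k hk
    have e : P k = (k ^ 3 * (F₁ k * bar G₂ k) - k ^ 2 * a₁ - k * (a₂ - a₁ * B))
        - expL L (-k) * (k ^ 3 * (G₁ k * bar F₂ k) - k ^ 2 * A₁ - k * (A₂ - A₁ * b)) := by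
      rw [hP]; ring
    rw [e]
    refine (norm_sub_le _ _).trans (add_le_add (h k hk) ?_)
    rw [norm_mul]
    exact mul_le_mul_of_nonneg_left (h' k hk) (norm_nonneg _)
  have hre : ∀ x : ℝ, (((x : ℂ)) ^ 2).im = 0 := fun x => by
    rw [← Complex.ofReal_pow, Complex.ofReal_im]
  have him : ∀ x : ℝ, (((x : ℂ) * Complex.I) ^ 2).im = 0 := fun x => by
    rw [mul_pow, Complex.I_sq, mul_neg_one, Complex.neg_im, hre, neg_zero]
  -- The statement in the upper half plane is moved to the lower one by k ↦ −k: the factor e^{−2ikL}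
  -- absorbs the growth of P(−k), and Phragmén–Lindelöf applies once more.
  refine ⟨C + D, P, fun k => expL L (-k) * P (-k), by positivity, ?_, fun k => ⟨(hP k).symm, ?_⟩⟩
  · intro k hk
    constructor
    · refine eP.norm_le_of_axes dP (fun x => ?_) (fun x hx => ?_) hk
      · have := bP x (hre x)
        rw [norm_expL] at this
        simpa using this
      · refine (bP _ (him x)).trans ?_
        have : ‖expL L (-(x * Complex.I))‖ ≤ 1 := by
          rw [norm_expL, Real.exp_le_one_iff]
          simp only [Complex.neg_im, Complex.mul_im, Complex.ofReal_re, Complex.I_im,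
            Complex.ofReal_im, Complex.I_re]
          nlinarith
        nlinarith
    · refine ExpType.norm_le_of_axes (f := fun k => expL L (-k) * P (-k))
        ((expType_expL L).comp_neg.mul eP.comp_neg)
        (((differentiable_expL L).comp differentiable_neg).mul (dP.comp differentiable_neg))
        (fun x => ?_) (fun x hx => ?_) hk
      · have := bP (-x) (by rw [neg_sq, hre])
        rw [norm_mul]
        rw [norm_expL] at this ⊢
        simpa using this
      · have e := bP (-(x * Complex.I)) (by rw [neg_sq, him])
        rw [norm_mul]
        rw [neg_neg] at e
        have e1 : ‖expL L (-(x * Complex.I))‖ * ‖expL L (x * Complex.I)‖ = 1 := by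
          rw [mul_comm, ← norm_mul, expL_mul_expL_neg, norm_one]
        have e2 : ‖expL L (-(x * Complex.I))‖ ≤ 1 := by
          rw [norm_expL, Real.exp_le_one_iff]
          simp only [Complex.neg_im, Complex.mul_im, Complex.ofReal_re, Complex.I_im,
            Complex.ofReal_im, Complex.I_re]
          nlinarith
        calc _ ≤ ‖expL L (-(x * Complex.I))‖ * (C + ‖expL L (x * Complex.I)‖ * D) := by gcongr
          _ = ‖expL L (-(x * Complex.I))‖ * C + D := by linear_combination D * e1
          _ ≤ _ := by nlinarith
  · rw [← mul_assoc, expL_mul_expL_neg, one_mul, hP, neg_neg]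
    ring

end SideAsymptotics

/-! ### Leading terms of the parts of the integrands -/

/-- `f = c/k + O(k⁻²)` in the closed second and fourth quadrants. -/
def LeadsWith (c : ℂ) (f : ℂ → ℂ) : Prop :=
  ∃ C, 0 ≤ C ∧ ∀ k : ℂ, 1 ≤ ‖k‖ → (k ^ 2).im ≤ 0 → ‖f k - c * k⁻¹‖ ≤ C * ‖k⁻¹‖ ^ 2

/-- `n/Δ = d/k + O(k⁻²)` in the closed lower half plane, away from the zeros of `Δ`. -/
def QuotientLeadsWith (L : ℝ) (d : ℂ) (n : ℂ → ℂ) : Prop :=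
  ∃ C, 0 ≤ C ∧ ∀ k : ℂ, k.im ≤ 0 → 1 ≤ ‖k‖ →
    ‖n k - d * k⁻¹ * Delta L k‖ ≤ C * ‖expL L k‖ * ‖k⁻¹‖ ^ 2

theorem LeadsWith.add {c d : ℂ} {f g : ℂ → ℂ} (hf : LeadsWith c f) (hg : LeadsWith d g) :
    LeadsWith (c + d) fun k => f k + g k := by
  obtain ⟨C, hC, h⟩ := hf
  obtain ⟨D, hD, h'⟩ := hg
  refine ⟨C + D, by positivity, fun k hk hk' => ?_⟩
  rw [show f k + g k - (c + d) * k⁻¹ = (f k - c * k⁻¹) + (g k - d * k⁻¹) by ring, add_mul C]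
  exact (norm_add_le _ _).trans (add_le_add (h k hk hk') (h' k hk hk'))

theorem LeadsWith.const_mul {c : ℂ} {f : ℂ → ℂ} (a : ℂ) (hf : LeadsWith c f) :
    LeadsWith (a * c) fun k => a * f k := by
  obtain ⟨C, hC, h⟩ := hf
  refine ⟨‖a‖ * C, by positivity, fun k hk hk' => ?_⟩
  rw [show a * f k - a * c * k⁻¹ = a * (f k - c * k⁻¹) by ring, norm_mul, mul_assoc]
  exact mul_le_mul_of_nonneg_left (h k hk hk') (norm_nonneg _)

theorem one_le_norm_expL {L : ℝ} (hL : 0 ≤ L) {k : ℂ} (hk : k.im ≤ 0) : 1 ≤ ‖expL L k‖ := by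
  rw [norm_expL]
  exact Real.one_le_exp (by nlinarith)

theorem norm_expL_neg_le {L : ℝ} (hL : 0 ≤ L) {k : ℂ} (hk : k.im ≤ 0) : ‖expL L (-k)‖ ≤ 1 := by
  rw [norm_expL, Real.exp_le_one_iff, Complex.neg_im]
  nlinarith

namespace SideAsymptotics

variable {F₁ F₂ G₁ G₂ : ℂ → ℂ} {a₁ a₂ b A₁ A₂ B : ℂ}

/-- The region is described through k², hence contains −k along with k. The terms with a₁ cancel in
the even part, and the error O(k⁻³) survives the factor k as O(k⁻²). -/
theorem leadsWith_evenPart_fst (h : SideAsymptotics F₁ F₂ a₁ a₂ b) :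
    LeadsWith (2 * a₂) fun k => k * evenPart F₁ k := by
  obtain ⟨C, hC, h⟩ := h.bound
  refine ⟨2 * C, by positivity, fun k hk hk' => ?_⟩
  have hk0 : k ≠ 0 := by rintro rfl; norm_num at hk
  have e1 := (h k hk hk').1
  have e2 := (h (-k) (by rwa [norm_neg]) (by rwa [neg_sq])).1
  rw [inv_neg, norm_neg] at e2
  have hkκ : k * k⁻¹ = 1 := mul_inv_cancel₀ hk0
  have hκk : ‖k‖ * ‖k⁻¹‖ = 1 := by rw [← norm_mul, hkκ, norm_one]
  generalize k⁻¹ = κ at *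
  have e : k * evenPart F₁ k - 2 * a₂ * κ
      = k * ((F₁ k - a₁ * κ - a₂ * κ ^ 2) + (F₁ (-k) - a₁ * -κ - a₂ * (-κ) ^ 2)) := by
    rw [evenPart]; linear_combination (-2 * a₂ * κ) * hkκ * (-1)
  rw [e, norm_mul]
  calc _ ≤ ‖k‖ * (C * ‖κ‖ ^ 3 + C * ‖κ‖ ^ 3) := by
        gcongr; exact (norm_add_le _ _).trans (add_le_add e1 e2)
    _ = 2 * C * ‖κ‖ ^ 2 := by linear_combination (2 * C * ‖κ‖ ^ 2) * hκk

theorem leadsWith_oddPart_fst (h : SideAsymptotics F₁ F₂ a₁ a₂ b) :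
    LeadsWith (2 * a₁) (oddPart F₁) := by
  obtain ⟨C, hC, h⟩ := h.bound
  refine ⟨2 * C + 2 * ‖a₂‖, by positivity, fun k hk hk' => ?_⟩
  have e1 := (h k hk hk').1
  have e2 := (h (-k) (by rwa [norm_neg]) (by rwa [neg_sq])).1
  rw [inv_neg, norm_neg] at e2
  have hκ1 : ‖k⁻¹‖ ≤ 1 := by rw [norm_inv]; exact inv_le_one_of_one_le₀ hk
  generalize k⁻¹ = κ at *
  have e : oddPart F₁ k - 2 * a₁ * κ
      = (F₁ k - a₁ * κ - a₂ * κ ^ 2) - (F₁ (-k) - a₁ * -κ - a₂ * (-κ) ^ 2) := by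
    rw [oddPart]; ring
  rw [e]
  have h3 : C * ‖κ‖ ^ 3 ≤ C * ‖κ‖ ^ 2 := by
    gcongr C * ?_
    exact pow_le_pow_of_le_one (norm_nonneg _) hκ1 (by norm_num)
  have h4 : 0 ≤ 2 * ‖a₂‖ * ‖κ‖ ^ 2 := by positivity
  refine (norm_sub_le _ _).trans ?_
  linarith

theorem leadsWith_oddPart_snd (h : SideAsymptotics F₁ F₂ a₁ a₂ b) :
    LeadsWith (2 * b) (oddPart F₂) := by
  obtain ⟨C, hC, h⟩ := h.bound
  refine ⟨2 * C, by positivity, fun k hk hk' => ?_⟩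
  have e1 := (h k hk hk').2
  have e2 := (h (-k) (by rwa [norm_neg]) (by rwa [neg_sq])).2
  rw [inv_neg, norm_neg] at e2
  have e : oddPart F₂ k - 2 * b * k⁻¹ = (F₂ k - 1 - b * k⁻¹) - (F₂ (-k) - 1 - b * -k⁻¹) := by
    rw [oddPart]; ring
  rw [e]
  refine (norm_sub_le _ _).trans ?_
  linarith

/-- The parts of the four integrands with denominator `Δ`. -/
theorem quotientLeadsWith {L : ℝ} (hL : 0 ≤ L) (hF : SideAsymptotics F₁ F₂ a₁ a₂ b)
    (hG : SideAsymptotics G₁ G₂ A₁ A₂ B) {M N : ℂ → ℂ}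
    (hM : M = fun k => F₁ k * bar G₂ k - bar F₂ k * G₁ k * expL L (-k))
    (hN : N = fun k => F₁ k * bar G₂ k * expL L k - bar F₂ k * G₁ k) (hexp : ExpType M) :
    QuotientLeadsWith L (-(A₂ - A₁ * b)) (fun k => -Sig L k * A₁ + 2 * a₁ - k * oddPart M k) ∧
    QuotientLeadsWith L (-(a₂ - a₁ * B)) (fun k => Sig L k * a₁ - 2 * A₁ - k * oddPart N k) ∧
    QuotientLeadsWith L (-A₁) (fun k => -evenPart M k) ∧
    QuotientLeadsWith L (-a₁) (fun k => -evenPart N k) := by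
  rw [hM] at hexp
  obtain ⟨C, P, Q, hC, hPQ, h⟩ := exists_bound_global hL hF hG hexp
  -- Since N = e^{2ikL}M, the one global relation for M serves all four quotients.
  have hNM : ∀ k, N k = expL L k * M k := fun k => by
    rw [hN, hM]; linear_combination (bar F₂ k * G₁ k) * expL_mul_expL_neg L k
  have hM1 : ∀ k, F₁ k * bar G₂ k - bar F₂ k * G₁ k * expL L (-k) = M k := fun k => by rw [hM]
  have hM2 : ∀ k, F₁ (-k) * bar G₂ (-k) - bar F₂ (-k) * G₁ (-k) * expL L k = M (-k) := fun k => by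
    simp only [hM, neg_neg]
  simp only [hM1, hM2] at h
  obtain ⟨m, hm⟩ : ∃ m, m = a₂ - a₁ * B := ⟨_, rfl⟩
  obtain ⟨n, hn⟩ : ∃ n, n = A₂ - A₁ * b := ⟨_, rfl⟩
  rw [← hm, ← hn]
  simp only [← hm, ← hn] at h
  -- After multiplication by k² it suffices to exhibit the remainder as an expression X bounded by a
  -- multiple of |e^{2ikL}|.
  have red : ∀ (d : ℂ) (f X : ℂ → ℂ) (K : ℝ), 0 ≤ K →
      (∀ k : ℂ, k * k⁻¹ = 1 → k ^ 2 * (f k - d * k⁻¹ * Delta L k) = X k) →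
      (∀ k : ℂ, k.im ≤ 0 → ‖k⁻¹‖ ≤ 1 → 1 ≤ ‖expL L k‖ → ‖expL L (-k)‖ ≤ 1 →
        ‖X k‖ ≤ K * ‖expL L k‖) → QuotientLeadsWith L d f := by
    intro d f X K hK h1 h2
    refine ⟨K, hK, fun k hk hk1 => ?_⟩
    have hk0 : k ≠ 0 := by rintro rfl; norm_num at hk1
    have hκ1 : ‖k⁻¹‖ ≤ 1 := by rw [norm_inv]; exact inv_le_one_of_one_le₀ hk1
    have e1 := h1 k (mul_inv_cancel₀ hk0)
    have e2 := h2 k hk hκ1 (one_le_norm_expL hL hk) (norm_expL_neg_le hL hk)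
    rw [show f k - d * k⁻¹ * Delta L k = X k * k⁻¹ ^ 2 by rw [← e1]; field_simp, norm_mul, norm_pow]
    gcongr
  have hE : ∀ k, expL L k * expL L (-k) = 1 := expL_mul_expL_neg L
  -- The remainders come from the relations for M(k) and M(−k): their sum for the odd parts, their
  -- difference, divided by k, for the even parts. For N they are first multiplied by e^{2ikL} and
  -- e^{−2ikL}.
  refine ⟨red _ _ (fun k => -(P k + expL L k * Q k)) (2 * C) (by positivity) (fun k hk => ?_)
      fun k hk _ h1 h2 => ?_,
    red _ _ (fun k => -(expL L k * P k + Q k)) (2 * C) (by positivity) (fun k hk => ?_)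
      fun k hk _ h1 h2 => ?_,
    red _ _ (fun k => -(k⁻¹ * (P k - expL L k * Q k) + 2 * m - n * Sig L k))
      (2 * C + 2 * ‖m‖ + 2 * ‖n‖) (by positivity) (fun k hk => ?_) fun k hk hκ h1 h2 => ?_,
    red _ _ (fun k => -(k⁻¹ * (expL L k * P k - Q k) + m * Sig L k - 2 * n))
      (2 * C + 2 * ‖m‖ + 2 * ‖n‖) (by positivity) (fun k hk => ?_) fun k hk hκ h1 h2 => ?_⟩
  · obtain ⟨e1, e2⟩ := h k
    simp only [Sig, Delta, oddPart]
    linear_combination -e1 - e2 + (n * k * (expL L k - expL L (-k))) * hk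
  · obtain ⟨p1, p2⟩ := hPQ k hk
    rw [norm_neg]
    refine (norm_add_le _ _).trans ?_
    rw [norm_mul]
    nlinarith [mul_le_mul_of_nonneg_left p2 (norm_nonneg (expL L k))]
  · obtain ⟨e1, e2⟩ := h k
    simp only [Sig, Delta, oddPart, hNM]
    linear_combination -expL L k * e1 - expL L (-k) * e2 + (2 * k ^ 2 * A₁ - Q k) * hE k
      + (m * k * (expL L k - expL L (-k))) * hk
  · obtain ⟨p1, p2⟩ := hPQ k hk
    rw [norm_neg]
    refine (norm_add_le _ _).trans ?_
    rw [norm_mul]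
    nlinarith [mul_le_mul_of_nonneg_left p1 (norm_nonneg (expL L k))]
  · obtain ⟨e1, e2⟩ := h k
    simp only [Sig, Delta, evenPart]
    linear_combination -k⁻¹ * (e1 - e2)
      + (k ^ 2 * (M k + M (-k)) - 2 * m + n * (expL L k + expL L (-k))) * hk
  · obtain ⟨p1, p2⟩ := hPQ k hk
    have s1 : ‖P k - expL L k * Q k‖ ≤ C + ‖expL L k‖ * C := by
      refine (norm_sub_le _ _).trans (add_le_add p1 ?_)
      rw [norm_mul]; gcongr
    have s2 : ‖k⁻¹ * (P k - expL L k * Q k)‖ ≤ 1 * (C + ‖expL L k‖ * C) := by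
      rw [norm_mul]; gcongr
    have s3 : ‖n * Sig L k‖ ≤ ‖n‖ * (‖expL L k‖ + 1) := by
      rw [norm_mul]; gcongr; exact (norm_add_le _ _).trans (add_le_add le_rfl h2)
    have s4 : ‖2 * m‖ = 2 * ‖m‖ := by rw [norm_mul, Complex.norm_ofNat]
    rw [norm_neg]
    refine (norm_sub_le _ _).trans ?_
    have s5 := norm_add_le (k⁻¹ * (P k - expL L k * Q k)) (2 * m)
    have s6 := mul_le_mul_of_nonneg_left h1 (norm_nonneg m)
    have s7 := mul_le_mul_of_nonneg_left h1 (norm_nonneg n)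
    have s8 := mul_le_mul_of_nonneg_left h1 hC
    linarith
  · obtain ⟨e1, e2⟩ := h k
    simp only [Sig, Delta, evenPart, hNM]
    linear_combination -k⁻¹ * (expL L k * e1 - expL L (-k) * e2)
      + (k ^ 2 * (expL L k * M k + expL L (-k) * M (-k)) - m * (expL L k + expL L (-k))
        + 2 * n) * hk + (2 * k * k⁻¹ * n + k⁻¹ * Q k) * hE k
  · obtain ⟨p1, p2⟩ := hPQ k hk
    have s1 : ‖expL L k * P k - Q k‖ ≤ ‖expL L k‖ * C + C := by
      refine (norm_sub_le _ _).trans (add_le_add ?_ p2)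
      rw [norm_mul]; gcongr
    have s2 : ‖k⁻¹ * (expL L k * P k - Q k)‖ ≤ 1 * (‖expL L k‖ * C + C) := by
      rw [norm_mul]; gcongr
    have s3 : ‖m * Sig L k‖ ≤ ‖m‖ * (‖expL L k‖ + 1) := by
      rw [norm_mul]; gcongr; exact (norm_add_le _ _).trans (add_le_add le_rfl h2)
    have s4 : ‖2 * n‖ = 2 * ‖n‖ := by rw [norm_mul, Complex.norm_ofNat]
    rw [norm_neg]
    refine (norm_sub_le _ _).trans ?_
    have s5 := norm_add_le (k⁻¹ * (expL L k * P k - Q k)) (m * Sig L k)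
    have s6 := mul_le_mul_of_nonneg_left h1 (norm_nonneg m)
    have s7 := mul_le_mul_of_nonneg_left h1 (norm_nonneg n)
    have s8 := mul_le_mul_of_nonneg_left h1 hC
    linarith

end SideAsymptotics

/-! ### Lower bound for Δ and position of the contour -/

/-- Uses |1 − e^w|² = (1 − e^{Re w})² + 4e^{Re w} sin²(Im w/2). If Re w ≤ −d/2, the first term
suffices. Otherwise Im w is at distance at least d/2 from the nearest multiple of 2π, and Jordan's
inequality bounds the sine from below. -/
theorem exists_le_norm_one_sub_exp {d : ℝ} (hd : 0 < d) :
    ∃ c, 0 < c ∧ ∀ w : ℂ, w.re ≤ 0 →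
      (∀ n : ℤ, d ≤ ‖w - ((2 * Real.pi * n : ℝ) : ℂ) * Complex.I‖) → c ≤ ‖1 - Complex.exp w‖ := by
  have hπ := Real.pi_pos
  have h1 : Real.exp (-(d / 2)) < 1 := by
    rw [← Real.exp_zero]; exact Real.exp_lt_exp.2 (by linarith)
  refine ⟨min (1 - Real.exp (-(d / 2))) (2 * Real.exp (-(d / 4)) * (d / (2 * Real.pi))),
    lt_min (by linarith) (by positivity), fun w hw h => ?_⟩
  rcases le_total w.re (-(d / 2)) with hre | hre
  · refine (min_le_left _ _).trans ?_
    have e1 := norm_sub_norm_le (1 : ℂ) (Complex.exp w)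
    rw [norm_one, Complex.norm_exp] at e1
    linarith [Real.exp_le_exp.2 hre]
  · refine (min_le_right _ _).trans ?_
    refine (abs_le_of_sq_le_sq' ?_ (norm_nonneg _)).2
    have e1 : ‖1 - Complex.exp w‖ ^ 2
        = (1 - Real.exp w.re) ^ 2 + 4 * Real.exp w.re * Real.sin (w.im / 2) ^ 2 := by
      rw [Complex.sq_norm, Complex.normSq_apply, Complex.sub_re, Complex.sub_im, Complex.exp_re,
        Complex.exp_im, Complex.one_re, Complex.one_im]
      have hc : Real.cos w.im = 1 - 2 * Real.sin (w.im / 2) ^ 2 := by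
        have := Real.cos_sq' (w.im / 2)
        have h2 := Real.cos_two_mul (w.im / 2)
        rw [mul_div_cancel₀ _ (two_ne_zero)] at h2
        rw [h2, this]; ring
      have hs := Real.sin_sq_add_cos_sq w.im
      linear_combination (Real.exp w.re) ^ 2 * hs - 2 * Real.exp w.re * hc
    obtain ⟨n, hn⟩ : ∃ n : ℤ, n = round (w.im / (2 * Real.pi)) := ⟨_, rfl⟩
    have e2 : |w.im / 2 - n * Real.pi| ≤ Real.pi / 2 := by
      have := abs_sub_round (w.im / (2 * Real.pi))
      rw [← hn] at this
      rw [show w.im / 2 - n * Real.pi = (w.im / (2 * Real.pi) - n) * Real.pi by field_simp,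
        abs_mul, abs_of_pos hπ]
      nlinarith
    have e3 : d / 2 ≤ 2 * |w.im / 2 - n * Real.pi| := by
      have e := (h n).trans (Complex.norm_le_abs_re_add_abs_im _)
      simp only [Complex.sub_re, Complex.sub_im, Complex.mul_re, Complex.mul_im, Complex.ofReal_re,
        Complex.ofReal_im, Complex.I_re, Complex.I_im, mul_zero, mul_one, sub_zero, add_zero] at e
      rw [abs_of_nonpos hw] at e
      have : |w.im - 2 * Real.pi * n| = 2 * |w.im / 2 - n * Real.pi| := by
        rw [← abs_of_pos (two_pos (α := ℝ)), ← abs_mul, abs_of_pos (two_pos (α := ℝ))]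
        congr 1; ring
      linarith
    have e4 : d / (2 * Real.pi) ≤ |Real.sin (w.im / 2)| := by
      have e5 := Real.mul_abs_le_abs_sin e2
      rw [Real.sin_sub_int_mul_pi, abs_mul, abs_zpow, abs_neg, abs_one, one_zpow, one_mul] at e5
      refine le_trans ?_ e5
      rw [div_mul_eq_mul_div, div_le_div_iff₀ (by positivity) hπ]
      nlinarith
    have e6 : Real.exp (-(d / 4)) ^ 2 ≤ Real.exp w.re := by
      rw [← Real.exp_nat_mul]
      refine Real.exp_le_exp.2 (le_trans (le_of_eq ?_) hre)
      push_cast; ring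
    have e7 : (d / (2 * Real.pi)) ^ 2 ≤ Real.sin (w.im / 2) ^ 2 := by
      rw [← sq_abs (Real.sin _)]
      gcongr
    rw [e1]
    have e8 := mul_le_mul e6 e7 (by positivity) (by positivity)
    nlinarith [sq_nonneg (1 - Real.exp w.re)]

/-- The closed lower half plane with the `ε`-neighbourhoods of the zeros of `Δ` removed. -/
def avoidZeros (L ε : ℝ) : Set ℂ :=
  {k | k.im ≤ 0 ∧ ∀ n : ℤ, ε ≤ ‖k - ((n * Real.pi / (2 * L) : ℝ) : ℂ)‖}

/-- Factor Δ = (1 − e^{−4ikL})e^{2ikL}. The map k ↦ −4ikL scales distances by 4L, hence d = 4Lε. -/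
theorem exists_le_norm_Delta {L ε : ℝ} (hL : 0 < L) (hε : 0 < ε) :
    ∃ c, 0 < c ∧ ∀ k ∈ avoidZeros L ε, c * ‖expL L k‖ ≤ ‖Delta L k‖ := by
  obtain ⟨c, hc, h⟩ := exists_le_norm_one_sub_exp (d := 4 * L * ε) (by positivity)
  refine ⟨c, hc, fun k hk => ?_⟩
  have e1 : Delta L k = (1 - Complex.exp (-4 * Complex.I * L * k)) * expL L k := by
    rw [Delta, expL, expL, sub_mul, ← Complex.exp_add, one_mul]; ring_nf
  rw [e1, norm_mul]
  refine mul_le_mul_of_nonneg_right (h _ ?_ fun n => ?_) (norm_nonneg _)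
  · have : (-4 * Complex.I * L * k).re = 4 * L * k.im := by
      simp
    rw [this]
    nlinarith [hk.1]
  · have e2 := hk.2 (-n)
    have e3 : -4 * Complex.I * L * k - ((2 * Real.pi * n : ℝ) : ℂ) * Complex.I
        = -4 * Complex.I * L * (k - ((((-n : ℤ) : ℝ) * Real.pi / (2 * L) : ℝ) : ℂ)) := by
      have hL' : (L : ℂ) ≠ 0 := by exact_mod_cast hL.ne'
      push_cast
      field_simp
      ring
    rw [e3, norm_mul]
    have e4 : ‖-4 * Complex.I * L‖ = 4 * L := by simp [abs_of_pos hL]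
    rw [e4]
    gcongr

theorem Delta_ne_zero_of_im_neg {L : ℝ} (hL : 0 < L) {k : ℂ} (hk : k.im < 0) : Delta L k ≠ 0 := by
  intro h
  have h1 : ‖expL L k‖ = ‖expL L (-k)‖ := by rw [sub_eq_zero.1 h]
  rw [norm_expL, norm_expL, Complex.neg_im] at h1
  have := Real.exp_injective h1
  nlinarith

theorem Delta_ne_zero_of_mem {L ε : ℝ} (hL : 0 < L) (hε : 0 < ε) {k : ℂ}
    (hk : k ∈ avoidZeros L ε) : Delta L k ≠ 0 := by
  obtain ⟨c, hc, h⟩ := exists_le_norm_Delta hL hε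
  have := h k hk
  have h1 := one_le_norm_expL hL.le hk.1
  intro h0
  rw [h0, norm_zero] at this
  nlinarith

theorem neg_I_mul_mem_avoidZeros {L ε y : ℝ} (hε : 0 < ε) (hy : ε ≤ y) :
    -Complex.I * y ∈ avoidZeros L ε := by
  refine ⟨by simp; linarith, fun n => hy.trans ?_⟩
  refine le_trans ?_ (Complex.abs_im_le_norm _)
  have : (-Complex.I * y).im = -y := by simp
  rw [Complex.sub_im, Complex.ofReal_im, sub_zero, this, abs_neg]
  exact le_abs_self y

theorem im_arc_nonpos {r θ : ℝ} (hr : 0 ≤ r) (h1 : -Real.pi ≤ θ) (h2 : θ ≤ 0) :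
    ((r : ℂ) * Complex.exp (θ * Complex.I)).im ≤ 0 := by
  rw [Complex.im_ofReal_mul, Complex.exp_ofReal_mul_I_im]
  exact mul_nonpos_of_nonneg_of_nonpos hr (Real.sin_nonpos_of_nonpos_of_neg_pi_le h2 h1)

theorem norm_arc {r : ℝ} (hr : 0 ≤ r) (θ : ℝ) :
    ‖(r : ℂ) * Complex.exp (θ * Complex.I)‖ = r := by
  rw [norm_mul, Complex.norm_exp_ofReal_mul_I, Complex.norm_real, Real.norm_of_nonneg hr, mul_one]

/-- The zeros are π/(2L) > 2ε apart, so a circle of radius ε about one of them stays at distance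
more than ε from the others. -/
theorem small_arc_mem_avoidZeros {L ε : ℝ} (hL : 0 < L) (hε : 0 < ε) (hε' : ε < Real.pi / (4 * L))
    (m : ℤ) {θ : ℝ} (h1 : -Real.pi ≤ θ) (h2 : θ ≤ 0) :
    ((m * Real.pi / (2 * L) : ℝ) : ℂ) + ε * Complex.exp (θ * Complex.I) ∈ avoidZeros L ε := by
  refine ⟨by rw [Complex.add_im, Complex.ofReal_im, zero_add]; exact im_arc_nonpos hε.le h1 h2,
    fun n => ?_⟩
  have hn := norm_arc hε.le θ
  generalize (ε : ℂ) * Complex.exp (θ * Complex.I) = u at *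
  rcases eq_or_ne m n with rfl | hmn
  · rw [add_sub_cancel_left, hn]
  · have e1 : (1 : ℝ) ≤ |(m : ℝ) - n| := by
      exact_mod_cast Int.one_le_abs (sub_ne_zero.2 hmn)
    have e2 : ‖((m * Real.pi / (2 * L) : ℝ) : ℂ) - ((n * Real.pi / (2 * L) : ℝ) : ℂ)‖
        = |(m : ℝ) - n| * (Real.pi / (2 * L)) := by
      rw [← Complex.ofReal_sub, Complex.norm_real, Real.norm_eq_abs,
        show (m * Real.pi / (2 * L) - n * Real.pi / (2 * L) : ℝ)
          = (m - n) * (Real.pi / (2 * L)) by ring, abs_mul,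
        abs_of_pos (a := Real.pi / (2 * L)) (by positivity)]
    have e3 := norm_sub_norm_le (((m * Real.pi / (2 * L) : ℝ) : ℂ) - ((n * Real.pi / (2 * L) : ℝ) : ℂ))
      (-u)
    rw [norm_neg, hn, e2] at e3
    have e4 : Real.pi / (2 * L) = 2 * (Real.pi / (4 * L)) := by field_simp; norm_num
    have e5 : 1 * (Real.pi / (2 * L)) ≤ |(m : ℝ) - n| * (Real.pi / (2 * L)) := by gcongr
    rw [show ((m * Real.pi / (2 * L) : ℝ) : ℂ) + u - ((n * Real.pi / (2 * L) : ℝ) : ℂ)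
      = ((m * Real.pi / (2 * L) : ℝ) : ℂ) - ((n * Real.pi / (2 * L) : ℝ) : ℂ) - -u by ring]
    linarith

theorem neg_ofReal_mem_avoidZeros {L ε s : ℝ} (hL : 0 < L) (n : ℕ) (h1 : zeroPt L n + ε ≤ s)
    (h2 : s ≤ zeroPt L (n + 1) - ε) : -(s : ℂ) ∈ avoidZeros L ε := by
  refine ⟨by simp, fun m => ?_⟩
  rw [← Complex.ofReal_neg, ← Complex.ofReal_sub, Complex.norm_real, Real.norm_eq_abs, le_abs]
  have hp : 0 < Real.pi / (2 * L) := by positivity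
  unfold zeroPt at h1 h2
  push_cast at h2
  rcases le_or_gt (-m) (n : ℤ) with h | h
  · right
    have : (-m : ℝ) ≤ n := by exact_mod_cast h
    have := mul_le_mul_of_nonneg_right this hp.le
    have e1 : (-m : ℝ) * (Real.pi / (2 * L)) = -(m * Real.pi / (2 * L)) := by ring
    have e2 : (n : ℝ) * (Real.pi / (2 * L)) = n * Real.pi / (2 * L) := by ring
    linarith
  · left
    have : (n + 1 : ℝ) ≤ -m := by exact_mod_cast h
    have := mul_le_mul_of_nonneg_right this hp.le
    have e1 : (-m : ℝ) * (Real.pi / (2 * L)) = -(m * Real.pi / (2 * L)) := by ring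
    have e2 : (n + 1 : ℝ) * (Real.pi / (2 * L)) = (n + 1) * Real.pi / (2 * L) := by ring
    linarith

/-- The distance from a point of modulus R to a zero is at least the difference of the moduli, and
the set of zeros is symmetric, so the condition on R at nonnegative zeros is enough. -/
theorem big_arc_mem_avoidZeros {L ε R : ℝ} (hR : 0 ≤ R) (hL : 0 < L)
    (h : ∀ n : ℕ, ε ≤ |R - zeroPt L n|) {θ : ℝ} (h1 : -Real.pi ≤ θ) (h2 : θ ≤ 0) :
    (R : ℂ) * Complex.exp (θ * Complex.I) ∈ avoidZeros L ε := by
  refine ⟨im_arc_nonpos hR h1 h2, fun n => (h n.natAbs).trans ?_⟩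
  have e := abs_norm_sub_norm_le ((R : ℂ) * Complex.exp (θ * Complex.I))
    ((n * Real.pi / (2 * L) : ℝ) : ℂ)
  rw [norm_arc hR, Complex.norm_real, Real.norm_eq_abs, mul_div_assoc, abs_mul,
    abs_of_pos (a := Real.pi / (2 * L)) (by positivity)] at e
  rw [zeroPt, Nat.cast_natAbs, Int.cast_abs, mul_div_assoc]
  rwa [mul_div_assoc]

/-! ### Deformation of the contour -/

variable {L ε R : ℝ} {f : ℂ → ℂ}

/-- Paths in the closed lower half plane that avoid the zeros of `Δ` can be shifted downwards. -/
theorem tendsto_integral_shift (hL : 0 < L) (hε : 0 < ε)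
    (hf : ContinuousOn f {k | Delta L k ≠ 0}) {γ w : ℝ → ℂ} (hγ : Continuous γ) (hw : Continuous w)
    {a b : ℝ} (h : ∀ s ∈ uIcc a b, γ s ∈ avoidZeros L ε) :
    Tendsto (fun δ : ℝ => ∫ s in a..b, f (γ s - δ * Complex.I) * w s) (𝓝[>] 0)
      (𝓝 (∫ s in a..b, f (γ s) * w s)) := by
  have hmem : ∀ p ∈ uIcc a b ×ˢ Icc (0 : ℝ) 1,
      γ p.1 - (p.2 : ℂ) * Complex.I ∈ {k | Delta L k ≠ 0} := by
    rintro ⟨s, δ⟩ ⟨hs, hδ⟩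
    rcases hδ.1.eq_or_lt with h0 | h0
    · have h0' : δ = 0 := h0.symm
      simp only [h0', Complex.ofReal_zero, zero_mul, sub_zero]
      exact Delta_ne_zero_of_mem hL hε (h s hs)
    · refine Delta_ne_zero_of_im_neg hL ?_
      have := (h s hs).1
      have e : ((δ : ℂ) * Complex.I).im = δ := by simp
      change (γ s - (δ : ℂ) * Complex.I).im < 0
      rw [Complex.sub_im, e]
      dsimp only at h0
      linarith
  have hc : ContinuousOn (fun p : ℝ × ℝ => f (γ p.1 - (p.2 : ℂ) * Complex.I) * w p.1)
      (uIcc a b ×ˢ Icc (0 : ℝ) 1) :=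
    (hf.comp (f := fun p : ℝ × ℝ => γ p.1 - (p.2 : ℂ) * Complex.I)
      (by fun_prop) hmem).mul (by fun_prop)
  obtain ⟨C, hC⟩ := (isCompact_uIcc.prod isCompact_Icc).exists_bound_of_continuousOn hc
  have hev : ∀ᶠ δ : ℝ in 𝓝[>] 0, δ ∈ Icc (0 : ℝ) 1 := by
    filter_upwards [Ioo_mem_nhdsGT (zero_lt_one' ℝ)] with δ hδ using ⟨hδ.1.le, hδ.2.le⟩
  refine intervalIntegral.tendsto_integral_filter_of_dominated_convergence (fun _ => C) ?_ ?_ ?_ ?_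
  · filter_upwards [hev] with δ hδ
    have : ContinuousOn (fun s => f (γ s - (δ : ℂ) * Complex.I) * w s) (uIcc a b) :=
      hc.comp (f := fun s => (s, δ)) (by fun_prop) fun s hs => ⟨hs, hδ⟩
    exact (this.mono uIoc_subset_uIcc).aestronglyMeasurable measurableSet_uIoc
  · filter_upwards [hev] with δ hδ
    exact Eventually.of_forall fun s hs => hC (s, δ) ⟨uIoc_subset_uIcc hs, hδ⟩
  · exact intervalIntegrable_const
  · refine Eventually.of_forall fun s hs => ?_
    have h1 := (hc (s, 0) ⟨uIoc_subset_uIcc hs, ⟨le_rfl, zero_le_one⟩⟩)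
    have h2 : Tendsto (fun δ : ℝ => (s, δ)) (𝓝[>] 0) (𝓝[uIcc a b ×ˢ Icc (0 : ℝ) 1] (s, 0)) := by
      refine tendsto_nhdsWithin_iff.2 ⟨?_, hev.mono fun δ hδ => ⟨uIoc_subset_uIcc hs, hδ⟩⟩
      exact ((Continuous.prodMk_right s).tendsto 0).mono_left nhdsWithin_le_nhds
    have h3 := h1.tendsto.comp h2
    simpa [Function.comp_def] using h3

theorem integral_comp_path {S : Set ℂ} {g G : ℂ → ℂ} (hG : ∀ k ∈ S, HasDerivAt G (g k) k)
    (hg : ContinuousOn g S) {γ γ' : ℝ → ℂ} (hγ : ∀ s, HasDerivAt γ (γ' s) s) (hγ' : Continuous γ')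
    {a b : ℝ} (h : ∀ s ∈ uIcc a b, γ s ∈ S) :
    ∫ s in a..b, g (γ s) * γ' s = G (γ b) - G (γ a) := by
  have hc : Continuous γ := continuous_iff_continuousAt.2 fun s => (hγ s).continuousAt
  refine intervalIntegral.integral_eq_sub_of_hasDerivAt (f := fun s => G (γ s))
    (fun s hs => (hG _ (h s hs)).comp s (hγ s)) ?_
  exact ((hg.comp hc.continuousOn h).mul hγ'.continuousOn).intervalIntegrable

theorem hasDerivAt_arc (c : ℂ) (r s : ℝ) :
    HasDerivAt (fun θ : ℝ => c + r * Complex.exp (θ * Complex.I))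
      (Complex.I * r * Complex.exp (s * Complex.I)) s := by
  have := (((Complex.ofRealCLM.hasDerivAt (x := s)).mul_const Complex.I).cexp.const_mul
    (r : ℂ)).const_add c
  exact this.congr_deriv (by simp; ring)

theorem arcIntegral_eq_sub {S : Set ℂ} {g G : ℂ → ℂ} (hG : ∀ k ∈ S, HasDerivAt G (g k) k)
    (hg : ContinuousOn g S) {c : ℂ} {r a b : ℝ}
    (h : ∀ θ ∈ uIcc a b, c + r * Complex.exp (θ * Complex.I) ∈ S) :
    arcIntegral c r a b g
      = G (c + r * Complex.exp (b * Complex.I)) - G (c + r * Complex.exp (a * Complex.I)) :=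
  integral_comp_path hG hg (hasDerivAt_arc c r) (by fun_prop) h

theorem exp_neg_pi_mul_I : Complex.exp ((-Real.pi : ℝ) * Complex.I) = -1 := by
  rw [Complex.ofReal_neg, neg_mul, Complex.exp_neg, Complex.exp_pi_mul_I]; norm_num

theorem exp_neg_pi_div_two_mul_I :
    Complex.exp ((-(Real.pi / 2) : ℝ) * Complex.I) = -Complex.I := by
  rw [Complex.ofReal_neg, neg_mul, Complex.exp_neg, Complex.ofReal_div, Complex.ofReal_ofNat,
    Complex.exp_pi_div_two_mul_I, Complex.inv_I]

theorem uIcc_neg_pi_div_two {θ : ℝ} (h : θ ∈ uIcc (-(Real.pi / 2)) (-Real.pi)) :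
    -Real.pi ≤ θ ∧ θ ≤ 0 := by
  have := Real.pi_pos
  rw [uIcc_of_ge (by linarith)] at h
  exact ⟨h.1, by linarith [h.2]⟩

theorem uIcc_zero_neg_pi {θ : ℝ} (h : θ ∈ uIcc 0 (-Real.pi)) : -Real.pi ≤ θ ∧ θ ≤ 0 := by
  rwa [uIcc_of_ge (by linarith [Real.pi_pos])] at h

theorem zeroPt_nonneg (hL : 0 < L) (n : ℕ) : 0 ≤ zeroPt L n := by
  have := Real.pi_pos
  unfold zeroPt; positivity

theorem zeroPt_mono (hL : 0 < L) {m n : ℕ} (h : m ≤ n) : zeroPt L m ≤ zeroPt L n := by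
  have := Real.pi_pos
  unfold zeroPt; gcongr

theorem zeroPt_add_le (hL : 0 < L) (hε' : ε < Real.pi / (4 * L)) (n : ℕ) :
    zeroPt L n + ε ≤ zeroPt L (n + 1) - ε := by
  have e4 : Real.pi / (2 * L) = 2 * (Real.pi / (4 * L)) := by field_simp; norm_num
  have : zeroPt L (n + 1) = zeroPt L n + Real.pi / (2 * L) := by
    unfold zeroPt; push_cast; ring
  linarith

/-- For admissible R the floor counts the zeros n ≥ 1 whose indentations are complete before −R is
reached, and the last segment of the contour does not run backwards. -/
theorem zeroPt_floor (hL : 0 < L) (hR : 0 ≤ R) (h : ∀ n : ℕ, ε ≤ |R - zeroPt L n|) :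
    zeroPt L ⌊2 * L * R / Real.pi⌋₊ + ε ≤ R ∧ R ≤ zeroPt L (⌊2 * L * R / Real.pi⌋₊ + 1) - ε := by
  have hπ := Real.pi_pos
  have h1 := Nat.floor_le (a := 2 * L * R / Real.pi) (by positivity)
  have h2 := Nat.lt_floor_add_one (2 * L * R / Real.pi)
  generalize ⌊2 * L * R / Real.pi⌋₊ = N at *
  have e1 : zeroPt L N ≤ R := by
    unfold zeroPt
    rw [div_le_iff₀ (by positivity)]
    rw [le_div_iff₀ hπ] at h1
    linarith
  have e2 : R ≤ zeroPt L (N + 1) := by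
    unfold zeroPt
    rw [le_div_iff₀ (by positivity)]
    rw [div_lt_iff₀ hπ] at h2
    push_cast
    linarith
  have h3 := h N
  have h4 := h (N + 1)
  rw [abs_of_nonneg (by linarith)] at h3
  rw [abs_of_nonpos (by linarith)] at h4
  constructor <;> linarith

/-- Membership of the pieces of the contour in a set. -/
structure ContourIn (L ε R : ℝ) (S : Set ℂ) : Prop where
  vertical : ∀ y ∈ uIcc ε R, -Complex.I * (y : ℂ) ∈ S
  arc_zero : ∀ θ ∈ uIcc (-(Real.pi / 2)) (-Real.pi), 0 + (ε : ℂ) * Complex.exp (θ * Complex.I) ∈ S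
  segment : ∀ n < ⌊2 * L * R / Real.pi⌋₊, ∀ s ∈ uIcc (zeroPt L n + ε) (zeroPt L (n + 1) - ε),
    -(s : ℂ) ∈ S
  arc : ∀ n < ⌊2 * L * R / Real.pi⌋₊, ∀ θ ∈ uIcc 0 (-Real.pi),
    -(zeroPt L (n + 1) : ℂ) + ε * Complex.exp (θ * Complex.I) ∈ S
  last : ∀ s ∈ uIcc (zeroPt L ⌊2 * L * R / Real.pi⌋₊ + ε) R, -(s : ℂ) ∈ S
  arc_big : ∀ θ ∈ uIcc (-(Real.pi / 2)) (-Real.pi), 0 + (R : ℂ) * Complex.exp (θ * Complex.I) ∈ S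

theorem contourIn_avoidZeros (hL : 0 < L) (hε : 0 < ε) (hε' : ε < Real.pi / (4 * L)) (hR : ε ≤ R)
    (h : ∀ n : ℕ, ε ≤ |R - zeroPt L n|) :
    ContourIn L ε R (avoidZeros L ε ∩ Metric.closedBall 0 (R + ε)) := by
  have hR0 : 0 ≤ R := hε.le.trans hR
  obtain ⟨f1, f2⟩ := zeroPt_floor hL hR0 h
  have hnorm : ∀ (x r : ℝ) (θ : ℝ), 0 ≤ x → 0 ≤ r → x ≤ R → r ≤ ε →
      -(x : ℂ) + r * Complex.exp (θ * Complex.I) ∈ Metric.closedBall (0 : ℂ) (R + ε) := by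
    intro x r θ hx hr h1 h2
    rw [mem_closedBall_zero_iff]
    refine (norm_add_le _ _).trans ?_
    rw [norm_arc hr, norm_neg, Complex.norm_real, Real.norm_of_nonneg hx]
    linarith
  have hreal : ∀ x : ℝ, 0 ≤ x → x ≤ R → -(x : ℂ) ∈ Metric.closedBall (0 : ℂ) (R + ε) := by
    intro x h1 h2
    simpa using hnorm x 0 0 h1 le_rfl h2 hε.le
  have hbd : ∀ n < ⌊2 * L * R / Real.pi⌋₊, zeroPt L (n + 1) ≤ R := fun n hn => by
    have := zeroPt_mono hL (Nat.succ_le_of_lt hn)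
    have e : zeroPt L n.succ = zeroPt L (n + 1) := rfl
    linarith
  constructor
  · intro y hy
    rw [uIcc_of_le hR] at hy
    refine ⟨neg_I_mul_mem_avoidZeros hε hy.1, ?_⟩
    rw [mem_closedBall_zero_iff]
    simp only [norm_mul, norm_neg, Complex.norm_I, one_mul, Complex.norm_real]
    rw [Real.norm_of_nonneg (hε.le.trans hy.1)]
    linarith [hy.2]
  · intro θ hθ
    obtain ⟨h1, h2⟩ := uIcc_neg_pi_div_two hθ
    have e1 := small_arc_mem_avoidZeros hL hε hε' 0 h1 h2
    have e2 := hnorm 0 ε θ le_rfl hε.le hR0 le_rfl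
    rw [Complex.ofReal_zero, neg_zero] at e2
    exact ⟨by simpa using e1, e2⟩
  · intro n hn s hs
    rw [uIcc_of_le (zeroPt_add_le hL hε' n)] at hs
    exact ⟨neg_ofReal_mem_avoidZeros hL n hs.1 hs.2,
      hreal s (by linarith [zeroPt_nonneg hL n, hs.1]) (by linarith [hbd n hn, hs.2])⟩
  · intro n hn θ hθ
    obtain ⟨h1, h2⟩ := uIcc_zero_neg_pi hθ
    have e1 := small_arc_mem_avoidZeros hL hε hε' (-(n + 1 : ℕ)) h1 h2
    refine ⟨?_, hnorm _ ε θ (zeroPt_nonneg hL _) hε.le (hbd n hn) le_rfl⟩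
    convert e1 using 2
    unfold zeroPt; push_cast; ring
  · intro s hs
    rw [uIcc_of_le f1] at hs
    exact ⟨neg_ofReal_mem_avoidZeros hL _ hs.1 (hs.2.trans f2),
      hreal s (by linarith [zeroPt_nonneg hL ⌊2 * L * R / Real.pi⌋₊, hs.1]) hs.2⟩
  · intro θ hθ
    obtain ⟨h1, h2⟩ := uIcc_neg_pi_div_two hθ
    rw [zero_add]
    refine ⟨big_arc_mem_avoidZeros hR0 hL h h1 h2, ?_⟩
    rw [mem_closedBall_zero_iff, norm_arc hR0]
    linarith

/-- Both paths lead from −iR to −R; with a primitive available on all pieces the contributions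
telescope. -/
theorem truncatedIntegral_eq_sub {S : Set ℂ} {g G : ℂ → ℂ} (hG : ∀ k ∈ S, HasDerivAt G (g k) k)
    (hg : ContinuousOn g S) (h : ContourIn L ε R S) :
    truncatedIntegral L ε R g = arcIntegral 0 R (-(Real.pi / 2)) (-Real.pi) g := by
  have hneg : ∀ s : ℝ, HasDerivAt (fun s : ℝ => -(s : ℂ)) (-1) s := fun s =>
    (Complex.ofRealCLM.hasDerivAt (x := s)).neg
  have e1 : ∫ y in ε..R, g (-Complex.I * y) * Complex.I
      = G (-Complex.I * ε) - G (-Complex.I * R) := by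
    have := integral_comp_path hG hg (γ := fun y : ℝ => -Complex.I * y) (γ' := fun _ => -Complex.I)
      (fun s => ((Complex.ofRealCLM.hasDerivAt (x := s)).const_mul (-Complex.I)).congr_deriv
        (by simp)) continuous_const h.vertical
    simp only [mul_neg, intervalIntegral.integral_neg] at this
    linear_combination -this
  have e2 : ∀ a b : ℝ, (∀ s ∈ uIcc a b, -(s : ℂ) ∈ S) →
      ∫ s in a..b, g (-(s : ℂ)) = G (-(a : ℂ)) - G (-(b : ℂ)) := by
    intro a b hab
    have := integral_comp_path hG hg hneg continuous_const hab
    simp only [mul_neg, mul_one, intervalIntegral.integral_neg] at this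
    linear_combination -this
  have e3 := arcIntegral_eq_sub hG hg h.arc_zero
  have e4 := arcIntegral_eq_sub hG hg h.arc_big
  rw [exp_neg_pi_mul_I, exp_neg_pi_div_two_mul_I] at e3 e4
  have e5 : ∑ n ∈ Finset.range ⌊2 * L * R / Real.pi⌋₊,
        (-(∫ s in (zeroPt L n + ε)..(zeroPt L (n + 1) - ε), g (-(s : ℂ)))
          + arcIntegral (-(zeroPt L (n + 1) : ℂ)) ε 0 (-Real.pi) g)
      = G (-((zeroPt L ⌊2 * L * R / Real.pi⌋₊ + ε : ℝ) : ℂ)) - G (-((zeroPt L 0 + ε : ℝ) : ℂ)) := by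
    rw [← Finset.sum_range_sub (fun n => G (-((zeroPt L n + ε : ℝ) : ℂ)))]
    refine Finset.sum_congr rfl fun n hn => ?_
    rw [Finset.mem_range] at hn
    rw [e2 _ _ (h.segment n hn), arcIntegral_eq_sub hG hg (h.arc n hn), exp_neg_pi_mul_I]
    have a1 : -(zeroPt L (n + 1) : ℂ) + ε * Complex.exp ((0 : ℝ) * Complex.I)
        = -((zeroPt L (n + 1) - ε : ℝ) : ℂ) := by
      rw [Complex.ofReal_zero, zero_mul, Complex.exp_zero]; push_cast; ring
    have a2 : -(zeroPt L (n + 1) : ℂ) + ε * -1 = -((zeroPt L (n + 1) + ε : ℝ) : ℂ) := by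
      push_cast; ring
    rw [a1, a2]
    ring
  have e6 : zeroPt L 0 = 0 := by simp [zeroPt]
  rw [truncatedIntegral, e1, e3, e5, e2 _ _ h.last, e4, e6]
  have a3 : (0 : ℂ) + ε * -1 = -((0 + ε : ℝ) : ℂ) := by push_cast; ring
  have a4 : (0 : ℂ) + ε * -Complex.I = -Complex.I * ε := by ring
  have a5 : (0 : ℂ) + R * -1 = -(R : ℂ) := by ring
  have a6 : (0 : ℂ) + R * -Complex.I = -Complex.I * R := by ring
  rw [a3, a4, a5, a6]
  ring

/-- The indented contour can be deformed into a circular arc. -/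
theorem truncatedIntegral_eq_arcIntegral (hL : 0 < L) (hε : 0 < ε) (hε' : ε < Real.pi / (4 * L))
    (hR : ε ≤ R) (h : ∀ n : ℕ, ε ≤ |R - zeroPt L n|)
    (hf : DifferentiableOn ℂ f {k | Delta L k ≠ 0}) :
    truncatedIntegral L ε R f = arcIntegral 0 R (-(Real.pi / 2)) (-Real.pi) f := by
  have hC := contourIn_avoidZeros hL hε hε' hR h
  have hc := hf.continuousOn
  -- The zeros of Δ are real, so the translated function is holomorphic for Im k < δ. A primitive on
  -- one large disc there covers the whole contour, although the indentations wind around the zeros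
  -- of Δ; then δ → 0.
  have hshift : ∀ δ : ℝ, 0 < δ → truncatedIntegral L ε R (fun k => f (k - δ * Complex.I))
      = arcIntegral 0 R (-(Real.pi / 2)) (-Real.pi) (fun k => f (k - δ * Complex.I)) := by
    intro δ hδ
    -- The disc with centre −iM and radius M + δ lies in Im k < δ. It contains the lower half of the
    -- disc of radius R + ε, because (R + ε)² + M² = Mδ + M² < (M + δ)².
    obtain ⟨M, hM⟩ : ∃ M, M = (R + ε) ^ 2 / δ := ⟨_, rfl⟩
    have hM0 : 0 ≤ M := by rw [hM]; positivity
    have hMδ : M * δ = (R + ε) ^ 2 := by rw [hM]; field_simp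
    have hd : DifferentiableOn ℂ (fun k => f (k - δ * Complex.I))
        (Metric.ball (-(M : ℂ) * Complex.I) (M + δ)) := by
      refine hf.comp (by fun_prop) fun k hk => ?_
      refine Delta_ne_zero_of_im_neg hL ?_
      rw [mem_ball_iff_norm] at hk
      have h1 := (Complex.abs_im_le_norm _).trans_lt hk
      simp only [Complex.sub_im, Complex.mul_im, Complex.neg_re, Complex.ofReal_re, Complex.I_im,
        Complex.neg_im, Complex.ofReal_im, Complex.I_re, mul_one, mul_zero, add_zero] at h1 ⊢
      linarith [(abs_lt.1 h1).2]
    obtain ⟨G, hG⟩ := hd.isExactOn_ball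
    have hsub : avoidZeros L ε ∩ Metric.closedBall 0 (R + ε)
        ⊆ Metric.ball (-(M : ℂ) * Complex.I) (M + δ) := by
      rintro k ⟨hk1, hk2⟩
      rw [mem_closedBall_zero_iff] at hk2
      rw [mem_ball_iff_norm]
      refine (abs_lt_of_sq_lt_sq' ?_ (by positivity)).2
      have e1 : ‖k - -(M : ℂ) * Complex.I‖ ^ 2 = ‖k‖ ^ 2 + 2 * M * k.im + M ^ 2 := by
        rw [Complex.sq_norm, Complex.sq_norm, Complex.normSq_apply, Complex.normSq_apply]
        simp
        ring
      have e2 : ‖k‖ ^ 2 ≤ (R + ε) ^ 2 := by gcongr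
      have e3 : M * k.im ≤ 0 := mul_nonpos_of_nonneg_of_nonpos hM0 hk1.1
      nlinarith [sq_nonneg (R + ε)]
    exact truncatedIntegral_eq_sub (fun k hk => hG k (hsub hk)) (hd.continuousOn.mono hsub) hC
  have harc : ∀ (c : ℂ) (r a b : ℝ),
      (∀ θ ∈ uIcc a b, c + r * Complex.exp (θ * Complex.I) ∈ avoidZeros L ε) →
      Tendsto (fun δ : ℝ => arcIntegral c r a b (fun k => f (k - δ * Complex.I))) (𝓝[>] 0)
        (𝓝 (arcIntegral c r a b f)) := fun c r a b hab =>
    tendsto_integral_shift hL hε hc (by fun_prop) (by fun_prop) hab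
  have hseg : ∀ a b : ℝ, (∀ s ∈ uIcc a b, -(s : ℂ) ∈ avoidZeros L ε) →
      Tendsto (fun δ : ℝ => ∫ s in a..b, f (-(s : ℂ) - δ * Complex.I)) (𝓝[>] 0)
        (𝓝 (∫ s in a..b, f (-(s : ℂ)))) := fun a b hab => by
    simpa only [mul_one] using tendsto_integral_shift hL hε hc (γ := fun s : ℝ => -(s : ℂ))
      (w := fun _ => 1) (by fun_prop) continuous_const hab
  have l1 := tendsto_integral_shift hL hε hc (γ := fun y : ℝ => -Complex.I * y)
    (w := fun _ => Complex.I) (by fun_prop) continuous_const fun y hy => (hC.vertical y hy).1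
  have l2 := harc _ _ _ _ fun θ hθ => (hC.arc_zero θ hθ).1
  have l3 := tendsto_finsetSum (Finset.range ⌊2 * L * R / Real.pi⌋₊) fun n hn =>
    ((hseg _ _ fun s hs => (hC.segment n (Finset.mem_range.1 hn) s hs).1).neg).add
      (harc _ _ _ _ fun θ hθ => (hC.arc n (Finset.mem_range.1 hn) θ hθ).1)
  have l4 := hseg _ _ fun s hs => (hC.last s hs).1
  have l5 := harc _ _ _ _ fun θ hθ => (hC.arc_big θ hθ).1
  have l6 := ((l1.add l2).add l3).sub l4
  refine tendsto_nhds_unique (l6.congr' ?_) l5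
  filter_upwards [self_mem_nhdsWithin] with δ hδ
  exact hshift δ hδ

/-- Along the arc dk/k = i dθ, so c/k contributes ci(b − a), while an error O(R⁻²) over a length
O(R) is O(R⁻¹). -/
theorem norm_arcIntegral_sub_le {g : ℂ → ℂ} {S : Set ℂ} {a b C : ℝ} {c : ℂ} (hR : 0 < R)
    (hg : ContinuousOn g S)
    (hS : ∀ θ ∈ uIcc a b, 0 + (R : ℂ) * Complex.exp (θ * Complex.I) ∈ S)
    (h : ∀ θ ∈ uIcc a b, ‖g (0 + (R : ℂ) * Complex.exp (θ * Complex.I))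
      - c * (0 + (R : ℂ) * Complex.exp (θ * Complex.I))⁻¹‖ ≤ C * R⁻¹ ^ 2) :
    ‖arcIntegral 0 R a b g - c * Complex.I * (b - a)‖ ≤ C * |b - a| * R⁻¹ := by
  have hc : ContinuousOn (fun θ : ℝ => g (0 + (R : ℂ) * Complex.exp (θ * Complex.I)) *
      (Complex.I * R * Complex.exp (θ * Complex.I))) (uIcc a b) :=
    (hg.comp (f := fun θ : ℝ => 0 + (R : ℂ) * Complex.exp (θ * Complex.I)) (by fun_prop) hS).mul
      (by fun_prop)
  have e1 : arcIntegral 0 R a b g - c * Complex.I * (b - a) = ∫ θ in a..b,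
      (g (0 + (R : ℂ) * Complex.exp (θ * Complex.I)) *
        (Complex.I * R * Complex.exp (θ * Complex.I)) - c * Complex.I) := by
    rw [intervalIntegral.integral_sub hc.intervalIntegrable intervalIntegrable_const,
      intervalIntegral.integral_const, arcIntegral]
    simp only [Complex.real_smul, Complex.ofReal_sub]
    ring
  rw [e1]
  refine (intervalIntegral.norm_integral_le_of_norm_le_const (C := C * R⁻¹) fun θ hθ => ?_).trans
    (le_of_eq (by ring))
  have h1 := h θ (uIoc_subset_uIcc hθ)
  have hne : (R : ℂ) * Complex.exp (θ * Complex.I) ≠ 0 :=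
    mul_ne_zero (by exact_mod_cast hR.ne') (Complex.exp_ne_zero _)
  have hn := norm_arc hR.le θ
  rw [zero_add] at h1 ⊢
  rw [mul_assoc Complex.I]
  generalize (R : ℂ) * Complex.exp (θ * Complex.I) = k at *
  rw [show g k * (Complex.I * k) - c * Complex.I = (g k - c * k⁻¹) * (Complex.I * k) by
    field_simp, norm_mul, norm_mul, Complex.norm_I, one_mul, hn]
  calc _ ≤ C * R⁻¹ ^ 2 * R := by gcongr
    _ = C * R⁻¹ := by field_simp

/-- An odd entire function has equal integrals over the arcs in the third and fourth quadrants. -/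
theorem arcIntegral_odd {o : ℂ → ℂ} (ho : Differentiable ℂ o) (hodd : ∀ k, o (-k) = -o k) (R : ℝ) :
    arcIntegral 0 R (-(Real.pi / 2)) (-Real.pi) o = arcIntegral 0 R (-(Real.pi / 2)) 0 o := by
  obtain ⟨G, hG⟩ := ho.isExactOn_univ
  have h1 := fun a b : ℝ => arcIntegral_eq_sub (a := a) (b := b) (c := 0) (r := R) hG
    ho.continuous.continuousOn (fun _ _ => mem_univ _)
  rw [h1, h1, exp_neg_pi_mul_I, Complex.ofReal_zero, zero_mul, Complex.exp_zero]
  -- A primitive of an odd function is even, so the end points −R and R of the two arcs give the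
  -- same value.
  have hd : ∀ k, HasDerivAt (fun k => G k - G (-k)) 0 k := fun k => by
    have h2 := (hG (-k) (mem_univ _)).comp k (hasDerivAt_neg k)
    exact ((hG k (mem_univ _)).sub h2).congr_deriv (by rw [hodd]; ring)
  have hconst := is_const_of_deriv_eq_zero (fun k => (hd k).differentiableAt)
    (fun k => (hd k).deriv) (R : ℂ) 0
  simp only [neg_zero, sub_self] at hconst
  have e : G ((0 : ℂ) + R * -1) = G (0 + R * 1) := by
    rw [zero_add, zero_add, mul_neg_one, mul_one]
    linear_combination -hconst
  rw [e]

/-! ### Evaluation of the contour integrals -/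

theorem differentiable_Delta (L : ℝ) : Differentiable ℂ (Delta L) :=
  (differentiable_expL L).sub ((differentiable_expL L).comp differentiable_neg)

/-- Evaluation of the contour integral by closing the contour: the part without denominator is moved
to the fourth quadrant. -/
theorem hasContourIntegral_of_split (hL : 0 < L) (hε : 0 < ε) (hε' : ε < Real.pi / (4 * L))
    {o n : ℂ → ℂ} {c d : ℂ} (ho : Differentiable ℂ o) (hodd : ∀ k, o (-k) = -o k)
    (hn : Differentiable ℂ n) (hf : ∀ k, Delta L k ≠ 0 → f k = o k + n k / Delta L k)
    (hoc : LeadsWith c o) (hnd : QuotientLeadsWith L d n) :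
    HasContourIntegral L ε f (Complex.I * Real.pi / 2 * (c - d)) := by
  have hπ := Real.pi_pos
  obtain ⟨C, hC, hC'⟩ := hoc
  obtain ⟨D, hD, hD'⟩ := hnd
  obtain ⟨c₀, hc₀, hΔ⟩ := exists_le_norm_Delta hL hε
  have dq : DifferentiableOn ℂ (fun k => n k / Delta L k) {k | Delta L k ≠ 0} :=
    hn.differentiableOn.div (differentiable_Delta L).differentiableOn fun k hk => hk
  have df : DifferentiableOn ℂ f {k | Delta L k ≠ 0} :=
    (ho.differentiableOn.add dq).congr fun k hk => hf k hk
  unfold HasContourIntegral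
  rw [tendsto_iff_norm_sub_tendsto_zero]
  have hlim : Tendsto (fun R : ℝ => (C * (Real.pi / 2) + D / c₀ * (Real.pi / 2)) * R⁻¹)
      (atTop ⊓ 𝓟 {R : ℝ | ∀ n : ℕ, ε ≤ |R - zeroPt L n|}) (𝓝 0) := by
    have := (tendsto_inv_atTop_zero (𝕜 := ℝ)).const_mul
      (C * (Real.pi / 2) + D / c₀ * (Real.pi / 2))
    rw [mul_zero] at this
    exact this.mono_left inf_le_left
  refine squeeze_zero' (Eventually.of_forall fun _ => norm_nonneg _) ?_ hlim
  rw [eventually_inf_principal]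
  filter_upwards [eventually_ge_atTop ε, eventually_ge_atTop 1] with R hR hR1 hadm
  have hR0 : 0 < R := by linarith
  have hmem := (contourIn_avoidZeros hL hε hε' hR hadm).arc_big
  have hmemΔ : ∀ θ ∈ uIcc (-(Real.pi / 2)) (-Real.pi),
      0 + (R : ℂ) * Complex.exp (θ * Complex.I) ∈ {k | Delta L k ≠ 0} := fun θ hθ =>
    Delta_ne_zero_of_mem hL hε (hmem θ hθ).1
  have hsplit : arcIntegral 0 R (-(Real.pi / 2)) (-Real.pi) f
      = arcIntegral 0 R (-(Real.pi / 2)) (-Real.pi) o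
        + arcIntegral 0 R (-(Real.pi / 2)) (-Real.pi) (fun k => n k / Delta L k) := by
    unfold arcIntegral
    rw [← intervalIntegral.integral_add]
    · refine intervalIntegral.integral_congr fun θ hθ => ?_
      simp only
      rw [hf _ (hmemΔ θ hθ), add_mul]
    · have hc := ho.continuous
      exact Continuous.intervalIntegrable (by fun_prop) _ _
    · refine ContinuousOn.intervalIntegrable ?_
      exact (dq.continuousOn.comp
        (f := fun θ : ℝ => 0 + (R : ℂ) * Complex.exp (θ * Complex.I)) (by fun_prop) hmemΔ).mul
        (by fun_prop)
  rw [truncatedIntegral_eq_arcIntegral hL hε hε' hR hadm df, hsplit, arcIntegral_odd ho hodd]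
  -- The arc for o turns by +π/2 into the fourth quadrant, the arc for n/Δ by −π/2 through the
  -- third. This produces the difference c − d.
  have b1 := norm_arcIntegral_sub_le (a := -(Real.pi / 2)) (b := 0) (C := C) (c := c) hR0
    ho.continuous.continuousOn (S := univ) (fun _ _ => mem_univ _) (fun θ hθ => by
      rw [uIcc_of_le (by linarith)] at hθ
      have hn := norm_arc hR0.le θ
      rw [zero_add]
      have := hC' ((R : ℂ) * Complex.exp (θ * Complex.I)) (by rw [hn]; exact hR1) (by
        rw [mul_pow, ← Complex.exp_nat_mul, ← Complex.ofReal_pow, Complex.im_ofReal_mul,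
          show ((2 : ℕ) : ℂ) * (θ * Complex.I) = ((2 * θ : ℝ) : ℂ) * Complex.I by push_cast; ring,
          Complex.exp_ofReal_mul_I_im]
        exact mul_nonpos_of_nonneg_of_nonpos (by positivity)
          (Real.sin_nonpos_of_nonpos_of_neg_pi_le (by linarith [hθ.2]) (by linarith [hθ.1])))
      rwa [norm_inv, hn] at this)
  have b2 := norm_arcIntegral_sub_le (a := -(Real.pi / 2)) (b := -Real.pi) (C := D / c₀) (c := d)
    hR0 dq.continuousOn hmemΔ (fun θ hθ => by
      have hn := norm_arc hR0.le θ
      have hm := (hmem θ hθ).1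
      have hne := hmemΔ θ hθ
      rw [zero_add] at hm hne ⊢
      generalize (R : ℂ) * Complex.exp (θ * Complex.I) = k at *
      have e1 := hD' k hm.1 (by rw [hn]; exact hR1)
      have e2 := hΔ k hm
      rw [norm_inv, hn] at e1
      have hne' : 0 < ‖Delta L k‖ := norm_pos_iff.2 hne
      rw [show n k / Delta L k - d * k⁻¹ = (n k - d * k⁻¹ * Delta L k) / Delta L k by
        field_simp [show Delta L k ≠ 0 from hne], norm_div, div_le_iff₀ hne']
      calc _ ≤ _ := e1
        _ = D / c₀ * R⁻¹ ^ 2 * (c₀ * ‖expL L k‖) := by field_simp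
        _ ≤ _ := by gcongr)
  have e1 : |0 - -(Real.pi / 2)| = Real.pi / 2 := by
    rw [zero_sub, neg_neg, abs_of_pos (by positivity)]
  have e2 : |-Real.pi - -(Real.pi / 2)| = Real.pi / 2 := by
    rw [abs_of_nonpos (by linarith)]; ring
  rw [e1] at b1
  rw [e2] at b2
  have e3 : arcIntegral 0 R (-(Real.pi / 2)) 0 o
        + arcIntegral 0 R (-(Real.pi / 2)) (-Real.pi) (fun k => n k / Delta L k)
        - Complex.I * Real.pi / 2 * (c - d)
      = (arcIntegral 0 R (-(Real.pi / 2)) 0 o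
          - c * Complex.I * ((0 : ℝ) - (-(Real.pi / 2) : ℝ)))
        + (arcIntegral 0 R (-(Real.pi / 2)) (-Real.pi) (fun k => n k / Delta L k)
          - d * Complex.I * ((-Real.pi : ℝ) - (-(Real.pi / 2) : ℝ))) := by
    push_cast; ring
  rw [e3]
  refine (norm_add_le _ _).trans ?_
  linarith

/-- The contour integral formulas for the boundary values. -/
theorem SideAsymptotics.hasContourIntegral {L ε : ℝ} (hL : 0 < L) (hε : 0 < ε)
    (hε' : ε < Real.pi / (4 * L)) {Φ₁ Φ₂ φ₁ φ₂ : ℂ → ℂ} {g₀ g₁ h₀ h₁ B b : ℂ}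
    (hΦ : SideAsymptotics Φ₁ Φ₂ (g₀ / (2 * Complex.I)) (g₁ / 4 + g₀ / (2 * Complex.I) * B) B)
    (hφ : SideAsymptotics φ₁ φ₂ (h₀ / (2 * Complex.I)) (h₁ / 4 + h₀ / (2 * Complex.I) * b) b)
    (hexp : ExpType fun k => φ₁ k * bar Φ₂ k - bar φ₂ k * Φ₁ k * expL L (-k)) :
    HasContourIntegral L ε (integrand_g₁ L g₀ h₀ Φ₁ Φ₂ φ₁ φ₂) (Real.pi * Complex.I / 4 * g₁) ∧
    HasContourIntegral L ε (integrand_h₁ L g₀ h₀ Φ₁ Φ₂ φ₁ φ₂) (Real.pi * Complex.I / 4 * h₁) ∧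
    HasContourIntegral L ε (integrand_g₀ L Φ₁ Φ₂ φ₁ φ₂) (Real.pi / 2 * g₀) ∧
    HasContourIntegral L ε (integrand_h₀ L Φ₁ Φ₂ φ₁ φ₂) (Real.pi / 2 * h₀) := by
  have hI := Complex.I_mul_I
  have hg : g₀ = 2 * Complex.I * (g₀ / (2 * Complex.I)) := by field_simp
  have hh : h₀ = 2 * Complex.I * (h₀ / (2 * Complex.I)) := by field_simp
  generalize g₀ / (2 * Complex.I) = A at *
  generalize h₀ / (2 * Complex.I) = a at *
  have hgi : g₀ / (4 * Complex.I) = A / 2 := by rw [hg]; field_simp; ring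
  have hhi : h₀ / (4 * Complex.I) = a / 2 := by rw [hh]; field_simp; ring
  have hIg : Complex.I * g₀ = -2 * A := by rw [hg]; linear_combination 2 * A * hI
  have hIh : Complex.I * h₀ = -2 * a := by rw [hh]; linear_combination 2 * a * hI
  obtain ⟨M, hM⟩ : ∃ M : ℂ → ℂ, M = fun k => φ₁ k * bar Φ₂ k - bar φ₂ k * Φ₁ k * expL L (-k) :=
    ⟨_, rfl⟩
  obtain ⟨N, hN⟩ : ∃ N : ℂ → ℂ, N = fun k => φ₁ k * bar Φ₂ k * expL L k - bar φ₂ k * Φ₁ k :=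
    ⟨_, rfl⟩
  have dΦ₁ := hΦ.diff_fst
  have dΦ₂ := hΦ.diff_snd
  have dφ₁ := hφ.diff_fst
  have dφ₂ := hφ.diff_snd
  have dΦ₂' := differentiable_bar dΦ₂
  have dφ₂' := differentiable_bar dφ₂
  have dE := differentiable_expL L
  have dE' : Differentiable ℂ fun k => expL L (-k) := dE.comp differentiable_neg
  have dS : Differentiable ℂ (Sig L) := dE.add dE'
  have dM : Differentiable ℂ M := by rw [hM]; fun_prop
  have dN : Differentiable ℂ N := by rw [hN]; fun_prop
  have dodd : ∀ {f : ℂ → ℂ}, Differentiable ℂ f → Differentiable ℂ (oddPart f) := fun hf =>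
    hf.sub (hf.comp differentiable_neg)
  have deven : ∀ {f : ℂ → ℂ}, Differentiable ℂ f → Differentiable ℂ (evenPart f) := fun hf =>
    hf.add (hf.comp differentiable_neg)
  have hodd : ∀ (f : ℂ → ℂ) k, oddPart f (-k) = -oddPart f k := fun f k => by
    simp only [oddPart, neg_neg]; ring
  have heven : ∀ (f : ℂ → ℂ) k, evenPart f (-k) = evenPart f k := fun f k => by
    simp only [evenPart, neg_neg]; ring
  -- The side x = L plays the role of F and the side x = 0 that of G.
  obtain ⟨q1, q2, q3, q4⟩ := SideAsymptotics.quotientLeadsWith hL.le hφ hΦ hM hN (hM ▸ hexp)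
  have oM := dodd dM
  have oN := dodd dN
  have eM := deven dM
  have eN := deven dN
  have o1 := dodd dΦ₁
  have o2 := dodd dΦ₂
  have o3 := dodd dφ₁
  have o4 := dodd dφ₂
  have e1 := deven dΦ₁
  have e2 := deven dφ₁
  have l1 := hΦ.leadsWith_evenPart_fst
  have l2 := hΦ.leadsWith_oddPart_fst
  have l3 := hΦ.leadsWith_oddPart_snd
  have l4 := hφ.leadsWith_evenPart_fst
  have l5 := hφ.leadsWith_oddPart_fst
  have l6 := hφ.leadsWith_oddPart_snd
  refine ⟨?_, ?_, ?_, ?_⟩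
  -- The terms −1 in the bracket cancel φ₁ and combine with (Σ/2)Φ₁₋ so that Δ divides out, which
  -- leaves k(Φ₁)₊/2. Here c = g₁/4 − AB + Ab and d = −(g₁/4 + AB − Ab), with A = g₀/(2i), hence c −
  -- d = g₁/2. The formula for h₁ is the same with the sides exchanged.
  · have := hasContourIntegral_of_split (f := integrand_g₁ L g₀ h₀ Φ₁ Φ₂ φ₁ φ₂) hL hε hε'
      (o := fun k => 1 / 2 * (k * evenPart Φ₁ k) + A / 2 * oddPart φ₂ k + -A * oddPart Φ₂ k)
      (by fun_prop) (fun k => by simp only [hodd, heven]; ring) (by fun_prop)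
      (fun k hk => by
        have hk' : Delta L k ≠ 0 := hk
        simp only [integrand_g₁, hgi, hIg, hIh, hM, Sig, oddPart, evenPart, neg_neg]
        field_simp
        simp only [Delta]
        ring)
      (((l1.const_mul _).add (l6.const_mul _)).add (l3.const_mul _)) q1
    convert this using 1
    ring
  · have := hasContourIntegral_of_split (f := integrand_h₁ L g₀ h₀ Φ₁ Φ₂ φ₁ φ₂) hL hε hε'
      (o := fun k => 1 / 2 * (k * evenPart φ₁ k) + a / 2 * oddPart Φ₂ k + -a * oddPart φ₂ k)
      (by fun_prop) (fun k => by simp only [hodd, heven]; ring) (by fun_prop)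
      (fun k hk => by
        have hk' : Delta L k ≠ 0 := hk
        simp only [integrand_h₁, hhi, hIg, hIh, hN, Sig, oddPart, evenPart]
        field_simp
        simp only [Delta]
        ring)
      (((l4.const_mul _).add (l3.const_mul _)).add (l6.const_mul _)) q2
    convert this using 1
    ring
  -- The same cancellation with even and odd parts exchanged leaves (Φ₁)₋/2, so c = A, d = −A and c
  -- − d = 2A = g₀/i.
  · have := hasContourIntegral_of_split (f := integrand_g₀ L Φ₁ Φ₂ φ₁ φ₂) hL hε hε'
      (o := fun k => 1 / 2 * oddPart Φ₁ k)
      (by fun_prop) (fun k => by simp only [hodd]; ring) (by fun_prop)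
      (fun k hk => by
        have hk' : Delta L k ≠ 0 := hk
        simp only [integrand_g₀, hM, Sig, oddPart, evenPart, neg_neg]
        field_simp
        simp only [Delta]
        ring)
      (l2.const_mul _) q3
    convert this using 1
    rw [hg]; ring
  · have := hasContourIntegral_of_split (f := integrand_h₀ L Φ₁ Φ₂ φ₁ φ₂) hL hε hε'
      (o := fun k => 1 / 2 * oddPart φ₁ k)
      (by fun_prop) (fun k => by simp only [hodd]; ring) (by fun_prop)
      (fun k hk => by
        have hk' : Delta L k ≠ 0 := hk
        simp only [integrand_h₀, hN, Sig, oddPart, evenPart]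
        field_simp
        simp only [Delta]
        ring)
      (l5.const_mul _) q4
    convert this using 1
    rw [hh]; ring

/-! ### Application to the eigenfunctions and conclusion -/

namespace SmoothData

variable {lam L T : ℝ} {q qx qxx qt qtt qxt qxtt : ℝ → ℝ → ℂ}

theorem tSys_of_isEigenfunction (D : SmoothData lam L T q qx qxx qt qtt qxt qxtt) {x₀ t₀ : ℝ}
    (hx₀ : x₀ ∈ Icc 0 L) (ht₀ : t₀ ∈ Icc 0 T) {μ : ℝ → ℝ → ℂ → Matrix (Fin 2) (Fin 2) ℂ}
    (hμ : IsEigenfunction lam L T q x₀ t₀ μ) (k : ℂ) :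
    TSys lam T (q x₀) (qx x₀) k (fun t => μ x₀ t k 0 1) (fun t => μ x₀ t k 1 1) :=
  (D.laxSol_of_isEigenfunction hx₀ ht₀ hμ k).1.t_part

theorem eigenfunction_bar (D : SmoothData lam L T q qx qxx qt qtt qxt qxtt) {x₀ : ℝ}
    (hx₀ : x₀ ∈ Icc 0 L) {μ : ℝ → ℝ → ℂ → Matrix (Fin 2) (Fin 2) ℂ}
    (hμ : IsEigenfunction lam L T q x₀ 0 μ) {t : ℝ} (ht : t ∈ Icc 0 T) (k : ℂ) :
    μ x₀ t k 0 0 = bar (fun k => μ x₀ t k 1 1) k := by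
  rw [D.eigenfunction_symm hx₀ (Or.inl rfl) hμ ht k]
  simp [symMatrix]

theorem volterraSystem (D : SmoothData lam L T q qx qxx qt qtt qxt qxtt) {x₀ : ℝ}
    (hx₀ : x₀ ∈ Icc 0 L) {μ : ℝ → ℝ → ℂ → Matrix (Fin 2) (Fin 2) ℂ}
    (hμ : IsEigenfunction lam L T q x₀ 0 μ) {g₀ g₁ : ℝ → ℂ} (hg₀ : ∀ t ∈ Icc 0 T, q x₀ t = g₀ t)
    (hg₁ : ∀ t ∈ Icc 0 T, HasDerivWithinAt (fun x => q x t) (g₁ t) (Icc 0 L) x₀) :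
    VolterraSystem lam T g₀ g₁ (fun t k => μ x₀ t k 0 1) (fun t k => μ x₀ t k 1 1) := by
  have n0 : (0 : ℝ) ∈ Icc 0 T := D.mem_Icc_right (Or.inl rfl)
  have h0 := D.isEigenfunction_corner hx₀ n0 hμ
  refine TSys.volterraSystem (continuousOn_slice_snd D.cont hx₀) (continuousOn_slice_snd D.cont_x hx₀)
    (D.tSys_of_isEigenfunction hx₀ n0 hμ) (fun k => by simp [h0]) (fun k => by simp [h0]) hg₀
    fun t ht => ?_
  exact (uniqueDiffOn_Icc D.L_pos x₀ hx₀).eq_deriv _ (D.deriv_x x₀ hx₀ t ht) (hg₁ t ht)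

theorem sideAsymptotics (D : SmoothData lam L T q qx qxx qt qtt qxt qxtt) {x₀ : ℝ}
    (hx₀ : x₀ ∈ Icc 0 L) {μ : ℝ → ℝ → ℂ → Matrix (Fin 2) (Fin 2) ℂ}
    (hμ : IsEigenfunction lam L T q x₀ 0 μ) {t : ℝ} (ht : t ∈ Icc 0 T) {g₀ g₁ : ℂ}
    (hg₀ : q x₀ t = g₀) (hg₁ : HasDerivWithinAt (fun x => q x t) g₁ (Icc 0 L) x₀) :
    ∃ b, SideAsymptotics (fun k => μ x₀ t k 0 1) (fun k => μ x₀ t k 1 1) (g₀ / (2 * Complex.I))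
      (g₁ / 4 + g₀ / (2 * Complex.I) * b) b := by
  have n0 : (0 : ℝ) ∈ Icc 0 T := D.mem_Icc_right (Or.inl rfl)
  have h0 := D.isEigenfunction_corner hx₀ n0 hμ
  have hs := D.tSys_of_isEigenfunction hx₀ n0 hμ
  have hx : qx x₀ t = g₁ :=
    (uniqueDiffOn_Icc D.L_pos x₀ hx₀).eq_deriv _ (D.deriv_x x₀ hx₀ t ht) hg₁
  have i1 : ∀ k, μ x₀ 0 k 0 1 = 0 := fun k => by simp [h0]
  have i2 : ∀ k, μ x₀ 0 k 1 1 = 1 := fun k => by simp [h0]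
  obtain ⟨b, hb, C, hC, h⟩ := D.asymptotics hx₀ (F₁ := fun t k => μ x₀ t k 0 1)
    (F₂ := fun t k => μ x₀ t k 1 1) hs i1 i2
  have hd := TSys.differentiable (F₁ := fun t k => μ x₀ t k 0 1)
    (F₂ := fun t k => μ x₀ t k 1 1) D.T_pos.le (continuousOn_slice_snd D.cont hx₀)
    (continuousOn_slice_snd D.cont_x hx₀) hs i1 i2 ht
  subst hg₀ hx
  exact ⟨b t, hd.1, hd.2, hb t ht, C, hC, fun k hk hk' => h k hk hk' t ht⟩

theorem expType_global (D : SmoothData lam L T q qx qxx qt qtt qxt qxtt)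
    {μ ν : ℝ → ℝ → ℂ → Matrix (Fin 2) (Fin 2) ℂ} (hμ : IsEigenfunction lam L T q 0 0 μ)
    (hν : IsEigenfunction lam L T q L 0 ν) {t : ℝ} (ht : t ∈ Icc 0 T) :
    ExpType fun k => ν L t k 0 1 * bar (fun k => μ 0 t k 1 1) k
      - bar (fun k => ν L t k 1 1) k * μ 0 t k 0 1 * expL L (-k) := by
  obtain ⟨C, hC, h⟩ := D.exists_exp_bound hμ hν ht
  have hCe : C ≤ Real.exp C := by linarith [Real.add_one_le_exp C]
  refine ⟨Real.exp C, (Real.exp_nonneg _), fun k => ?_⟩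
  beta_reduce
  rw [← D.eigenfunction_bar (D.mem_Icc_left (Or.inl rfl)) hμ ht,
    ← D.eigenfunction_bar (D.mem_Icc_left (Or.inr rfl)) hν ht]
  refine (h k).trans ?_
  rw [add_comm, Real.exp_add]
  gcongr

end SmoothData

end NLSInterval

open NLSInterval
theorem theorem3p1 :
    ∃ N : ℕ, ∀ (lam L T : ℝ) (q : ℝ → ℝ → ℂ) (g₀ g₁ h₀ h₁ : ℝ → ℂ),
      (lam = 1 ∨ lam = -1) → 0 < L → 0 < T →
      IsSolution N lam L T q → HasBoundaryValues L T q g₀ g₁ h₀ h₁ →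
      -- the four eigenfunctions exist and are unique
      (∀ x₀ ∈ ({0, L} : Set ℝ), ∀ t₀ ∈ ({0, T} : Set ℝ),
        (∃ μ, IsEigenfunction lam L T q x₀ t₀ μ) ∧
        ∀ μ μ', IsEigenfunction lam L T q x₀ t₀ μ → IsEigenfunction lam L T q x₀ t₀ μ' →
          ∀ x ∈ Icc 0 L, ∀ t ∈ Icc 0 T, ∀ k, μ x t k = μ' x t k) ∧
      ∀ μ₁ μ₂ μ₃ μ₄ : ℝ → ℝ → ℂ → Matrix (Fin 2) (Fin 2) ℂ,
        IsEigenfunction lam L T q 0 T μ₁ → IsEigenfunction lam L T q 0 0 μ₂ →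
        IsEigenfunction lam L T q L 0 μ₃ → IsEigenfunction lam L T q L T μ₄ →
        ∀ (A B cA cB : ℂ → ℂ) (Φ₁ Φ₂ φ₁ φ₂ : ℝ → ℂ → ℂ),
          (∀ k, A k = μ₁ 0 0 k 1 1) → (∀ k, B k = μ₁ 0 0 k 0 1) →
          (∀ k, cA k = μ₄ L 0 k 1 1) → (∀ k, cB k = μ₄ L 0 k 0 1) →
          (∀ t k, Φ₁ t k = μ₂ 0 t k 0 1) → (∀ t k, Φ₂ t k = μ₂ 0 t k 1 1) →
          (∀ t k, φ₁ t k = μ₃ L t k 0 1) → (∀ t k, φ₂ t k = μ₃ L t k 1 1) →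
          -- the matrices have the form by which the scalar functions are defined
          (∀ k, μ₁ 0 0 k = symMatrix lam B A k) ∧
          (∀ k, μ₄ L 0 k = symMatrix lam cB cA k) ∧
          (∀ t ∈ Icc 0 T, ∀ k, μ₂ 0 t k = symMatrix lam (Φ₁ t) (Φ₂ t) k) ∧
          (∀ t ∈ Icc 0 T, ∀ k, μ₃ L t k = symMatrix lam (φ₁ t) (φ₂ t) k) ∧
          -- the spectral functions
          (∀ k, A k = bar (Φ₂ T) k) ∧
          (∀ k, B k = -Φ₁ T k * Complex.exp (4 * Complex.I * k ^ 2 * T)) ∧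
          (∀ k, cA k = bar (φ₂ T) k) ∧
          (∀ k, cB k = -φ₁ T k * Complex.exp (4 * Complex.I * k ^ 2 * T)) ∧
          -- the integral equations
          VolterraSystem lam T g₀ g₁ Φ₁ Φ₂ ∧
          VolterraSystem lam T h₀ h₁ φ₁ φ₂ ∧
          -- the contour integral representations of the boundary values
          ∀ ε : ℝ, 0 < ε → ε < Real.pi / (4 * L) → ∀ t ∈ Icc 0 T,
            -- (a) the Dirichlet problem
            ((∃ J, HasContourIntegral L ε
                (integrand_g₁ L (g₀ t) (h₀ t) (Φ₁ t) (Φ₂ t) (φ₁ t) (φ₂ t)) J ∧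
                g₁ t = 4 / (Real.pi * Complex.I) * J) ∧
              (∃ J, HasContourIntegral L ε
                (integrand_h₁ L (g₀ t) (h₀ t) (Φ₁ t) (Φ₂ t) (φ₁ t) (φ₂ t)) J ∧
                h₁ t = 4 / (Real.pi * Complex.I) * J)) ∧
            -- (b) the Neumann problem
            ((∃ J, HasContourIntegral L ε
                (integrand_g₀ L (Φ₁ t) (Φ₂ t) (φ₁ t) (φ₂ t)) J ∧
                g₀ t = 2 / Real.pi * J) ∧
              (∃ J, HasContourIntegral L ε
                (integrand_h₀ L (Φ₁ t) (Φ₂ t) (φ₁ t) (φ₂ t)) J ∧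
                h₀ t = 2 / Real.pi * J)) := by
  -- Four derivatives are ample: the residual of the large-k expansion involves derivatives of q
  -- only up to q_tt and q_xtt.
  refine ⟨4, fun lam L T q g₀ g₁ h₀ h₁ _ hL hT hq hbv => ?_⟩
  obtain ⟨qx, qxx, qt, qtt, qxt, qxtt, D⟩ := hq.exists_smoothData hL hT
  have m0 : (0 : ℝ) ∈ Icc 0 L := D.mem_Icc_left (Or.inl rfl)
  have mL : L ∈ Icc 0 L := D.mem_Icc_left (Or.inr rfl)
  have n0 : (0 : ℝ) ∈ Icc 0 T := D.mem_Icc_right (Or.inl rfl)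
  have nT : T ∈ Icc 0 T := D.mem_Icc_right (Or.inr rfl)
  refine ⟨fun x₀ hx₀ t₀ ht₀ => ⟨D.exists_isEigenfunction hx₀ ht₀, fun μ μ' hμ hμ' x hx t ht k =>
    D.isEigenfunction_unique hx₀ ht₀ hμ hμ' hx ht k⟩, ?_⟩
  intro μ₁ μ₂ μ₃ μ₄ hμ₁ hμ₂ hμ₃ hμ₄ A B cA cB Φ₁ Φ₂ φ₁ φ₂ hA hB hcA hcB hΦ₁ hΦ₂ hφ₁ hφ₂
  obtain rfl : A = _ := funext hA
  obtain rfl : B = _ := funext hB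
  obtain rfl : cA = _ := funext hcA
  obtain rfl : cB = _ := funext hcB
  obtain rfl : Φ₁ = _ := funext₂ hΦ₁
  obtain rfl : Φ₂ = _ := funext₂ hΦ₂
  obtain rfl : φ₁ = _ := funext₂ hφ₁
  obtain rfl : φ₂ = _ := funext₂ hφ₂
  refine ⟨fun k => D.eigenfunction_symm m0 (Or.inr rfl) hμ₁ n0 k,
    fun k => D.eigenfunction_symm mL (Or.inr rfl) hμ₄ n0 k,
    fun t ht k => D.eigenfunction_symm m0 (Or.inl rfl) hμ₂ ht k,
    fun t ht k => D.eigenfunction_symm mL (Or.inl rfl) hμ₃ ht k,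
    fun k => (D.eigenfunction_top_bottom m0 hμ₁ hμ₂ k).1.trans (D.eigenfunction_bar m0 hμ₂ nT k),
    fun k => (D.eigenfunction_top_bottom m0 hμ₁ hμ₂ k).2,
    fun k => (D.eigenfunction_top_bottom mL hμ₄ hμ₃ k).1.trans (D.eigenfunction_bar mL hμ₃ nT k),
    fun k => (D.eigenfunction_top_bottom mL hμ₄ hμ₃ k).2,
    D.volterraSystem m0 hμ₂ hbv.left_dirichlet hbv.left_neumann,
    D.volterraSystem mL hμ₃ hbv.right_dirichlet hbv.right_neumann, fun ε hε hε' t ht => ?_⟩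
  obtain ⟨b, hb⟩ := D.sideAsymptotics m0 hμ₂ ht (hbv.left_dirichlet t ht) (hbv.left_neumann t ht)
  obtain ⟨b', hb'⟩ := D.sideAsymptotics mL hμ₃ ht (hbv.right_dirichlet t ht)
    (hbv.right_neumann t ht)
  obtain ⟨c₁, c₂, c₃, c₄⟩ := SideAsymptotics.hasContourIntegral hL hε hε' hb hb'
    (D.expType_global hμ₂ hμ₃ ht)
  have hπ : (Real.pi : ℂ) ≠ 0 := by exact_mod_cast Real.pi_ne_zero
  exact ⟨⟨⟨_, c₁, by field_simp⟩, ⟨_, c₂, by field_simp⟩⟩, ⟨_, c₃, by field_simp⟩,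
    ⟨_, c₄, by field_simp⟩⟩
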